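/- Let $p\in(1,\infty)$ and write $W^{1,p}=W^{1,p}((0,1);\mathbb R^2)$, whose elements are identified with their continuous representatives on $(0,1)$. "Homeomorphism" means homeomorphism of $(0,1)$ onto its image. Call $y\in W^{1,p}$ *non-interpenetrative* if there is a bounded sequence $(\tilde y_k)\subset W^{1,p}$ of homeomorphisms with $\tilde y_k\to y$ uniformly on $(0,1)$. Let $f:\mathbb R^2\to[0,+\infty]$ be finite and continuous on $\mathbb R^2\setminus\{0\}$, with $f(0)=+\infty$, and suppose that for every $\delta>0$ there is $c_\delta>0$ such that $f(a)\le c_\delta(1+|a|^p)$ for all $|a|\ge\delta$. For $y\in W^{1,p}$ put $$\mathcal I(y)=\begin{cases}\int_0^1 f(y'(x))\,dx&\text{if $y$ is a homeomorphism},\\+\infty&\text{else,}\end{cases}$$ $$\mathcal I^{\rm rel}(y)=\inf\Big\{\liminf_{k\to\infty}\mathcal I(y_k)\;:\;(y_k)\subset W^{1,p},\ y_k\rightharpoonup y\text{ weakly in }W^{1,p}\Big\},$$ $$\mathcal I^{C}(y)=\begin{cases}\int_0^1 \mathcal Cf(y'(x))\,dx&\text{if $y$ is non-interpenetrative},\\+\infty&\text{else,}\end{cases}$$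 where $\mathcal Cf=\sup\{g:\ g:\mathbb R^2\to\mathbb R\text{ convex},\ g\le f\}$. Then: 1. $\mathcal I^{\rm rel}(y)=\mathcal I^{C}(y)$ for every $y\in W^{1,p}$. 2. For every $y\in W^{1,p}$, the infimum defining $\mathcal I^{\rm rel}(y)$ does not change if only sequences of piecewise affine homeomorphisms $y_k\rightharpoonup y$ are admitted (with $\inf\emptyset=+\infty$); here piecewise affine means affine on each of finitely many intervals partitioning $(0,1)$. 3. If in addition $f$ is $p$-coercive, i.e. there are $c>0$ and $C\in\mathbb R$ with $f(a)\ge c|a|^p-C$ for all $a\in\mathbb R^2$, then for every non-interpenetrative $y$ the infimum is attained by piecewise affine homeomorphisms: there are piecewise affine homeomorphisms $y_k\in W^{1,p}$ with $y_k\rightharpoonup y$ weakly in $W^{1,p}$ and $\lim_{k\to\infty}\mathcal I(y_k)=\mathcal I^{\rm rel}(y)$. -/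

import Mathlib

open MeasureTheory Filter Topology Set
open scoped ENNReal

noncomputable section

/-- The plane `ℝ²` with its Euclidean norm. -/
abbrev Plane : Type := EuclideanSpace ℝ (Fin 2)

/-- Lebesgue measure on the open interval `(0,1)`. -/
abbrev unitVol : Measure ℝ := volume.restrict (Ioo (0 : ℝ) 1)

/-- Smooth real test functions with compact support contained in `(0,1)`. -/
structure IsTestFun (φ : ℝ → ℝ) : Prop where
  smooth : ContDiff ℝ (⊤ : ℕ∞) φ
  compact : HasCompactSupport φ
  support : tsupport φ ⊆ Ioo (0 : ℝ) 1

/-- `g` is the weak derivative of `u` on `(0,1)`. -/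
def IsWeakDeriv (u g : ℝ → Plane) : Prop :=
  ∀ φ : ℝ → ℝ, IsTestFun φ →
    ∫ x, deriv φ x • u x ∂unitVol = - ∫ x, φ x • g x ∂unitVol

theorem IsTestFun.bdd {φ : ℝ → ℝ} (hφ : IsTestFun φ) : ∃ C : ℝ, ∀ x, ‖φ x‖ ≤ C :=
  hφ.smooth.continuous.bounded_above_of_compact_support hφ.compact

theorem IsTestFun.continuous_deriv {φ : ℝ → ℝ} (hφ : IsTestFun φ) : Continuous (deriv φ) :=
  hφ.smooth.continuous_deriv (by simp)

theorem IsTestFun.bdd_deriv {φ : ℝ → ℝ} (hφ : IsTestFun φ) :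
    ∃ C : ℝ, ∀ x, ‖deriv φ x‖ ≤ C :=
  hφ.continuous_deriv.bounded_above_of_compact_support hφ.compact.deriv

theorem IsTestFun.integrable_smul {φ : ℝ → ℝ} (hφ : IsTestFun φ) {u : ℝ → Plane}
    (hu : Integrable u unitVol) : Integrable (fun x => φ x • u x) unitVol := by
  obtain ⟨C, hC⟩ := hφ.bdd
  exact hu.bdd_smul C hφ.smooth.continuous.aestronglyMeasurable (ae_of_all _ hC)

theorem IsTestFun.integrable_deriv_smul {φ : ℝ → ℝ} (hφ : IsTestFun φ) {u : ℝ → Plane}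
    (hu : Integrable u unitVol) : Integrable (fun x => deriv φ x • u x) unitVol := by
  obtain ⟨C, hC⟩ := hφ.bdd_deriv
  exact hu.bdd_smul C hφ.continuous_deriv.aestronglyMeasurable (ae_of_all _ hC)

theorem IsWeakDeriv.congr {u v g h : ℝ → Plane} (huv : u =ᵐ[unitVol] v) (hgh : g =ᵐ[unitVol] h)
    (H : IsWeakDeriv u g) : IsWeakDeriv v h := by
  intro φ hφ
  have h1 : ∫ x, deriv φ x • v x ∂unitVol = ∫ x, deriv φ x • u x ∂unitVol :=
    integral_congr_ae (huv.mono fun x hx => by simp only [hx])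
  have h2 : ∫ x, φ x • h x ∂unitVol = ∫ x, φ x • g x ∂unitVol :=
    integral_congr_ae (hgh.mono fun x hx => by simp only [hx])
  rw [h1, h2, H φ hφ]

theorem IsWeakDeriv.add {u v g h : ℝ → Plane} (hu : Integrable u unitVol)
    (hv : Integrable v unitVol) (hg : Integrable g unitVol) (hh : Integrable h unitVol)
    (H : IsWeakDeriv u g) (K : IsWeakDeriv v h) : IsWeakDeriv (u + v) (g + h) := by
  intro φ hφ
  simp only [Pi.add_apply, smul_add]
  rw [integral_add (hφ.integrable_deriv_smul hu) (hφ.integrable_deriv_smul hv),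
    integral_add (hφ.integrable_smul hg) (hφ.integrable_smul hh), H φ hφ, K φ hφ, neg_add]

theorem IsWeakDeriv.smul {u g : ℝ → Plane} (c : ℝ) (H : IsWeakDeriv u g) :
    IsWeakDeriv (c • u) (c • g) := by
  intro φ hφ
  simp only [Pi.smul_apply, smul_comm _ c]
  rw [integral_smul, integral_smul, H φ hφ, smul_neg]

theorem IsWeakDeriv.zero : IsWeakDeriv 0 0 := by
  intro φ _
  simp

/-- The Sobolev space `W^{1,p}((0,1); ℝ²)`: the pairs `(y, y')` of `L^p` functions such that `y'`
is the weak derivative of `y`, as a subspace of `L^p × L^p` with the norm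
`(‖y‖_p ^ p + ‖y'‖_p ^ p) ^ (1/p)`. -/
def W1p (p : ℝ≥0∞) [Fact (1 ≤ p)] :
    Submodule ℝ (WithLp p (Lp Plane p unitVol × Lp Plane p unitVol)) where
  carrier := {y | IsWeakDeriv (y.fst : ℝ → Plane) (y.snd : ℝ → Plane)}
  zero_mem' :=
    IsWeakDeriv.zero.congr (Lp.coeFn_zero Plane p unitVol).symm
      (Lp.coeFn_zero Plane p unitVol).symm
  add_mem' := by
    intro y z hy hz
    have hi : ∀ w : Lp Plane p unitVol, Integrable (w : ℝ → Plane) unitVol := fun w =>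
      (Lp.memLp w).integrable Fact.out
    exact (IsWeakDeriv.add (hi _) (hi _) (hi _) (hi _) hy hz).congr
      (Lp.coeFn_add _ _).symm (Lp.coeFn_add _ _).symm
  smul_mem' := by
    intro c y hy
    exact (IsWeakDeriv.smul c hy).congr (Lp.coeFn_smul _ _).symm (Lp.coeFn_smul _ _).symm

namespace W1p

variable {p : ℝ≥0∞} [Fact (1 ≤ p)]

/-- The underlying function of an element of `W^{1,p}` (defined up to null sets). -/
def fn (y : W1p p) : ℝ → Plane := (y : WithLp p (Lp Plane p unitVol × Lp Plane p unitVol)).fst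

/-- The weak derivative `y'` of an element of `W^{1,p}` (defined up to null sets). -/
def wderiv (y : W1p p) : ℝ → Plane :=
  (y : WithLp p (Lp Plane p unitVol × Lp Plane p unitVol)).snd

/-- `v` is the continuous representative of `y` on `(0,1)`; it is unique there. -/
def IsContRep (y : W1p p) (v : ℝ → Plane) : Prop :=
  ContinuousOn v (Ioo 0 1) ∧ v =ᵐ[unitVol] fn y

/-- `y` (through its continuous representative) is a homeomorphism of `(0,1)` onto its image. -/
def IsHomeo (y : W1p p) : Prop :=
  ∃ v : ℝ → Plane, IsContRep y v ∧ IsEmbedding ((Ioo (0 : ℝ) 1).domRestrict v)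

/-- `y` is piecewise affine: `(0,1)` has a finite partition such that the continuous
representative of `y` is affine on each piece. -/
def IsPiecewiseAffine (y : W1p p) : Prop :=
  ∃ v : ℝ → Plane, IsContRep y v ∧
    ∃ (n : ℕ) (t : Fin (n + 1) → ℝ), StrictMono t ∧ t 0 = 0 ∧ t (Fin.last n) = 1 ∧
      ∀ i : Fin n, ∃ a b : Plane, ∀ x ∈ Ioo (t i.castSucc) (t i.succ), v x = x • a + b

/-- Convergence in `C⁰((0,1); ℝ²)`, i.e. uniform convergence of continuous representatives. -/
def TendstoC0 (z : ℕ → W1p p) (y : W1p p) : Prop :=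
  ∃ (w : ℕ → ℝ → Plane) (v : ℝ → Plane), (∀ k, IsContRep (z k) (w k)) ∧ IsContRep y v ∧
    TendstoUniformlyOn w v atTop (Ioo 0 1)

/-- Weak convergence in the Banach space `W^{1,p}((0,1); ℝ²)`. -/
def TendstoWeakly (z : ℕ → W1p p) (y : W1p p) : Prop :=
  Tendsto (fun k => toWeakSpace ℝ (W1p p) (z k)) atTop (𝓝 (toWeakSpace ℝ (W1p p) y))

/-- `y` is non-interpenetrative: it is the `C⁰`-limit of a sequence of homeomorphisms that is
bounded in `W^{1,p}`. -/
def NonInterpenetrative (y : W1p p) : Prop :=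
  ∃ z : ℕ → W1p p, Bornology.IsBounded (range z) ∧ (∀ k, IsHomeo (z k)) ∧ TendstoC0 z y

open Classical in
/-- The functional `∫₀¹ f(y')` on homeomorphisms, `+∞` otherwise. -/
def energy (f : Plane → ℝ≥0∞) (y : W1p p) : ℝ≥0∞ :=
  if IsHomeo y then ∫⁻ x, f (wderiv y x) ∂unitVol else ∞

/-- The relaxation: the infimum of `liminf I(y_k)` over all sequences in `W^{1,p}` that converge
weakly to `y`. -/
def relaxedEnergy (f : Plane → ℝ≥0∞) (y : W1p p) : ℝ≥0∞ :=
  ⨅ (z : ℕ → W1p p) (_ : TendstoWeakly z y), liminf (fun k => energy f (z k)) atTop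

/-- The same infimum, over sequences of piecewise affine homeomorphisms only. -/
def relaxedEnergyPA (f : Plane → ℝ≥0∞) (y : W1p p) : ℝ≥0∞ :=
  ⨅ (z : ℕ → W1p p) (_ : TendstoWeakly z y)
    (_ : ∀ k, IsHomeo (z k) ∧ IsPiecewiseAffine (z k)),
    liminf (fun k => energy f (z k)) atTop

end W1p

/-- The convex envelope: the supremum of all finite convex `g : ℝ² → ℝ` with `g ≤ f`.
Since `f ≥ 0`, the inequality `g b ≤ f b` is the same as `ENNReal.ofReal (g b) ≤ f b`, and, `g = 0`
being admissible, truncating the supremum at `0` does not change it. -/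
def convexEnvelope (f : Plane → ℝ≥0∞) (a : Plane) : ℝ≥0∞ :=
  ⨆ (g : Plane → ℝ) (_ : ConvexOn ℝ univ g) (_ : ∀ b, ENNReal.ofReal (g b) ≤ f b),
    ENNReal.ofReal (g a)

open Classical in
/-- The functional `∫₀¹ Cf(y')` on non-interpenetrative maps, `+∞` otherwise. -/
def W1p.convexEnergy {p : ℝ≥0∞} [Fact (1 ≤ p)] (f : Plane → ℝ≥0∞) (y : W1p p) : ℝ≥0∞ :=
  if W1p.NonInterpenetrative y then ∫⁻ x, convexEnvelope f (W1p.wderiv y x) ∂unitVol else ∞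

end

noncomputable section

/-! Lower bound. A weakly convergent sequence in W^{1,p}, p > 1, is bounded and converges uniformly,
so a weak limit of homeomorphisms is non-interpenetrative. The functional with integrand Cf is
convex and strongly lower semicontinuous, hence weakly lower semicontinuous, and Cf ≤ f. This is
`convexEnergy_le_liminf`.

Upper bound, geometry. A non-interpenetrative y is a uniform limit of injective arcs of bounded
length. Lay a grid of mesh about δ over such an arc. By the coarea (Banach indicatrix) argument of
`exists_level` the grid lines can be chosen so that the arc meets them at most M times, where M
depends only on δ, the length and the size of the arc. Between two crossings the arc stays in one
rectangle and is replaced by essentially a chord. Disjoint arcs in a convex set whose ends are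
extreme points have disjoint chords (`chords_disjoint`, a winding argument), so the polygon stays
simple. Rectangles have flat sides, so the ends are first pushed onto a slightly smaller strictly
convex curve; `exists_grid_polygon` is the result.

Upper bound, energy. The polygon is run through with vertices visited near the times at which y is
near them, and each segment receives a little extra time. Jensen's inequality bounds the convexified
energy by that of y up to a small error (`exists_reparametrization`, `exists_PA_approx`). This works
because M is fixed before the distance from the arc to y: that distance can be made small compared
with the extra time per segment. On each affine piece the slope B, nonzero by injectivity, is then
replaced by fine zigzags whose slopes nearly realize Cf(B). A zigzag in a direction transversal to B
cannot fold back, and with small amplitude it misses the rest of the curve (`Attains.combo`,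
`Attains.of_sum`, `exists_relaxed`).

Weak convergence of the approximations follows from uniform convergence and a bound in W^{1,p}
(`TendstoC0.tendstoWeakly`), which coercivity supplies. A general f is replaced by f + |·|^p/(n+1);
its convex envelopes decrease to Cf as n grows. -/

/-! ### Plane topology: disjoint arcs with extreme ends have disjoint chords -/

/-- A nowhere vanishing continuous function on a compact star-shaped set has a continuous
logarithm. -/
theorem exists_continuousOn_log {E : Type*} [NormedAddCommGroup E] [NormedSpace ℝ E]
    {K : Set E} (hK : IsCompact K) (hstar : StarConvex ℝ 0 K) {F : E → ℂ}
    (hF : ContinuousOn F K) (hne : ∀ x ∈ K, F x ≠ 0) :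
    ∃ L : E → ℂ, ContinuousOn L K ∧ ∀ x ∈ K, Complex.exp (L x) = F x := by
  rcases K.eq_empty_or_nonempty with rfl | hKne
  · exact ⟨0, by simp, by simp⟩
  obtain ⟨x₀, hx₀, hmin⟩ := hK.exists_isMinOn hKne hF.norm
  set m := ‖F x₀‖ with hm
  have hmpos : 0 < m := norm_pos_iff.2 (hne _ hx₀)
  have huc := hK.uniformContinuousOn_of_continuous hF
  rw [Metric.uniformContinuousOn_iff] at huc
  obtain ⟨η, hη, huc⟩ := huc m hmpos
  obtain ⟨R, hR⟩ := hK.isBounded.exists_norm_le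
  obtain ⟨n, hn⟩ := exists_nat_gt ((|R| + 1) / η)
  have hn0 : (0 : ℝ) < n := lt_of_le_of_lt (by positivity) hn
  have hmem : ∀ x ∈ K, ∀ i : ℕ, i ≤ n → ((i : ℝ) / n) • x ∈ K := by
    intro x hx i hi
    apply hstar.smul_mem hx (by positivity)
    rw [div_le_one hn0]; exact_mod_cast hi
  -- Neighbouring samples of F on the ray from 0 to x differ by less than the minimum of |F|, so
  -- their ratio has distance less than 1 from 1. The principal logarithms of these ratios are
  -- continuous in x and telescope to a logarithm of F x / F 0.
  have hratio : ∀ x ∈ K, ∀ i : ℕ, i < n →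
      F (((i + 1 : ℕ) / n : ℝ) • x) / F (((i : ℕ) / n : ℝ) • x) ∈ Complex.slitPlane := by
    intro x hx i hi
    have h1 := hmem x hx i hi.le
    have h2 := hmem x hx (i + 1) hi
    have hd : dist (((i + 1 : ℕ) / n : ℝ) • x) (((i : ℕ) / n : ℝ) • x) < η := by
      rw [dist_eq_norm, ← sub_smul, norm_smul]
      have : (((i + 1 : ℕ) / n : ℝ) - ((i : ℕ) / n : ℝ)) = 1 / n := by
        push_cast; ring
      rw [this, Real.norm_of_nonneg (by positivity)]
      rw [div_lt_iff₀ hη] at hn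
      rw [one_div, inv_mul_lt_iff₀ hn0]
      have := hR x hx
      have := le_abs_self R
      linarith
    have h3 := huc _ h2 _ h1 hd
    have h4 : m ≤ ‖F (((i : ℕ) / n : ℝ) • x)‖ := hmin h1
    have hne' := hne _ h1
    rw [← add_sub_cancel 1 (F (((i + 1 : ℕ) / n : ℝ) • x) / F (((i : ℕ) / n : ℝ) • x))]
    apply Complex.mem_slitPlane_of_norm_lt_one
    rw [div_sub_one hne', norm_div, div_lt_one (norm_pos_iff.2 hne'), ← dist_eq_norm]
    exact h3.trans_le h4
  refine ⟨fun x => Complex.log (F 0) + ∑ i ∈ Finset.range n,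
    Complex.log (F (((i + 1 : ℕ) / n : ℝ) • x) / F (((i : ℕ) / n : ℝ) • x)), ?_, ?_⟩
  · refine continuousOn_const.add (continuousOn_finsetSum _ fun i hi => ?_)
    rw [Finset.mem_range] at hi
    apply ContinuousOn.clog
    · apply ContinuousOn.div
      · exact hF.comp (by fun_prop) fun x hx => hmem x hx (i + 1) hi
      · exact hF.comp (by fun_prop) fun x hx => hmem x hx i hi.le
      · exact fun x hx => hne _ (hmem x hx i hi.le)
    · exact fun x hx => hratio x hx i hi
  · intro x hx
    have h0 : (0 : E) ∈ K := by simpa using hmem x hx 0 (Nat.zero_le _)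
    rw [Complex.exp_add, Complex.exp_sum, Complex.exp_log (hne 0 h0)]
    rw [Finset.prod_congr rfl (g := fun i : ℕ =>
      F (((i + 1 : ℕ) / n : ℝ) • x) / F (((i : ℕ) / n : ℝ) • x))]
    · have : ∀ k : ℕ, k ≤ n → F 0 * ∏ i ∈ Finset.range k,
          F (((i + 1 : ℕ) / n : ℝ) • x) / F (((i : ℕ) / n : ℝ) • x) = F ((k / n : ℝ) • x) := by
        intro k
        induction k with
        | zero => simp
        | succ k ih =>
          intro hk
          rw [Finset.prod_range_succ, ← mul_assoc, ih (by omega)]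
          have := hne _ (hmem x hx k (by omega))
          field_simp
      have h := this n le_rfl
      rw [div_self hn0.ne', one_smul] at h
      exact h
    · intro i hi
      rw [Finset.mem_range] at hi
      exact Complex.exp_log (Complex.slitPlane_ne_zero (hratio x hx i hi))

/-- Along a path in an open half-plane the logarithm varies like the principal argument. -/
theorem im_log_sub_of_halfPlane {L : ℝ → ℂ} {γ : ℝ → ℂ} (hL : ContinuousOn L (Icc 0 1))
    (hγ : ContinuousOn γ (Icc 0 1)) (hexp : ∀ t ∈ Icc (0 : ℝ) 1, Complex.exp (L t) = γ t) (w : ℂ)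
    (hw : ∀ t ∈ Icc (0 : ℝ) 1, 0 < (γ t * w).re) :
    (L 1).im - (L 0).im = (γ 1 * w).arg - (γ 0 * w).arg := by
  have hw0 : w ≠ 0 := by
    rintro rfl
    simpa using hw 0 (by simp)
  have hlog : ContinuousOn (fun t => Complex.log (γ t * w)) (Icc 0 1) :=
    (hγ.mul continuousOn_const).clog fun t ht => Or.inl (hw t ht)
  have hne : ∀ t ∈ Icc (0 : ℝ) 1, γ t * w ≠ 0 := fun t ht h => by
    have := hw t ht; rw [h] at this; simp at this
  -- Up to the constant `log w`, two logarithms of γ are being compared. They differ by a multiple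
  -- of 2πi that depends continuously on t and is therefore constant.
  have hint : ∀ t ∈ Icc (0 : ℝ) 1, ∃ n : ℤ,
      L t - Complex.log (γ t * w) + Complex.log w = n * (2 * Real.pi * Complex.I) := by
    intro t ht
    rw [← Complex.exp_eq_one_iff, Complex.exp_add, Complex.exp_sub, Complex.exp_log (hne t ht),
      Complex.exp_log hw0, hexp t ht]
    have h1 := hne t ht
    have h2 : γ t ≠ 0 := left_ne_zero_of_mul h1
    field_simp
  have hcont : ContinuousOn
      (fun t => (L t - Complex.log (γ t * w) + Complex.log w).im / (2 * Real.pi)) (Icc 0 1) := by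
    apply ContinuousOn.div_const
    exact Complex.continuous_im.comp_continuousOn ((hL.sub hlog).add continuousOn_const)
  have hval : ∀ t ∈ Icc (0 : ℝ) 1, ∃ n : ℤ,
      (L t - Complex.log (γ t * w) + Complex.log w).im / (2 * Real.pi) = n := by
    intro t ht
    obtain ⟨n, hn⟩ := hint t ht
    refine ⟨n, ?_⟩
    rw [hn]
    have : ((n : ℂ) * (2 * Real.pi * Complex.I)).im = n * (2 * Real.pi) := by simp
    rw [this]
    field_simp
  choose! n hn using hval
  have hconst : (n 0 : ℝ) = n 1 := by
    have hpre : IsPreconnected ((fun t => (L t - Complex.log (γ t * w) + Complex.log w).im /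
      (2 * Real.pi)) '' Icc 0 1) := isPreconnected_Icc.image _ hcont
    by_contra hne
    have hne : n 0 ≠ n 1 := by exact_mod_cast hne
    have h0 : (n 0 : ℝ) ∈ ((fun t => (L t - Complex.log (γ t * w) + Complex.log w).im /
      (2 * Real.pi)) '' Icc 0 1) := ⟨0, by simp, hn 0 (by simp)⟩
    have h1 : (n 1 : ℝ) ∈ ((fun t => (L t - Complex.log (γ t * w) + Complex.log w).im /
      (2 * Real.pi)) '' Icc 0 1) := ⟨1, by simp, hn 1 (by simp)⟩
    -- A connected set containing two distinct integers contains a + 1/2, which is not an integer.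
    have key : ∀ a b : ℤ, a < b → Icc (a : ℝ) b ⊆ ((fun t => (L t - Complex.log (γ t * w)
        + Complex.log w).im / (2 * Real.pi)) '' Icc 0 1) → False := by
      intro a b hab hsub
      have hab' : (a : ℝ) + 1 ≤ b := by exact_mod_cast hab
      obtain ⟨t, ht, htt⟩ := hsub (show (a : ℝ) + 1 / 2 ∈ Icc (a : ℝ) b by
        constructor <;> linarith)
      have h := hn t ht
      simp only at htt
      rw [htt] at h
      have h1 : (2 * a + 1 : ℝ) = 2 * n t := by linarith
      have h2 : 2 * a + 1 = 2 * n t := by exact_mod_cast h1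
      omega
    rcases lt_or_gt_of_ne hne with h | h
    · exact key _ _ h (hpre.Icc_subset h0 h1)
    · exact key _ _ h (hpre.Icc_subset h1 h0)
  rw [← hn 0 (by simp), ← hn 1 (by simp)] at hconst
  have hpi : (2 * Real.pi) ≠ 0 := by positivity
  rw [div_left_inj' hpi] at hconst
  simp only [Complex.add_im, Complex.sub_im, Complex.log_im] at hconst
  linarith

theorem arg_lt_arg_of_re_pos {z w : ℂ} (hz : 0 < z.re) (hw : 0 < w.re)
    (h : z.re * w.im - z.im * w.re < 0) : w.arg < z.arg := by
  have hz' := abs_lt.1 (Complex.abs_arg_lt_pi_div_two_iff.2 (Or.inl hz))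
  have hw' := abs_lt.1 (Complex.abs_arg_lt_pi_div_two_iff.2 (Or.inl hw))
  rw [← Real.strictMonoOn_tan.lt_iff_lt hw' hz', Complex.tan_arg, Complex.tan_arg,
    div_lt_div_iff₀ hw hz]
  linarith

/-- The determinant of two vectors of the plane. -/
def cross (u v : Plane) : ℝ := u 0 * v 1 - u 1 * v 0

theorem cross_swap (u v : Plane) : cross u v = -cross v u := by
  unfold cross; ring

/-- A vector of the plane as a complex number. -/
def toCx (v : Plane) : ℂ := ⟨v 0, v 1⟩

theorem continuous_toCx : Continuous toCx := by
  have : toCx = fun v : Plane => ((v 0 : ℝ) : ℂ) + (v 1 : ℝ) * Complex.I := by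
    funext v
    apply Complex.ext <;> simp [toCx]
  rw [this]
  fun_prop

theorem toCx_ne_zero {v : Plane} (hv : v ≠ 0) : toCx v ≠ 0 := by
  intro h
  apply hv
  have h0 := congrArg Complex.re h
  have h1 := congrArg Complex.im h
  ext i
  fin_cases i
  · simpa [toCx] using h0
  · simpa [toCx] using h1

/-- The imaginary part of a logarithm decreases along a path in an open half-plane whose endpoints
are negatively oriented. -/
theorem im_log_lt_of_halfPlane {L : ℝ → ℂ} {γ : ℝ → Plane} (hL : ContinuousOn L (Icc 0 1))
    (hγ : ContinuousOn γ (Icc 0 1)) (hexp : ∀ t ∈ Icc (0 : ℝ) 1, Complex.exp (L t) = toCx (γ t))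
    (c : Plane) (hc : ∀ t ∈ Icc (0 : ℝ) 1, 0 < c 0 * γ t 0 + c 1 * γ t 1)
    (hcr : cross (γ 0) (γ 1) < 0) : (L 1).im < (L 0).im := by
  have hre : ∀ v : Plane, (toCx v * ⟨c 0, -c 1⟩).re = c 0 * v 0 + c 1 * v 1 := by
    intro v; simp [toCx]; ring
  have h := im_log_sub_of_halfPlane hL (continuous_toCx.comp_continuousOn hγ) hexp ⟨c 0, -c 1⟩
    (fun t ht => by rw [Function.comp_apply, hre]; exact hc t ht)
  have h0 := hc 0 (by simp)
  have h1 := hc 1 (by simp)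
  have hlt : (toCx (γ 1) * ⟨c 0, -c 1⟩).arg < (toCx (γ 0) * ⟨c 0, -c 1⟩).arg := by
    apply arg_lt_arg_of_re_pos
    · rw [hre]; exact h0
    · rw [hre]; exact h1
    · have hcc : 0 < c 0 ^ 2 + c 1 ^ 2 := by
        by_contra hcon
        have e0 : c 0 = 0 := by nlinarith [sq_nonneg (c 0), sq_nonneg (c 1)]
        have e1 : c 1 = 0 := by nlinarith [sq_nonneg (c 0), sq_nonneg (c 1)]
        rw [e0, e1] at h0
        simp at h0
      -- Multiplication by the conjugate of c rotates the half-plane onto the right one and scales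
      -- determinants by |c|².
      have : (toCx (γ 0) * ⟨c 0, -c 1⟩).re * (toCx (γ 1) * ⟨c 0, -c 1⟩).im -
          (toCx (γ 0) * ⟨c 0, -c 1⟩).im * (toCx (γ 1) * ⟨c 0, -c 1⟩).re
          = (c 0 ^ 2 + c 1 ^ 2) * cross (γ 0) (γ 1) := by
        simp [toCx, cross]; ring
      rw [this]
      exact mul_neg_of_pos_of_neg hcc hcr
  simp only [Function.comp_apply] at h
  linarith

theorem convexCombo_neg {x y m : ℝ} (hx : x < 0) (hy : y < 0) (hm : m ∈ Icc (0 : ℝ) 1) :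
    (1 - m) * x + m * y < 0 := by
  rcases hm.1.lt_or_eq with h | h
  · nlinarith [hm.2]
  · rw [← h]; simpa using hx

/-- As the arcs are disjoint, a(s) - b(t) has a continuous logarithm on the whole parameter square.
On each side of the square one argument is a fixed endpoint, and its supporting line keeps the
difference in an open half-plane; the sign hypotheses then make the imaginary part of the logarithm
drop. Four drops around a closed circuit are impossible. -/
theorem no_crossing_of_cross_pos {a b : ℝ → Plane} {K : Set Plane}
    (ha : ContinuousOn a (Icc 0 1)) (hb : ContinuousOn b (Icc 0 1))
    (haK : ∀ s ∈ Icc (0 : ℝ) 1, a s ∈ K) (hbK : ∀ s ∈ Icc (0 : ℝ) 1, b s ∈ K)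
    (hab : ∀ s ∈ Icc (0 : ℝ) 1, ∀ t ∈ Icc (0 : ℝ) 1, a s ≠ b t)
    (hsup : ∀ q, q = a 0 ∨ q = a 1 ∨ q = b 0 ∨ q = b 1 → ∃ c : Plane, ∀ x ∈ K, x ≠ q →
      c 0 * (x 0 - q 0) + c 1 * (x 1 - q 1) < 0)
    (h1 : cross (a 0 - b 0) (a 1 - b 0) < 0) (h2 : cross (a 1 - b 0) (a 1 - b 1) < 0)
    (h3 : cross (a 1 - b 1) (a 0 - b 1) < 0) (h4 : cross (a 0 - b 1) (a 0 - b 0) < 0) : False := by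
  have m0 : (0 : ℝ) ∈ Icc (0 : ℝ) 1 := by simp
  obtain ⟨L, hL, hexp⟩ := exists_continuousOn_log (E := ℝ × ℝ) (K := Icc 0 1 ×ˢ Icc 0 1)
    (F := fun x => toCx (a x.1 - b x.2)) (isCompact_Icc.prod isCompact_Icc)
    (by
      have : Convex ℝ (Icc (0 : ℝ) 1 ×ˢ Icc (0 : ℝ) 1) := (convex_Icc 0 1).prod (convex_Icc 0 1)
      exact this.starConvex ⟨m0, m0⟩)
    (by
      apply continuous_toCx.comp_continuousOn
      exact (ha.comp continuousOn_fst fun x hx => hx.1).sub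
        (hb.comp continuousOn_snd fun x hx => hx.2))
    (fun x hx => toCx_ne_zero (sub_ne_zero.2 (hab _ hx.1 _ hx.2)))
  have m1 : (1 : ℝ) ∈ Icc (0 : ℝ) 1 := by simp
  have mr : ∀ t ∈ Icc (0 : ℝ) 1, 1 - t ∈ Icc (0 : ℝ) 1 := fun t ht => by
    constructor <;> linarith [ht.1, ht.2]
  obtain ⟨ca0, hca0⟩ := hsup (a 0) (by simp)
  obtain ⟨ca1, hca1⟩ := hsup (a 1) (by simp)
  obtain ⟨cb0, hcb0⟩ := hsup (b 0) (by simp)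
  obtain ⟨cb1, hcb1⟩ := hsup (b 1) (by simp)
  have e1 : (L (1, 0)).im < (L (0, 0)).im := by
    apply im_log_lt_of_halfPlane (L := fun t => L (t, 0)) (γ := fun t => a t - b 0)
      (hL.comp (by fun_prop) fun t ht => ⟨ht, m0⟩) (ha.sub continuousOn_const)
      (fun t ht => hexp (t, 0) ⟨ht, m0⟩) (-cb0) _ h1
    intro t ht
    have := hcb0 (a t) (haK t ht) (hab t ht 0 m0)
    simp only [PiLp.neg_apply, PiLp.sub_apply]
    linarith
  have e2 : (L (1, 1)).im < (L (1, 0)).im := by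
    apply im_log_lt_of_halfPlane (L := fun t => L (1, t)) (γ := fun t => a 1 - b t)
      (hL.comp (by fun_prop) fun t ht => ⟨m1, ht⟩) (continuousOn_const.sub hb)
      (fun t ht => hexp (1, t) ⟨m1, ht⟩) ca1 _ h2
    intro t ht
    have := hca1 (b t) (hbK t ht) (hab 1 m1 t ht).symm
    simp only [PiLp.sub_apply]
    linarith
  have e3 : (L (0, 1)).im < (L (1, 1)).im := by
    have := im_log_lt_of_halfPlane (L := fun t => L (1 - t, 1)) (γ := fun t => a (1 - t) - b 1)
      (hL.comp (by fun_prop) fun t ht => ⟨mr t ht, m1⟩)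
      ((ha.comp (by fun_prop) mr).sub continuousOn_const)
      (fun t ht => hexp (1 - t, 1) ⟨mr t ht, m1⟩) (-cb1) (by
        intro t ht
        have := hcb1 (a (1 - t)) (haK _ (mr t ht)) (hab _ (mr t ht) 1 m1)
        simp only [PiLp.neg_apply, PiLp.sub_apply]
        linarith) (by simpa using h3)
    simpa using this
  have e4 : (L (0, 0)).im < (L (0, 1)).im := by
    have := im_log_lt_of_halfPlane (L := fun t => L (0, 1 - t)) (γ := fun t => a 0 - b (1 - t))
      (hL.comp (by fun_prop) fun t ht => ⟨m0, mr t ht⟩)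
      (continuousOn_const.sub (hb.comp (by fun_prop) mr))
      (fun t ht => hexp (0, 1 - t) ⟨m0, mr t ht⟩) ca0 (by
        intro t ht
        have := hca0 (b (1 - t)) (hbK _ (mr t ht)) (hab 0 m0 _ (mr t ht)).symm
        simp only [PiLp.sub_apply]
        linarith) (by simpa using h4)
    simpa using this
  linarith

/-- The collinear case. On the common line, with the common point as origin and a 1 - a 0 as unit,
the chord a has ends -l and 1 - l, and the chord b has ends -X and Y. The product conditions say
that no end used there lies between the two ends of the other chord, which fails for two overlapping
intervals. -/
theorem no_four_extreme {l X Y : ℝ} (hl : 0 < l) (hl1 : l < 1)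
    (g1 : 0 < (X - l) * (X + 1 - l)) (g2 : 0 < (-l - Y) * (1 - l - Y))
    (g3 : 0 < (l - X) * (l + Y)) (g4 : (0 ≤ X ∧ 0 ≤ Y) ∨ (X ≤ 0 ∧ Y ≤ 0)) : False := by
  rcases g4 with ⟨hX, hY⟩ | ⟨hX, hY⟩
  · have h1 : 0 < l - X := pos_of_mul_pos_left g3 (by linarith)
    nlinarith [mul_pos h1 (show 0 < X + 1 - l by linarith)]
  · have h1 : 0 < l + Y := pos_of_mul_pos_right g3 (by linarith)
    nlinarith [mul_pos h1 (show 0 < 1 - l - Y by linarith)]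

set_option maxHeartbeats 400000 in
/-- Disjoint paths in a set `K` that has strict supporting lines at their endpoints have disjoint
chords. -/
theorem chords_disjoint {a b : ℝ → Plane} {K : Set Plane}
    (ha : ContinuousOn a (Icc 0 1)) (hb : ContinuousOn b (Icc 0 1))
    (haK : ∀ s ∈ Icc (0 : ℝ) 1, a s ∈ K) (hbK : ∀ s ∈ Icc (0 : ℝ) 1, b s ∈ K)
    (hab : ∀ s ∈ Icc (0 : ℝ) 1, ∀ t ∈ Icc (0 : ℝ) 1, a s ≠ b t)
    (ha01 : a 0 ≠ a 1) (hb01 : b 0 ≠ b 1)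
    (hsup : ∀ q, q = a 0 ∨ q = a 1 ∨ q = b 0 ∨ q = b 1 → ∃ c : Plane, ∀ x ∈ K, x ≠ q →
      c 0 * (x 0 - q 0) + c 1 * (x 1 - q 1) < 0)
    {l m : ℝ} (hl : l ∈ Icc (0 : ℝ) 1) (hm : m ∈ Icc (0 : ℝ) 1) :
    a 0 + l • (a 1 - a 0) ≠ b 0 + m • (b 1 - b 0) := by
  intro heq
  have m0 : (0 : ℝ) ∈ Icc (0 : ℝ) 1 := by simp
  have m1 : (1 : ℝ) ∈ Icc (0 : ℝ) 1 := by simp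
  have mr : ∀ t ∈ Icc (0 : ℝ) 1, 1 - t ∈ Icc (0 : ℝ) 1 := fun t ht => by
    constructor <;> linarith [ht.1, ht.2]
  have q0 := congrArg (fun v : Plane => v 0) heq
  have q1 := congrArg (fun v : Plane => v 1) heq
  simp only [PiLp.add_apply, PiLp.smul_apply, PiLp.sub_apply, smul_eq_mul] at q0 q1
  obtain ⟨ca0, hca0⟩ := hsup (a 0) (by simp)
  obtain ⟨ca1, hca1⟩ := hsup (a 1) (by simp)
  obtain ⟨cb0, hcb0⟩ := hsup (b 0) (by simp)
  obtain ⟨cb1, hcb1⟩ := hsup (b 1) (by simp)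
  have A0 := hca0 _ (haK 1 m1) ha01.symm
  have A1 := hca0 _ (hbK 0 m0) (hab 0 m0 0 m0).symm
  have A2 := hca0 _ (hbK 1 m1) (hab 0 m0 1 m1).symm
  have B0 := hca1 _ (haK 0 m0) ha01
  have B1 := hca1 _ (hbK 0 m0) (hab 1 m1 0 m0).symm
  have B2 := hca1 _ (hbK 1 m1) (hab 1 m1 1 m1).symm
  have C0 := hcb0 _ (hbK 1 m1) hb01.symm
  have C1 := hcb0 _ (haK 0 m0) (hab 0 m0 0 m0)
  have C2 := hcb0 _ (haK 1 m1) (hab 1 m1 0 m0)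
  have D0 := hcb1 _ (hbK 0 m0) hb01
  have D1 := hcb1 _ (haK 0 m0) (hab 0 m0 1 m1)
  have D2 := hcb1 _ (haK 1 m1) (hab 1 m1 1 m1)
  clear hca0 hca1 hcb0 hcb1
  -- If an end of one chord lay on the other chord, its strict supporting functional would vanish at
  -- a convex combination of two points where it is negative. Hence the crossing is interior to both
  -- chords.
  have lpos : 0 < l := by
    rcases hl.1.lt_or_eq with h | h
    · exact h
    exfalso; subst h
    have e0 : a 0 0 = b 0 0 + m * (b 1 0 - b 0 0) := by linarith
    have e1 : a 0 1 = b 0 1 + m * (b 1 1 - b 0 1) := by linarith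
    have : (1 - m) * (ca0 0 * (b 0 0 - a 0 0) + ca0 1 * (b 0 1 - a 0 1)) +
      m * (ca0 0 * (b 1 0 - a 0 0) + ca0 1 * (b 1 1 - a 0 1)) = 0 := by rw [e0, e1]; ring
    linarith [convexCombo_neg A1 A2 hm]
  have llt : l < 1 := by
    rcases hl.2.lt_or_eq with h | h
    · exact h
    exfalso; subst h
    have e0 : a 1 0 = b 0 0 + m * (b 1 0 - b 0 0) := by linarith
    have e1 : a 1 1 = b 0 1 + m * (b 1 1 - b 0 1) := by linarith
    have : (1 - m) * (ca1 0 * (b 0 0 - a 1 0) + ca1 1 * (b 0 1 - a 1 1)) +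
      m * (ca1 0 * (b 1 0 - a 1 0) + ca1 1 * (b 1 1 - a 1 1)) = 0 := by rw [e0, e1]; ring
    linarith [convexCombo_neg B1 B2 hm]
  have mpos : 0 < m := by
    rcases hm.1.lt_or_eq with h | h
    · exact h
    exfalso; subst h
    have e0 : b 0 0 = a 0 0 + l * (a 1 0 - a 0 0) := by linarith
    have e1 : b 0 1 = a 0 1 + l * (a 1 1 - a 0 1) := by linarith
    have : (1 - l) * (cb0 0 * (a 0 0 - b 0 0) + cb0 1 * (a 0 1 - b 0 1)) +
      l * (cb0 0 * (a 1 0 - b 0 0) + cb0 1 * (a 1 1 - b 0 1)) = 0 := by rw [e0, e1]; ring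
    linarith [convexCombo_neg C1 C2 hl]
  have mlt : m < 1 := by
    rcases hm.2.lt_or_eq with h | h
    · exact h
    exfalso; subst h
    have e0 : b 1 0 = a 0 0 + l * (a 1 0 - a 0 0) := by linarith
    have e1 : b 1 1 = a 0 1 + l * (a 1 1 - a 0 1) := by linarith
    have : (1 - l) * (cb1 0 * (a 0 0 - b 1 0) + cb1 1 * (a 0 1 - b 1 1)) +
      l * (cb1 0 * (a 1 0 - b 1 0) + cb1 1 * (a 1 1 - b 1 1)) = 0 := by rw [e0, e1]; ring
    linarith [convexCombo_neg D1 D2 hl]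
  set D := cross (a 1 - a 0) (b 1 - b 0) with hD
  -- At an interior crossing all four boundary determinants are negative multiples of D, so they
  -- have the same sign.
  have f1 : cross (a 0 - b 0) (a 1 - b 0) = -m * D := by
    simp only [hD, cross, PiLp.sub_apply]
    linear_combination (a 1 1 - a 0 1) * q0 - (a 1 0 - a 0 0) * q1
  have f2 : cross (a 1 - b 0) (a 1 - b 1) = -(1 - l) * D := by
    simp only [hD, cross, PiLp.sub_apply]
    linear_combination -(b 1 1 - b 0 1) * q0 + (b 1 0 - b 0 0) * q1
  have f3 : cross (a 1 - b 1) (a 0 - b 1) = -(1 - m) * D := by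
    simp only [hD, cross, PiLp.sub_apply]
    linear_combination -(a 1 1 - a 0 1) * q0 + (a 1 0 - a 0 0) * q1
  have f4 : cross (a 0 - b 1) (a 0 - b 0) = -l * D := by
    simp only [hD, cross, PiLp.sub_apply]
    linear_combination (b 1 1 - b 0 1) * q0 - (b 1 0 - b 0 0) * q1
  rcases lt_trichotomy D 0 with hneg | h0 | hpos
  -- Reversing b changes the sign of D and swaps the roles of the four determinants.
  · refine no_crossing_of_cross_pos (b := fun t => b (1 - t)) ha (hb.comp (by fun_prop) mr) haK
      (fun t ht => hbK _ (mr t ht)) (fun s hs t ht => hab s hs _ (mr t ht)) ?_ ?_ ?_ ?_ ?_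
    · intro q hq
      apply hsup
      simp only [sub_zero, sub_self] at hq
      tauto
    all_goals simp only [sub_zero, sub_self]
    · rw [cross_swap, f3]; linarith [mul_neg_of_pos_of_neg (show 0 < 1 - m by linarith) hneg]
    · rw [cross_swap, f2]; linarith [mul_neg_of_pos_of_neg (show 0 < 1 - l by linarith) hneg]
    · rw [cross_swap, f1]; linarith [mul_neg_of_pos_of_neg (show 0 < m by linarith) hneg]
    · rw [cross_swap, f4]; linarith [mul_neg_of_pos_of_neg (show 0 < l by linarith) hneg]
  -- Parallel chords with a common point are collinear; everything is expressed in multiples of a 1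
  -- - a 0.
  · have hu : a 1 0 - a 0 0 ≠ 0 ∨ a 1 1 - a 0 1 ≠ 0 := by
      by_contra hcon
      push Not at hcon
      apply ha01
      ext i
      fin_cases i
      · simpa using (sub_eq_zero.1 hcon.1).symm
      · simpa using (sub_eq_zero.1 hcon.2).symm
    obtain ⟨c, hc0, hc1⟩ : ∃ c, b 1 0 - b 0 0 = c * (a 1 0 - a 0 0) ∧
        b 1 1 - b 0 1 = c * (a 1 1 - a 0 1) := by
      rw [hD] at h0
      simp only [cross, PiLp.sub_apply] at h0
      rcases hu with h | h
      · refine ⟨(b 1 0 - b 0 0) / (a 1 0 - a 0 0), by field_simp, ?_⟩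
        field_simp
        linarith
      · refine ⟨(b 1 1 - b 0 1) / (a 1 1 - a 0 1), ?_, by field_simp⟩
        field_simp
        linarith
    have q0' : a 0 0 - b 0 0 = (m * c - l) * (a 1 0 - a 0 0) := by rw [hc0] at q0; linarith
    have q1' : a 0 1 - b 0 1 = (m * c - l) * (a 1 1 - a 0 1) := by rw [hc1] at q1; linarith
    have key : ∀ d : Plane, ∀ x y : ℝ,
        d 0 * (x * (a 1 0 - a 0 0)) + d 1 * (x * (a 1 1 - a 0 1)) < 0 →
        d 0 * (y * (a 1 0 - a 0 0)) + d 1 * (y * (a 1 1 - a 0 1)) < 0 → 0 < x * y := by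
      intro d x y hx hy
      set k := d 0 * (a 1 0 - a 0 0) + d 1 * (a 1 1 - a 0 1) with hk
      have hx' : x * k < 0 := by rw [hk]; linarith
      have hy' : y * k < 0 := by rw [hk]; linarith
      have h3 := mul_pos_of_neg_of_neg hx' hy'
      have h4 : 0 < (x * y) * k ^ 2 := by linarith
      exact pos_of_mul_pos_left h4 (sq_nonneg k)
    have r : ∀ i : Fin 2, a 0 i - b 0 i = (m * c - l) * (a 1 i - a 0 i) ∧
        b 1 i - b 0 i = c * (a 1 i - a 0 i) := by
      intro i
      fin_cases i
      · exact ⟨q0', hc0⟩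
      · exact ⟨q1', hc1⟩
    have k1 := key cb0 (m * c - l) (m * c + 1 - l)
      (by rw [← (r 0).1, ← (r 1).1]; exact C1)
      (by
        have e : ∀ i, (m * c + 1 - l) * (a 1 i - a 0 i) = a 1 i - b 0 i := fun i => by
          linarith [(r i).1]
        rw [e 0, e 1]; exact C2)
    have k2 := key cb1 (-l - (1 - m) * c) (1 - l - (1 - m) * c)
      (by
        have e : ∀ i, (-l - (1 - m) * c) * (a 1 i - a 0 i) = a 0 i - b 1 i := fun i => by
          linarith [(r i).1, (r i).2]
        rw [e 0, e 1]; exact D1)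
      (by
        have e : ∀ i, (1 - l - (1 - m) * c) * (a 1 i - a 0 i) = a 1 i - b 1 i := fun i => by
          linarith [(r i).1, (r i).2]
        rw [e 0, e 1]; exact D2)
    have k3 := key ca0 (l - m * c) (l + (1 - m) * c)
      (by
        have e : ∀ i, (l - m * c) * (a 1 i - a 0 i) = b 0 i - a 0 i := fun i => by
          linarith [(r i).1, (r i).2]
        rw [e 0, e 1]; exact A1)
      (by
        have e : ∀ i, (l + (1 - m) * c) * (a 1 i - a 0 i) = b 1 i - a 0 i := fun i => by
          linarith [(r i).1, (r i).2]
        rw [e 0, e 1]; exact A2)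
    rcases le_total 0 c with hc | hc
    · exact no_four_extreme lpos llt k1 k2 k3 (Or.inl ⟨mul_nonneg mpos.le hc, mul_nonneg (by linarith) hc⟩)
    · exact no_four_extreme lpos llt k1 k2 k3 (Or.inr ⟨mul_nonpos_of_nonneg_of_nonpos mpos.le hc,
        mul_nonpos_of_nonneg_of_nonpos (by linarith) hc⟩)
  · refine no_crossing_of_cross_pos ha hb haK hbK hab hsup ?_ ?_ ?_ ?_
    · rw [f1]; linarith [mul_pos (show 0 < m by linarith) hpos]
    · rw [f2]; linarith [mul_pos (show 0 < 1 - l by linarith) hpos]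
    · rw [f3]; linarith [mul_pos (show 0 < 1 - m by linarith) hpos]
    · rw [f4]; linarith [mul_pos (show 0 < l by linarith) hpos]

/-! ### Rounding the square: strictly convex norms and radial projection -/

/-- The sup norm of the plane. -/
def supN (v : Plane) : ℝ := max |v 0| |v 1|

/-- The strictly convex norm `|v|_∞ + s |v|`. -/
def gN (s : ℝ) (v : Plane) : ℝ := supN v + s * ‖v‖

theorem continuous_supN : Continuous supN := by unfold supN; fun_prop

theorem continuous_gN (s : ℝ) : Continuous (gN s) := by
  unfold gN; exact continuous_supN.add (by fun_prop)

theorem supN_nonneg (v : Plane) : 0 ≤ supN v := le_max_of_le_left (abs_nonneg _)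

theorem supN_smul (t : ℝ) (v : Plane) : supN (t • v) = |t| * supN v := by
  simp only [supN, PiLp.smul_apply, smul_eq_mul, abs_mul]
  rw [mul_max_of_nonneg _ _ (abs_nonneg t)]

theorem supN_add_le (u v : Plane) : supN (u + v) ≤ supN u + supN v := by
  simp only [supN, PiLp.add_apply]
  apply max_le
  · exact (abs_add_le _ _).trans (add_le_add (le_max_left _ _) (le_max_left _ _))
  · exact (abs_add_le _ _).trans (add_le_add (le_max_right _ _) (le_max_right _ _))

theorem supN_zero : supN 0 = 0 := by simp [supN]

theorem supN_eq_zero {v : Plane} (h : supN v = 0) : v = 0 := by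
  have h0 : |v 0| ≤ 0 := h ▸ le_max_left _ _
  have h1 : |v 1| ≤ 0 := h ▸ le_max_right _ _
  ext i
  fin_cases i
  · simpa using h0
  · simpa using h1

theorem gN_smul (s t : ℝ) (v : Plane) : gN s (t • v) = |t| * gN s v := by
  simp only [gN, supN_smul, norm_smul, Real.norm_eq_abs]; ring

section
variable {s : ℝ}

theorem supN_le_gN (hs : 0 < s) (v : Plane) : supN v ≤ gN s v := by
  have := norm_nonneg v
  unfold gN
  nlinarith

theorem gN_nonneg (hs : 0 < s) (v : Plane) : 0 ≤ gN s v := (supN_nonneg v).trans (supN_le_gN hs v)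

theorem supN_lt_gN (hs : 0 < s) {v : Plane} (hv : v ≠ 0) : supN v < gN s v := by
  have := norm_pos_iff.2 hv
  unfold gN
  nlinarith

theorem gN_pos (hs : 0 < s) {v : Plane} (hv : v ≠ 0) : 0 < gN s v :=
  (supN_nonneg v).trans_lt (supN_lt_gN hs hv)

theorem gN_add_le (hs : 0 < s) (u v : Plane) : gN s (u + v) ≤ gN s u + gN s v := by
  have h1 := supN_add_le u v
  have h2 := norm_add_le u v
  unfold gN
  nlinarith

/-- The unit ball of `gN s` has strict supporting lines. -/
theorem gN_support (hs : 0 < s) {q : Plane} (hq : gN s q = 1) : ∃ c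
    : Plane, ∀ x, gN s x ≤ 1 → x ≠ q →
    c 0 * (x 0 - q 0) + c 1 * (x 1 - q 1) < 0 := by
  have hq0 : q ≠ 0 := by
    rintro rfl
    simp [gN, supN_zero] at hq
  have hqn := norm_pos_iff.2 hq0
  -- The functional d supports the sup norm at q. Adding the gradient of s‖·‖ at q makes the support
  -- strict, because equality in Cauchy–Schwarz leaves only nonnegative multiples of q.
  obtain ⟨d, hd1, hd2⟩ : ∃ d : Plane, (∀ x : Plane, d 0 * x 0 + d 1 * x 1 ≤ supN x) ∧
      d 0 * q 0 + d 1 * q 1 = supN q := by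
    rcases le_total |q 1| |q 0| with h | h
    · refine ⟨!₂[SignType.sign (q 0), 0], fun x => ?_, ?_⟩
      · simp only [supN]
        refine le_trans ?_ (le_max_left _ _)
        rcases lt_trichotomy (q 0) 0 with h | h | h <;> simp [h, neg_le_abs, le_abs_self]
      · simp [supN, max_eq_left h]
    · refine ⟨!₂[0, SignType.sign (q 1)], fun x => ?_, ?_⟩
      · simp only [supN]
        refine le_trans ?_ (le_max_right _ _)
        rcases lt_trichotomy (q 1) 0 with h | h | h <;> simp [h, neg_le_abs, le_abs_self]
      · simp [supN, max_eq_right h]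
  have hin : ∀ x : Plane, inner ℝ q x = q 0 * x 0 + q 1 * x 1 := by
    intro x
    simp [PiLp.inner_apply, Fin.sum_univ_two, mul_comm]
  refine ⟨d + (s / ‖q‖) • q, fun x hx hxq => ?_⟩
  have hqq : q 0 * q 0 + q 1 * q 1 = ‖q‖ ^ 2 := by rw [← hin, real_inner_self_eq_norm_sq]
  have hcs : q 0 * x 0 + q 1 * x 1 ≤ ‖q‖ * ‖x‖ := by rw [← hin]; exact real_inner_le_norm q x
  have e : (d + (s / ‖q‖) • q) 0 * (x 0 - q 0) + (d + (s / ‖q‖) • q) 1 * (x 1 - q 1)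
      = (d 0 * x 0 + d 1 * x 1) + s / ‖q‖ * (q 0 * x 0 + q 1 * x 1) - gN s q := by
    have : gN s q = (d 0 * q 0 + d 1 * q 1) + s / ‖q‖ * (q 0 * q 0 + q 1 * q 1) := by
      rw [hd2, hqq, gN]; field_simp
    rw [this]
    simp only [PiLp.add_apply, PiLp.smul_apply, smul_eq_mul]
    ring
  rw [e, hq]
  have hsq : 0 < s / ‖q‖ := by positivity
  have e2 : s / ‖q‖ * (‖q‖ * ‖x‖) = s * ‖x‖ := by field_simp
  rcases hcs.lt_or_eq with h | h
  · have h3 := mul_lt_mul_of_pos_left h hsq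
    rw [e2] at h3
    have := hd1 x
    unfold gN at hx
    linarith
  · have h3 : inner ℝ q x = ‖q‖ * ‖x‖ := by rw [hin, h]
    rw [inner_eq_norm_mul_iff_real] at h3
    have h4 : x = (‖x‖ / ‖q‖) • q := by
      rw [div_eq_inv_mul, mul_smul, h3, smul_smul, inv_mul_cancel₀ hqn.ne', one_smul]
    have h5 : gN s x = ‖x‖ / ‖q‖ := by
      conv_lhs => rw [h4]
      rw [gN_smul, hq, mul_one, abs_of_nonneg (by positivity)]
    have h6 : ‖x‖ / ‖q‖ < 1 := by
      rcases (h5 ▸ hx).lt_or_eq with h | h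
      · exact h
      · rw [h, one_smul] at h4
        exact absurd h4 hxq
    have h7 : d 0 * x 0 + d 1 * x 1 = ‖x‖ / ‖q‖ * supN q := by
      rw [← hd2]
      conv_lhs => rw [h4]
      simp only [PiLp.smul_apply, smul_eq_mul]; ring
    have h8 : s / ‖q‖ * (q 0 * x 0 + q 1 * x 1) = ‖x‖ / ‖q‖ * (s * ‖q‖) := by
      rw [h]; field_simp
    rw [h7, h8, ← mul_add, show supN q + s * ‖q‖ = gN s q from rfl, hq]
    linarith

theorem gN_lineMap_le (hs : 0 < s) {u v : Plane} (hu : gN s u ≤ 1) (hv : gN s v ≤ 1) {t : ℝ}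
    (ht : t ∈ Icc (0 : ℝ) 1) : gN s (AffineMap.lineMap u v t) ≤ 1 := by
  rw [AffineMap.lineMap_apply_module]
  refine (gN_add_le hs _ _).trans ?_
  rw [gN_smul, gN_smul, abs_of_nonneg (by linarith [ht.2]), abs_of_nonneg ht.1]
  nlinarith [ht.1, ht.2]

theorem gN_lineMap_lt (hs : 0 < s) {u v : Plane} (hu : gN s u ≤ 1) (hv : gN s v ≤ 1) (huv : u ≠ v)
    {t : ℝ}
    (ht : t ∈ Ioo (0 : ℝ) 1) : gN s (AffineMap.lineMap u v t) < 1 := by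
  rcases (gN_lineMap_le hs hu hv (Ioo_subset_Icc_self ht)).lt_or_eq with h | h
  · exact h
  obtain ⟨c, hc⟩ := gN_support hs h
  exfalso
  have h1 := hc u hu (by
    intro h
    rw [eq_comm, AffineMap.lineMap_eq_left_iff] at h
    exact h.elim huv ht.1.ne')
  have h2 := hc v hv (by
    intro h
    rw [eq_comm, AffineMap.lineMap_eq_right_iff] at h
    exact h.elim huv ht.2.ne)
  have h3 := convexCombo_neg h1 h2 (Ioo_subset_Icc_self ht)
  rw [AffineMap.lineMap_apply_module] at h3
  simp only [PiLp.add_apply, PiLp.smul_apply, smul_eq_mul] at h3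
  ring_nf at h3
  exact lt_irrefl _ h3

end

/-- The radial homeomorphism of the unit ball of `supN` onto that of `gN s`. -/
def radialMap (s : ℝ) (v : Plane) : Plane := (supN v / gN s v) • v

/-- The radial projection onto the unit sphere of `gN s`. -/
def radialProj (s : ℝ) (v : Plane) : Plane := (gN s v)⁻¹ • v

section
variable {s : ℝ}

theorem gN_radialMap (hs : 0 < s) (v : Plane) : gN s (radialMap s v) = supN v := by
  by_cases hv : v = 0
  · simp [hv, radialMap, gN, supN_zero]
  have := gN_pos hs hv
  rw [radialMap, gN_smul, abs_of_nonneg (div_nonneg (supN_nonneg v) this.le)]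
  field_simp

theorem radialMap_injective (hs : 0 < s) : Function.Injective (radialMap s) := by
  intro u v huv
  have h : supN u = supN v := by rw [← gN_radialMap hs, huv, gN_radialMap hs]
  by_cases hu : u = 0
  · subst hu
    rw [supN_zero] at h
    exact (supN_eq_zero h.symm).symm
  have hv : v ≠ 0 := by
    rintro rfl
    rw [supN_zero] at h
    exact hu (supN_eq_zero h)
  have hup := gN_pos hs hu
  have hvp := gN_pos hs hv
  have hsu : 0 < supN u := (supN_nonneg u).lt_of_ne' fun h => hu (supN_eq_zero h)
  have hsv : 0 < supN v := h ▸ hsu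
  have h1 : u = ((supN u / gN s u)⁻¹ * (supN v / gN s v)) • v := by
    unfold radialMap at huv
    rw [mul_smul, ← huv, smul_smul, inv_mul_cancel₀ (by positivity), one_smul]
  set k := (supN u / gN s u)⁻¹ * (supN v / gN s v) with hk
  have hkpos : 0 < k := by positivity
  have h2 : supN u = k * supN v := by
    conv_lhs => rw [h1]
    rw [supN_smul, abs_of_pos hkpos]
  rw [h] at h2
  have h3 : k = 1 := by
    have : (k - 1) * supN v = 0 := by linarith
    rcases mul_eq_zero.1 this with h | h
    · linarith
    · exact absurd h hsv.ne'
  rw [h1, h3, one_smul]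

theorem continuous_radialMap (hs : 0 < s) : Continuous (radialMap s) := by
  rw [continuous_iff_continuousAt]
  intro v
  by_cases hv : v = 0
  · subst hv
    have h0 : radialMap s 0 = 0 := by simp [radialMap]
    rw [ContinuousAt, h0]
    apply squeeze_zero_norm (a := fun v => ‖v‖)
    · intro v
      rw [radialMap, norm_smul, Real.norm_of_nonneg (div_nonneg (supN_nonneg v) (gN_nonneg hs v))]
      apply mul_le_of_le_one_left (norm_nonneg v)
      exact div_le_one_of_le₀ (supN_le_gN hs v) (gN_nonneg hs v)
    · exact continuous_norm.tendsto' 0 0 norm_zero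
  · unfold radialMap
    exact ((continuous_supN.continuousAt).div (continuous_gN s).continuousAt
      (gN_pos hs hv).ne').smul continuousAt_id

theorem radialMap_of_supN_eq_one {p : Plane} (hp : supN p = 1) :
    radialMap s p = radialProj s p := by
  rw [radialMap, radialProj, hp, one_div]

theorem ne_zero_of_supN_eq_one {p : Plane} (hp : supN p = 1) : p ≠ 0 := by
  rintro rfl
  rw [supN_zero] at hp
  norm_num at hp

theorem one_lt_gN (hs : 0 < s) {p : Plane} (hp : supN p = 1) : 1 < gN s p :=
  hp ▸ supN_lt_gN hs (ne_zero_of_supN_eq_one hp)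

theorem gN_radialProj (hs : 0 < s) {p : Plane} (hp : supN p = 1) : gN s (radialProj s p) = 1 := by
  rw [← radialMap_of_supN_eq_one hp, gN_radialMap hs, hp]

theorem radialProj_inj (hs : 0 < s) {p q : Plane} (hp : supN p = 1) (hq : supN q = 1)
    (h : radialProj s p = radialProj s q) : p = q := by
  rw [← radialMap_of_supN_eq_one hp, ← radialMap_of_supN_eq_one hq] at h
  exact radialMap_injective hs h

/-- Disjoint arcs in the square have disjoint projected chords. -/
theorem radialProj_chords_disjoint (hs : 0 < s) {a b : ℝ → Plane}
    (ha : ContinuousOn a (Icc 0 1)) (hb : ContinuousOn b (Icc 0 1))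
    (haK : ∀ t ∈ Icc (0 : ℝ) 1, supN (a t) ≤ 1) (hbK : ∀ t ∈ Icc (0 : ℝ) 1, supN (b t) ≤ 1)
    (hab : ∀ t ∈ Icc (0 : ℝ) 1, ∀ r ∈ Icc (0 : ℝ) 1, a t ≠ b r)
    (ha01 : a 0 ≠ a 1) (hb01 : b 0 ≠ b 1) (ha0 : supN (a 0) = 1) (ha1 : supN (a 1) = 1)
    (hb0 : supN (b 0) = 1) (hb1 : supN (b 1) = 1)
    {l m : ℝ} (hl : l ∈ Icc (0 : ℝ) 1) (hm : m ∈ Icc (0 : ℝ) 1) :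
    AffineMap.lineMap (radialProj s (a 0)) (radialProj s (a 1)) l ≠
      AffineMap.lineMap (radialProj s (b 0)) (radialProj s (b 1)) m := by
  -- The square itself has no strict supporting lines: two chords with ends on the same side could
  -- overlap. Its image under the injective radial map has them, and on the boundary of the square
  -- this map is the radial projection.
  have hc := continuous_radialMap hs
  have hi := radialMap_injective hs
  have h := chords_disjoint (a := radialMap s ∘ a) (b := radialMap s ∘ b)
    (K := {x | gN s x ≤ 1}) (hc.comp_continuousOn ha) (hc.comp_continuousOn hb)
    (fun t ht => by
      rw [mem_ofPred_eq, Function.comp_apply, gN_radialMap hs]; exact haK t ht)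
    (fun t ht => by
      rw [mem_ofPred_eq, Function.comp_apply, gN_radialMap hs]; exact hbK t ht)
    (fun t ht r hr => hi.ne (hab t ht r hr)) (hi.ne ha01) (hi.ne hb01)
    (by
      intro q hq
      have : gN s q = 1 := by
        rcases hq with rfl | rfl | rfl | rfl <;> rw [Function.comp_apply, gN_radialMap hs] <;>
          assumption
      exact gN_support hs this) hl hm
  simp only [Function.comp_apply, radialMap_of_supN_eq_one ha0,
    radialMap_of_supN_eq_one ha1, radialMap_of_supN_eq_one hb0,
    radialMap_of_supN_eq_one hb1] at h
  rw [AffineMap.lineMap_apply, AffineMap.lineMap_apply]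
  simp only [vsub_eq_sub, vadd_eq_add]
  rw [add_comm, add_comm _ (radialProj s (b 0))]
  exact h

theorem lineMap_radialProj (hs : 0 < s) {p : Plane} (hp : supN p = 1) {t : ℝ}
    (ht : t ∈ Icc (0 : ℝ) 1) :
    ∃ k ∈ Icc ((gN s p)⁻¹) 1, AffineMap.lineMap p (radialProj s p) t = k • p ∧
      k = 1 - t * (1 - (gN s p)⁻¹) := by
  have h1 := one_lt_gN hs hp
  have h2 : (gN s p)⁻¹ < 1 := inv_lt_one_of_one_lt₀ h1
  refine ⟨1 - t * (1 - (gN s p)⁻¹), ⟨by nlinarith [ht.1, ht.2], by nlinarith [ht.1, ht.2]⟩, ?_, rfl⟩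
  rw [AffineMap.lineMap_apply_module, radialProj]
  module

/-- The three kinds of points on the path `p, φ(p), φ(q), q`. -/
theorem stub_disjoint (hs : 0 < s) {p q : Plane} (hp : supN p = 1) (hq : supN q = 1) (hpq : p ≠ q)
    {t r : ℝ}
    (ht : t ∈ Icc (0 : ℝ) 1) (hr : r ∈ Icc (0 : ℝ) 1) :
    AffineMap.lineMap p (radialProj s p) t ≠ AffineMap.lineMap q (radialProj s q) r := by
  obtain ⟨k, hk, hkt, -⟩ := lineMap_radialProj hs hp ht
  obtain ⟨k', hk', hkt', -⟩ := lineMap_radialProj hs hq hr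
  have hkpos : 0 < k := (inv_pos.2 (zero_lt_one.trans (one_lt_gN hs hp))).trans_le hk.1
  have hkpos' : 0 < k' := (inv_pos.2 (zero_lt_one.trans (one_lt_gN hs hq))).trans_le hk'.1
  rw [hkt, hkt']
  intro h
  have h2 := congrArg supN h
  rw [supN_smul, supN_smul, hp, hq, abs_of_pos hkpos, abs_of_pos hkpos', mul_one, mul_one] at h2
  rw [h2] at h
  exact hpq (smul_right_injective _ hkpos'.ne' h)

/-- Stubs stay outside the open unit ball of `gN s` while chords stay in the closed ball; this is
what separates the two kinds of segment. -/
theorem one_le_gN_stub (hs : 0 < s) {p : Plane} (hp : supN p = 1) {t : ℝ} (ht : t ∈ Icc (0 : ℝ) 1) :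
    1 ≤ gN s (AffineMap.lineMap p (radialProj s p) t) := by
  obtain ⟨k, hk, hkt, -⟩ := lineMap_radialProj hs hp ht
  have h1 := one_lt_gN hs hp
  have hkpos : 0 < k := (inv_pos.2 (zero_lt_one.trans h1)).trans_le hk.1
  rw [hkt, gN_smul, abs_of_pos hkpos]
  have := hk.1
  rwa [inv_le_iff_one_le_mul₀ (by linarith)] at this

theorem one_lt_gN_stub (hs : 0 < s) {p : Plane} (hp : supN p = 1) {t : ℝ} (ht : t ∈ Ico (0 : ℝ) 1) :
    1 < gN s (AffineMap.lineMap p (radialProj s p) t) := by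
  obtain ⟨k, hk, hkt, hke⟩ := lineMap_radialProj hs hp (Ico_subset_Icc_self ht)
  have h1 := one_lt_gN hs hp
  have h2 : (gN s p)⁻¹ < 1 := inv_lt_one_of_one_lt₀ h1
  have hkpos : 0 < k := (inv_pos.2 (zero_lt_one.trans h1)).trans_le hk.1
  rw [hkt, gN_smul, abs_of_pos hkpos]
  have : (gN s p)⁻¹ < k := by nlinarith [ht.2]
  rwa [inv_lt_iff_one_lt_mul₀ (by linarith)] at this

theorem supN_stub_lt (hs : 0 < s) {p : Plane} (hp : supN p = 1) {t : ℝ} (ht : t ∈ Ioc (0 : ℝ) 1) :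
    supN (AffineMap.lineMap p (radialProj s p) t) < 1 := by
  obtain ⟨k, hk, hkt, hke⟩ := lineMap_radialProj hs hp (Ioc_subset_Icc_self ht)
  have h1 := one_lt_gN hs hp
  have h2 : (gN s p)⁻¹ < 1 := inv_lt_one_of_one_lt₀ h1
  have hkpos : 0 < k := (inv_pos.2 (zero_lt_one.trans h1)).trans_le hk.1
  rw [hkt, supN_smul, abs_of_pos hkpos, hp, mul_one, hke]
  nlinarith [ht.1]

theorem supN_lt_of_gN_le (hs : 0 < s) {x : Plane} (hx : gN s x ≤ 1) : supN x < 1 := by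
  by_cases h0 : x = 0
  · rw [h0, supN_zero]; norm_num
  · exact (supN_lt_gN hs h0).trans_le hx

/-- By strict convexity a chord reaches the unit sphere of `gN s` only at its ends, and each end
belongs to the stub of p or q, so two stubs would meet. -/
theorem stub_chord_disjoint (hs : 0 < s) {p q r : Plane} (hp : supN p = 1) (hq : supN q = 1)
    (hr : supN r = 1) (hrp : r ≠ p) (hrq : r ≠ q) (hpq : p ≠ q) {t l : ℝ}
    (ht : t ∈ Icc (0 : ℝ) 1) (hl : l ∈ Icc (0 : ℝ) 1) :
    AffineMap.lineMap r (radialProj s r) t ≠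
      AffineMap.lineMap (radialProj s p) (radialProj s q) l := by
  intro h
  have hpq' : radialProj s p ≠ radialProj s q := fun h => hpq (radialProj_inj hs hp hq h)
  have h1 := one_le_gN_stub hs hr ht
  rw [h] at h1
  rcases hl.1.lt_or_eq with h0 | h0
  · rcases hl.2.lt_or_eq with h2 | h2
    · exact absurd h1 (not_le.2 (gN_lineMap_lt hs (gN_radialProj hs hp).le
        (gN_radialProj hs hq).le hpq' ⟨h0, h2⟩))
    · rw [h2, AffineMap.lineMap_apply_one] at h
      refine stub_disjoint hs hr hq hrq ht (r := 1) (by simp) ?_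
      rw [h, AffineMap.lineMap_apply_one]
  · rw [← h0, AffineMap.lineMap_apply_zero] at h
    refine stub_disjoint hs hr hp hrp ht (r := 1) (by simp) ?_
    rw [h, AffineMap.lineMap_apply_one]

end

theorem tendsto_radialProj {p : Plane} (hp : supN p = 1) :
    Tendsto (fun s => radialProj s p) (𝓝[>] 0) (𝓝 p) := by
  have h : Tendsto (fun s => radialProj s p) (𝓝 0) (𝓝 (radialProj 0 p)) := by
    unfold radialProj gN
    have : ContinuousAt (fun s : ℝ => (supN p + s * ‖p‖)⁻¹ • p) 0 := by
      refine ContinuousAt.fun_smul (ContinuousAt.inv₀ (by fun_prop) ?_) continuousAt_const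
      rw [hp]; norm_num
    exact this
  have h0 : radialProj 0 p = p := by simp [radialProj, gN, hp]
  rw [h0] at h
  exact h.mono_left nhdsWithin_le_nhds

/-! ### Simple polygons replacing an arc that crosses cells -/

/-- The segment from `p` to `q` without `q`. -/
def hseg (p q : Plane) : Set Plane := AffineMap.lineMap p q '' Ico (0 : ℝ) 1

/-- The polygon with vertices `P 0, …, P n` is simple. -/
structure SimplePolygon (P : ℕ → Plane) (n : ℕ) : Prop where
  ne : ∀ i < n, P i ≠ P (i + 1)
  disj : ∀ i < n, ∀ j < n, i ≠ j → ∀ x ∈ hseg (P i) (P (i + 1)), x ∉ hseg (P j) (P (j + 1))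
  last : ∀ i < n, P n ∉ hseg (P i) (P (i + 1))

/-- The vertices of the path `p, φ(p), φ(q), q`. -/
def strandVertex (s : ℝ) (p q : Plane) : ℕ → Plane
  | 0 => p
  | 1 => radialProj s p
  | 2 => radialProj s q
  | _ => q

section
variable {s : ℝ} {p q : Plane}

theorem mem_strand_cases {r : ℕ} (hr : r < 3) {x : Plane}
    (hx : x ∈ hseg (strandVertex s p q r) (strandVertex s p q (r + 1))) :
    (r = 0 ∧ ∃ t ∈ Ico (0 : ℝ) 1, x = AffineMap.lineMap p (radialProj s p) t) ∨
    (r = 1 ∧ ∃ t ∈ Ico (0 : ℝ) 1, x = AffineMap.lineMap (radialProj s p) (radialProj s q) t) ∨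
    (r = 2 ∧ ∃ t ∈ Ioc (0 : ℝ) 1, x = AffineMap.lineMap q (radialProj s q) t) := by
  obtain ⟨t, ht, rfl⟩ := hx
  interval_cases r
  · exact Or.inl ⟨rfl, t, ht, rfl⟩
  · exact Or.inr (Or.inl ⟨rfl, t, ht, rfl⟩)
  · refine Or.inr (Or.inr ⟨rfl, 1 - t, ⟨by linarith [ht.2], by linarith [ht.1]⟩, ?_⟩)
    rw [AffineMap.lineMap_apply_one_sub]
    rfl

theorem strandVertex_ne (hs : 0 < s) (hp : supN p = 1) (hq : supN q = 1) (hpq : p ≠ q) {r : ℕ}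
    (hr : r < 3) :
    strandVertex s p q r ≠ strandVertex s p q (r + 1) := by
  have h : ∀ p, supN p = 1 → p ≠ radialProj s p := fun p hp h => by
    have h1 := one_lt_gN hs hp
    rw [h, gN_radialProj hs hp] at h1
    exact lt_irrefl _ h1
  interval_cases r
  · exact h p hp
  · exact fun h => hpq (radialProj_inj hs hp hq h)
  · exact (h q hq).symm

/-- Apart from its starting vertex a strand without its end lies in the open cell, so strands in
different cells cannot meet away from the crossing points. -/
theorem strand_eq_or_supN_lt (hs : 0 < s) (hp : supN p = 1) (hq : supN q = 1) {r : ℕ} (hr : r < 3)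
    {x : Plane}
    (hx : x ∈ hseg (strandVertex s p q r) (strandVertex s p q (r + 1))) :
    (r = 0 ∧ x = p) ∨ supN x < 1 := by
  rcases mem_strand_cases hr hx with ⟨h, t, ht, rfl⟩ | ⟨-, t, ht, rfl⟩ | ⟨-, t, ht, rfl⟩
  · rcases ht.1.lt_or_eq with h0 | h0
    · exact Or.inr (supN_stub_lt hs hp ⟨h0, ht.2.le⟩)
    · rw [← h0, AffineMap.lineMap_apply_zero]
      exact Or.inl ⟨h, rfl⟩
  · exact Or.inr (supN_lt_of_gN_le hs (gN_lineMap_le hs (gN_radialProj hs hp).le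
      (gN_radialProj hs hq).le (Ico_subset_Icc_self ht)))
  · exact Or.inr (supN_stub_lt hs hq ht)

theorem strand_self_disjoint (hs : 0 < s) (hp : supN p = 1) (hq : supN q = 1) (hpq : p ≠ q)
    {r r' : ℕ} (hr : r < 3) (hr' : r' < 3) (hrr : r ≠ r')
    {x : Plane} (hx : x ∈ hseg (strandVertex s p q r) (strandVertex s p q (r + 1)))
    (hx' : x ∈ hseg (strandVertex s p q r') (strandVertex s p q (r' + 1))) : False := by
  wlog hlt : r < r' generalizing r r'
  · exact this hr' hr hrr.symm hx' hx (lt_of_le_of_ne (not_lt.1 hlt) hrr.symm)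
  have hpq' : radialProj s p ≠ radialProj s q := fun h => hpq (radialProj_inj hs hp hq h)
  rcases mem_strand_cases hr hx with ⟨h, t, ht, rfl⟩ | ⟨h, t, ht, rfl⟩ | ⟨h, t, ht, rfl⟩ <;>
  rcases mem_strand_cases hr' hx' with
    ⟨h', t', ht', e⟩ | ⟨h', t', ht', e⟩ | ⟨h', t', ht', e⟩ <;> try omega
  · have h1 := one_lt_gN_stub hs hp ht
    rw [e] at h1
    exact absurd h1 (not_lt.2 (gN_lineMap_le hs (gN_radialProj hs hp).le
      (gN_radialProj hs hq).le (Ico_subset_Icc_self ht')))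
  · exact stub_disjoint hs hp hq hpq (Ico_subset_Icc_self ht) (Ioc_subset_Icc_self ht') e
  · have h1 := one_le_gN_stub hs hq (Ioc_subset_Icc_self ht')
    rw [← e] at h1
    rcases ht.1.lt_or_eq with h0 | h0
    · exact absurd h1 (not_le.2 (gN_lineMap_lt hs (gN_radialProj hs hp).le
        (gN_radialProj hs hq).le hpq' ⟨h0, ht.2⟩))
    · rw [← h0, AffineMap.lineMap_apply_zero] at e
      refine stub_disjoint hs hp hq hpq (t := 1) (by simp) (Ioc_subset_Icc_self ht') ?_
      rw [← e, AffineMap.lineMap_apply_one]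

/-- Nine combinations of stub and chord; the topological information `hch` enters only for chord
against chord. -/
theorem strands_disjoint (hs : 0 < s) (hp : supN p = 1) (hq : supN q = 1) {p' q' : Plane}
    (hp' : supN p' = 1) (hq' : supN q' = 1)
    (hpq : p ≠ q) (hpq' : p' ≠ q') (h1 : p ≠ p') (h2 : p ≠ q') (h3 : q ≠ p') (h4 : q ≠ q')
    (hch : ∀ l ∈ Icc (0 : ℝ) 1, ∀ m ∈ Icc (0 : ℝ) 1,
      AffineMap.lineMap (radialProj s p) (radialProj s q) l ≠
        AffineMap.lineMap (radialProj s p') (radialProj s q') m)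
    {r r' : ℕ} (hr : r < 3) (hr' : r' < 3)
    {x : Plane} (hx : x ∈ hseg (strandVertex s p q r) (strandVertex s p q (r + 1)))
    (hx' : x ∈ hseg (strandVertex s p' q' r') (strandVertex s p' q' (r' + 1))) : False := by
  rcases mem_strand_cases hr hx with ⟨h, t, ht, rfl⟩ | ⟨h, t, ht, rfl⟩ | ⟨h, t, ht, rfl⟩ <;>
  rcases mem_strand_cases hr' hx' with
    ⟨h', t', ht', e⟩ | ⟨h', t', ht', e⟩ | ⟨h', t', ht', e⟩ <;>
  first
  | replace ht := Ico_subset_Icc_self ht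
  | replace ht := Ioc_subset_Icc_self ht
  all_goals first
  | replace ht' := Ico_subset_Icc_self ht'
  | replace ht' := Ioc_subset_Icc_self ht'
  · exact stub_disjoint hs hp hp' h1 ht ht' e
  · exact stub_chord_disjoint hs hp' hq' hp h1 h2 hpq' ht ht' e
  · exact stub_disjoint hs hp hq' h2 ht ht' e
  · exact stub_chord_disjoint hs hp hq hp' h1.symm h3.symm hpq ht' ht e.symm
  · exact hch _ ht _ ht' e
  · exact stub_chord_disjoint hs hp hq hq' h2.symm h4.symm hpq ht' ht e.symm
  · exact stub_disjoint hs hq hp' h3 ht ht' e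
  · exact stub_chord_disjoint hs hp' hq' hq h3 h4 hpq' ht ht' e
  · exact stub_disjoint hs hq hq' h4 ht ht' e

end

theorem mem_hseg_map (A : Plane ≃ᵃ[ℝ] Plane) {p q x : Plane} (hx : x ∈ hseg p q) :
    A x ∈ hseg (A p) (A q) := by
  obtain ⟨t, ht, rfl⟩ := hx
  exact ⟨t, ht, (AffineMap.apply_lineMap A.toAffineMap p q t).symm⟩

/-- A path that crosses cells can be replaced by a simple polygon, which in each cell consists of
three segments. -/
theorem exists_simplePolygon {J : ℕ} {z : ℝ → Plane} {τ : ℕ → ℝ}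
    (hz : ContinuousOn z (Icc 0 1)) (hinj : InjOn z (Icc 0 1))
    (hτ : ∀ j < J, τ j < τ (j + 1)) (hτI : ∀ j ≤ J, τ j ∈ Icc (0 : ℝ) 1)
    (A : ℕ → Plane ≃ᵃ[ℝ] Plane)
    (hin : ∀ j < J, ∀ t ∈ Icc (τ j) (τ (j + 1)), supN (A j (z t)) ≤ 1)
    (hout : ∀ j < J, ∀ i ≤ J, 1 ≤ supN (A j (z (τ i))))
    (hcell : ∀ i < J, ∀ j < J, i < j → (A i = A j ∧ i + 1 ≠ j) ∨
      ∀ x, supN (A i x) < 1 → ¬ supN (A j x) < 1)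
    {ν : ℝ} (hν : 0 < ν) :
    ∃ P : ℕ → Plane, SimplePolygon P (3 * J) ∧ (∀ j ≤ J, P (3 * j) = z (τ j)) ∧
      ∀ j < J, dist (P (3 * j + 1)) (z (τ j)) < ν ∧ dist (P (3 * j + 2)) (z (τ (j + 1))) < ν := by
  have hτlt : ∀ i j, i < j → j ≤ J → τ i < τ j := by
    intro i j hij
    induction j, hij using Nat.le_induction with
    | base => intro h; exact hτ i (by omega)
    | succ j _ ih => intro h; exact (ih (by omega)).trans (hτ j (by omega))
  have hne : ∀ i j, i ≤ J → j ≤ J → i ≠ j → z (τ i) ≠ z (τ j) := by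
    intro i j hi hj hij h
    have := hinj (hτI i hi) (hτI j hj) h
    rcases lt_or_gt_of_ne hij with h' | h'
    · exact absurd this (hτlt i j h' hj).ne
    · exact absurd this (hτlt j i h' hi).ne'
  have hP1 : ∀ j < J, supN (A j (z (τ j))) = 1 := fun j hj =>
    le_antisymm (hin j hj _ ⟨le_rfl, (hτ j hj).le⟩) (hout j hj j hj.le)
  have hQ1 : ∀ j < J, supN (A j (z (τ (j + 1)))) = 1 := fun j hj =>
    le_antisymm (hin j hj _ ⟨(hτ j hj).le, le_rfl⟩) (hout j hj (j + 1) hj)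
  -- As s tends to 0 the projected points tend to the crossing points; only finitely many have to be
  -- ν-close, so one s serves all cells.
  have hclose : ∀ᶠ s in 𝓝[>] (0 : ℝ), ∀ j ∈ Finset.range J,
      dist ((A j).symm (radialProj s (A j (z (τ j))))) (z (τ j)) < ν ∧
      dist ((A j).symm (radialProj s (A j (z (τ (j + 1)))))) (z (τ (j + 1))) < ν := by
    rw [Filter.eventually_all_finset]
    intro j hj
    rw [Finset.mem_range] at hj
    have key : ∀ p, supN (A j p) = 1 → ∀ᶠ s in 𝓝[>] (0 : ℝ),
        dist ((A j).symm (radialProj s (A j p))) p < ν := by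
      intro p hp
      have hc : Continuous (A j).symm := (A j).symm.toAffineMap.continuous_of_finiteDimensional
      have h := (hc.tendsto (A j p)).comp (tendsto_radialProj hp)
      rw [AffineEquiv.symm_apply_apply] at h
      exact h (Metric.ball_mem_nhds p hν)
    exact (key _ (hP1 j hj)).and (key _ (hQ1 j hj))
  obtain ⟨s, hsν, hs⟩ := (hclose.and self_mem_nhdsWithin).exists
  replace hs : 0 < s := hs
  set V : ℕ → ℕ → Plane := fun j r =>
    strandVertex s (A j (z (τ j))) (A j (z (τ (j + 1)))) r with hV
  set P : ℕ → Plane := fun i =>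
    if i < 3 * J then (A (i / 3)).symm (V (i / 3) (i % 3)) else z (τ J) with hPdef
  have hPj : ∀ j ≤ J, P (3 * j) = z (τ j) := by
    intro j hj
    rcases hj.lt_or_eq with h | h
    · have h1 : 3 * j < 3 * J := by omega
      have h2 : 3 * j / 3 = j := by omega
      have h3 : 3 * j % 3 = 0 := by omega
      simp only [hPdef, h1, if_true, h2, h3, hV, strandVertex]
      exact (A j).symm_apply_apply _
    · subst h; simp [hPdef]
  have hPV : ∀ j < J, ∀ r ≤ 3, P (3 * j + r) = (A j).symm (V j r) := by
    intro j hj r hr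
    rcases hr.lt_or_eq with h | h
    · have h1 : 3 * j + r < 3 * J := by omega
      have h2 : (3 * j + r) / 3 = j := by omega
      have h3 : (3 * j + r) % 3 = r := by omega
      simp only [hPdef, h1, if_true, h2, h3]
    · subst h
      rw [show 3 * j + 3 = 3 * (j + 1) by ring, hPj _ hj]
      exact ((A j).symm_apply_apply _).symm
  have hseg_mem : ∀ j < J, ∀ r < 3, ∀ x ∈ hseg (P (3 * j + r)) (P (3 * j + r + 1)),
      A j x ∈ hseg (V j r) (V j (r + 1)) := by
    intro j hj r hr x hx
    have := mem_hseg_map (A j) hx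
    rwa [hPV j hj r hr.le, add_assoc, hPV j hj (r + 1) hr, AffineEquiv.apply_symm_apply,
      AffineEquiv.apply_symm_apply] at this
  have hpq : ∀ j < J, A j (z (τ j)) ≠ A j (z (τ (j + 1))) := fun j hj =>
    (A j).injective.ne (hne _ _ hj.le hj (by omega))
  have hdich : ∀ j < J, ∀ r < 3, ∀ x ∈ hseg (P (3 * j + r)) (P (3 * j + r + 1)),
      x = z (τ j) ∨ supN (A j x) < 1 := by
    intro j hj r hr x hx
    rcases strand_eq_or_supN_lt hs (hP1 j hj) (hQ1 j hj) hr (hseg_mem j hj r hr x hx) with h | h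
    · exact Or.inl ((A j).injective h.2)
    · exact Or.inr h
  have hsplit : ∀ i < 3 * J, ∃ j < J, ∃ r < 3, i = 3 * j + r := fun i hi =>
    ⟨i / 3, by omega, i % 3, by omega, by omega⟩
  refine ⟨P, ⟨?_, ?_, ?_⟩, hPj, ?_⟩
  · intro i hi
    obtain ⟨j, hj, r, hr, rfl⟩ := hsplit i hi
    rw [hPV j hj r hr.le, add_assoc, hPV j hj (r + 1) hr]
    exact (A j).symm.injective.ne (strandVertex_ne hs (hP1 j hj) (hQ1 j hj) (hpq j hj) hr)
  · have main : ∀ j < J, ∀ r < 3, ∀ j' < J, ∀ r' < 3, j < j' →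
        ∀ x ∈ hseg (P (3 * j + r)) (P (3 * j + r + 1)),
        x ∉ hseg (P (3 * j' + r')) (P (3 * j' + r' + 1)) := by
      intro j hj r hr j' hj' r' hr' hjj x hx hx'
      rcases hdich j hj r hr x hx with h | h
      · rcases hdich j' hj' r' hr' x hx' with h' | h'
        · exact hne j j' hj.le hj'.le hjj.ne (h.symm.trans h')
        · rw [h] at h'
          exact absurd h' (not_lt.2 (hout j' hj' j hj.le))
      · rcases hdich j' hj' r' hr' x hx' with h' | h'
        · rw [h'] at h
          exact absurd h (not_lt.2 (hout j hj j' hj'.le))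
        -- A common point now lies in the interior of both cells, so the cells coincide and the two
        -- passages through them are not consecutive.
        rcases hcell j hj j' hj' hjj with ⟨hA, hadj⟩ | hdis
        · have m := hseg_mem j hj r hr x hx
          have m' := hseg_mem j' hj' r' hr' x hx'
          have hP1' := hP1 j' hj'
          have hQ1' := hQ1 j' hj'
          have hin' := hin j' hj'
          simp only [hV, ← hA] at m' hP1' hQ1' hin'
          have hi := (A j).injective
          -- The j-th passage of the arc, reparametrized over [0,1].
          set g : ℕ → ℝ → ℝ := fun j t => τ j + t * (τ (j + 1) - τ j) with hg
          have hgI : ∀ j < J, ∀ t ∈ Icc (0 : ℝ) 1, g j t ∈ Icc (τ j) (τ (j + 1)) := by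
            intro j hj t ht
            have := hτ j hj
            constructor
            · have := mul_nonneg ht.1 (sub_nonneg.2 this.le)
              simp only [hg]; linarith
            · have := mul_le_of_le_one_left (sub_nonneg.2 this.le) ht.2
              simp only [hg]; linarith
          have hsub : ∀ j < J, Icc (τ j) (τ (j + 1)) ⊆ Icc 0 1 := fun j hj =>
            Icc_subset_Icc (hτI j hj.le).1 (hτI (j + 1) hj).2
          have hAc : Continuous (A j) := (A j).toAffineMap.continuous_of_finiteDimensional
          have hcont : ∀ k < J, ContinuousOn (fun t => A j (z (g k t))) (Icc 0 1) := by
            intro k hk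
            apply hAc.comp_continuousOn
            apply hz.comp (by simp only [hg]; fun_prop)
            exact fun t ht => hsub k hk (hgI k hk t ht)
          refine strands_disjoint hs (hP1 j hj) (hQ1 j hj) hP1' hQ1' (hpq j hj)
            (hi.ne (hne _ _ hj'.le hj' (by omega)))
            (hi.ne (hne _ _ hj.le hj'.le (by omega))) (hi.ne (hne _ _ hj.le hj' (by omega)))
            (hi.ne (hne _ _ hj hj'.le (by omega))) (hi.ne (hne _ _ hj hj' (by omega)))
            ?_ hr hr' m m'
          intro l hl mm hmm
          have hg0 : ∀ j, g j 0 = τ j := fun j => by simp [hg]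
          have hg1 : ∀ j, g j 1 = τ (j + 1) := fun j => by simp [hg]
          have := radialProj_chords_disjoint hs (hcont j hj) (hcont j' hj')
            (fun t ht => hin j hj _ (hgI j hj t ht)) (fun t ht => hin' _ (hgI j' hj' t ht))
            (by
              intro t ht t' ht'
              apply hi.ne
              intro h
              have h1 := hgI j hj t ht
              have h2 := hgI j' hj' t' ht'
              have h3 := hinj (hsub j hj h1) (hsub j' hj' h2) h
              -- Nonconsecutive passages have disjoint time intervals, so injectivity of z makes the
              -- two arcs disjoint including their ends.
              have h4 := hτlt (j + 1) j' (by omega) hj'.le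
              linarith [h1.2, h2.1])
            (by rw [hg0, hg1]; exact hpq j hj)
            (by rw [hg0, hg1]; exact hi.ne (hne _ _ hj'.le hj' (by omega)))
            (by rw [hg0]; exact hP1 j hj) (by rw [hg1]; exact hQ1 j hj)
            (by rw [hg0]; exact hP1') (by rw [hg1]; exact hQ1') hl hmm
          simpa only [hg0, hg1] using this
        · exact hdis x h h'
    intro i hi i' hi' hii x hx hx'
    obtain ⟨j, hj, r, hr, rfl⟩ := hsplit i hi
    obtain ⟨j', hj', r', hr', rfl⟩ := hsplit i' hi'
    rcases lt_trichotomy j j' with h | h | h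
    · exact main j hj r hr j' hj' r' hr' h x hx hx'
    · subst h
      exact strand_self_disjoint hs (hP1 j hj) (hQ1 j hj) (hpq j hj) hr hr' (by omega)
        (hseg_mem j hj r hr x hx) (hseg_mem j hj r' hr' x hx')
    · exact main j' hj' r' hr' j hj r hr h x hx' hx
  · intro i hi hx
    obtain ⟨j, hj, r, hr, rfl⟩ := hsplit i hi
    rw [hPj J le_rfl] at hx
    rcases hdich j hj r hr _ hx with h | h
    · exact hne J j le_rfl hj.le (by omega) h
    · exact absurd h (not_lt.2 (hout j hj J le_rfl))
  · intro j hj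
    have := hsν j (Finset.mem_range.2 hj)
    rw [hPV j hj 1 (by omega), hPV j hj 2 (by omega)]
    exact this

/-! ### Grid lines that an arc of bounded length crosses a bounded number of times -/

/-- A local minimum value is the minimum over some interval with rational ends, and that interval
determines it. Grid levels avoiding extremal values are genuinely crossed, so consecutive passages
of the arc lie in different cells. -/
theorem countable_isLocalMin_values (h : ℝ → ℝ) :
    {c | ∃ t, IsLocalMin h t ∧ h t = c}.Countable := by
  have : ∀ c : {c | ∃ t, IsLocalMin h t ∧ h t = c}, ∃ q : ℚ × ℚ, ∃ t ∈ Ioo (q.1 : ℝ) q.2,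
      h t = c ∧ ∀ s ∈ Ioo (q.1 : ℝ) q.2, (c : ℝ) ≤ h s := by
    rintro ⟨c, t, ht, rfl⟩
    obtain ⟨a, b, hab, hsub⟩ := mem_nhds_iff_exists_Ioo_subset.1 ht
    obtain ⟨q, hq1, hq2⟩ := exists_rat_btwn hab.1
    obtain ⟨r, hr1, hr2⟩ := exists_rat_btwn hab.2
    exact ⟨(q, r), t, ⟨hq2, hr1⟩, rfl, fun s hs => hsub ⟨hq1.trans hs.1, hs.2.trans hr2⟩⟩
  choose q hq using this
  have hinj : Function.Injective q := by
    intro c c' hcc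
    obtain ⟨t, ht, htc, hmin⟩ := hq c
    obtain ⟨t', ht', htc', hmin'⟩ := hq c'
    apply Subtype.ext
    apply le_antisymm
    · rw [← htc']; exact hmin t' (hcc ▸ ht')
    · rw [← htc]; exact hmin' t (hcc ▸ ht)
  exact countable_coe_iff.1 hinj.countable

theorem countable_isLocalExtr_values (h : ℝ → ℝ) :
    {c | ∃ t, IsLocalExtr h t ∧ h t = c}.Countable := by
  have h1 := countable_isLocalMin_values h
  have h2 := (countable_isLocalMin_values (-h)).image (fun x => -x)
  refine (h1.union h2).mono ?_
  rintro c ⟨t, ht | ht, rfl⟩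
  · exact Or.inl ⟨t, ht, rfl⟩
  · exact Or.inr ⟨-h t, ⟨t, ht.neg, rfl⟩, by simp⟩

/-- A function of bounded variation has a level in any interval, outside a given countable set,
that it takes only a controlled number of times. -/
theorem exists_level {h V : ℝ → ℝ} (hc : ContinuousOn h (Icc 0 1)) {L : ℝ}
    (hV : ∀ s ∈ Icc (0 : ℝ) 1, ∀ t ∈ Icc (0 : ℝ) 1, s ≤ t → |h t - h s| ≤ V t - V s)
    (hL : V 1 - V 0 ≤ L) {α β : ℝ} (hαβ : α < β) {N : Set ℝ} (hN : N.Countable) :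
    ∃ c ∈ Ioo α β, c ∉ N ∧ {t ∈ Icc (0 : ℝ) 1 | h t = c}.Finite ∧
      ({t ∈ Icc (0 : ℝ) 1 | h t = c}.ncard : ℝ) ≤ L / (β - α) := by
  have hL0 : 0 ≤ L := by
    have := hV 0 (by simp) 1 (by simp) zero_le_one
    linarith [abs_nonneg (h 1 - h 0)]
  set I : ℕ → ℕ → Set ℝ := fun n i => Icc ((i : ℝ) / n) ((i + 1 : ℕ) / n) with hI
  have hI01 : ∀ n i, i < n → I n i ⊆ Icc 0 1 := by
    intro n i hi t ht
    have hn : (0 : ℝ) < n := by exact_mod_cast (by omega : 0 < n)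
    refine ⟨le_trans (by positivity) ht.1, ht.2.trans ?_⟩
    rw [div_le_one hn]; exact_mod_cast hi
  have hmeas : ∀ n i, i < n → MeasurableSet (h '' I n i) := fun n i hi =>
    (isCompact_Icc.image_of_continuousOn (hc.mono (hI01 n i hi))).isClosed.measurableSet
  -- F n c counts the intervals of length 1/n whose image contains c. Its integral is at most the
  -- sum of the oscillations, hence at most L, and Fatou transfers the bound to the lower limit.
  set F : ℕ → ℝ → ℝ≥0∞ := fun n c => ∑ i ∈ Finset.range n, (h '' I n i).indicator 1 c with hF
  have hFm : ∀ n, Measurable (F n) := fun n =>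
    Finset.measurable_sum _ fun i hi =>
      measurable_one.indicator (hmeas n i (Finset.mem_range.1 hi))
  have hFint : ∀ n, 0 < n → ∫⁻ c in Ioo α β, F n c ≤ ENNReal.ofReal L := by
    intro n hn
    have hn' : (0 : ℝ) < n := by exact_mod_cast hn
    have hmemI : ∀ i ≤ n, ((i : ℝ) / n) ∈ Icc (0 : ℝ) 1 := fun i hi =>
      ⟨by positivity, by rw [div_le_one hn']; exact_mod_cast hi⟩
    have hle : ∀ i : ℕ, ((i : ℝ) / n) ≤ ((i + 1 : ℕ) / n) := fun i => by
      gcongr; simp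
    calc ∫⁻ c in Ioo α β, F n c ≤ ∫⁻ c, F n c := setLIntegral_le_lintegral _ _
      _ = ∑ i ∈ Finset.range n, volume (h '' I n i) := by
          simp only [hF]
          rw [lintegral_finsetSum' _ fun i hi =>
            (measurable_one.indicator (hmeas n i (Finset.mem_range.1 hi))).aemeasurable]
          refine Finset.sum_congr rfl fun i hi => ?_
          rw [lintegral_indicator_one (hmeas n i (Finset.mem_range.1 hi))]
      _ ≤ ∑ i ∈ Finset.range n, ENNReal.ofReal (V ((i + 1 : ℕ) / n) - V ((i : ℝ) / n)) := by
          refine Finset.sum_le_sum fun i hi => ?_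
          have hi := Finset.mem_range.1 hi
          refine (Real.volume_le_diam _).trans ?_
          refine Metric.ediam_le ?_
          rintro _ ⟨s, hs, rfl⟩ _ ⟨t, ht, rfl⟩
          rw [edist_dist]
          apply ENNReal.ofReal_le_ofReal
          wlog hst : s ≤ t generalizing s t
          · rw [dist_comm]; exact this t ht s hs (le_of_not_ge hst)
          rw [dist_comm, Real.dist_eq]
          have h1 := hV s (hI01 n i hi hs) t (hI01 n i hi ht) hst
          have h2 := hV _ (hmemI i hi.le) s (hI01 n i hi hs) hs.1
          have h3 := hV t (hI01 n i hi ht) _ (hmemI (i + 1) hi) ht.2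
          linarith [abs_nonneg (h s - h ((i : ℝ) / n)),
            abs_nonneg (h (((i + 1 : ℕ) : ℝ) / n) - h t)]
      _ = ENNReal.ofReal (∑ i ∈ Finset.range n, (V ((i + 1 : ℕ) / n) - V ((i : ℝ) / n))) := by
          rw [ENNReal.ofReal_sum_of_nonneg]
          intro i hi
          have hi := Finset.mem_range.1 hi
          exact (abs_nonneg _).trans (hV _ (hmemI i hi.le) _ (hmemI (i + 1) hi) (hle i))
      _ ≤ ENNReal.ofReal L := by
          apply ENNReal.ofReal_le_ofReal
          rw [Finset.sum_range_sub (fun i : ℕ => V ((i : ℝ) / n))]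
          simpa [div_self hn'.ne'] using hL
  have hlim : ∫⁻ c in Ioo α β, liminf (fun n => F n c) atTop ≤ ENNReal.ofReal L := by
    refine (lintegral_liminf_le hFm).trans ?_
    refine liminf_le_of_le (by isBoundedDefault) fun b hb => ?_
    obtain ⟨n, hn, hn1⟩ := (hb.and (eventually_gt_atTop 0)).exists
    exact hn.trans (hFint n hn1)
  have hvol : volume (Ioo α β) = ENNReal.ofReal (β - α) := Real.volume_Ioo
  have hpos : 0 < β - α := sub_pos.2 hαβ
  have hμ0 : volume.restrict (Ioo α β) ≠ 0 := by
    rw [Ne, Measure.restrict_eq_zero, hvol]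
    simpa using hαβ
  have : IsFiniteMeasure (volume.restrict (Ioo α β)) := ⟨by
    rw [Measure.restrict_apply_univ, hvol]; exact ENNReal.ofReal_lt_top⟩
  have hnull : (volume.restrict (Ioo α β)) ((Ioo α β)ᶜ ∪ N) = 0 := by
    rw [measure_union_null_iff]
    refine ⟨?_, ?_⟩
    · rw [Measure.restrict_apply measurableSet_Ioo.compl]; simp
    · exact (Measure.absolutelyContinuous_of_le Measure.restrict_le_self) (hN.measure_zero _)
  -- Some level outside a null set has a count at most the average L / (β - α).
  obtain ⟨c, hcN, hcle⟩ := exists_notMem_null_le_laverage hμ0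
    (f := fun c => liminf (fun n => F n c) atTop) (Measurable.liminf hFm).aemeasurable hnull
  simp only [mem_union, mem_compl_iff, not_or, not_not] at hcN
  have hb : liminf (fun n => F n c) atTop ≤ ENNReal.ofReal (L / (β - α)) := by
    refine hcle.trans ?_
    rw [laverage_eq, Measure.restrict_apply_univ, hvol, ENNReal.ofReal_div_of_pos hpos]
    gcongr
  have hfin : ∀ S : Finset ℝ, (∀ t ∈ S, t ∈ Icc (0 : ℝ) 1 ∧ h t = c) →
      (S.card : ℝ) ≤ L / (β - α) := by
    intro S hS
    -- For large n distinct points of S fall into distinct intervals, so F n c counts at least all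
    -- of S.
    have hsep : ∀ᶠ n : ℕ in atTop, ∀ x ∈ S ×ˢ S, x.1 ≠ x.2 → 1 / (n : ℝ) < |x.1 - x.2| := by
      rw [Filter.eventually_all_finset]
      intro x _
      by_cases hx : x.1 = x.2
      · simp [hx]
      · have := (tendsto_one_div_atTop_nhds_zero_nat (𝕜 := ℝ)).eventually
          (gt_mem_nhds (abs_pos.2 (sub_ne_zero.2 hx)))
        filter_upwards [this] with n hn _ using hn
    have hcard : ∀ᶠ n : ℕ in atTop, (S.card : ℝ≥0∞) ≤ F n c := by
      filter_upwards [hsep, eventually_gt_atTop 0] with n hn hn0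
      have hn' : (0 : ℝ) < n := by exact_mod_cast hn0
      -- The index of an interval containing t. Truncated subtraction gives index 0 to t = 0, where
      -- the ceiling is 0.
      set g : ℝ → ℕ := fun t => ⌈(n : ℝ) * t⌉₊ - 1 with hg
      have hgI : ∀ t ∈ S, g t < n ∧ t ∈ I n (g t) := by
        intro t ht
        have ht01 := (hS t ht).1
        have h1 : ⌈(n : ℝ) * t⌉₊ ≤ n := by
          rw [Nat.ceil_le]; exact mul_le_of_le_one_right hn'.le ht01.2
        refine ⟨by simp only [hg]; omega, ?_, ?_⟩
        · rw [div_le_iff₀ hn']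
          rcases Nat.eq_zero_or_pos ⌈(n : ℝ) * t⌉₊ with h0 | h0
          · simp only [hg, h0]
            simpa using mul_nonneg ht01.1 hn'.le
          · have := Nat.ceil_lt_add_one (mul_nonneg hn'.le ht01.1)
            simp only [hg]
            rw [Nat.cast_sub h0]
            push_cast
            linarith
        · rw [le_div_iff₀ hn']
          have h2 := Nat.le_ceil ((n : ℝ) * t)
          have h3 : ⌈(n : ℝ) * t⌉₊ ≤ g t + 1 := by simp only [hg]; omega
          have h4 : ((⌈(n : ℝ) * t⌉₊ : ℕ) : ℝ) ≤ ((g t + 1 : ℕ) : ℝ) := by exact_mod_cast h3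
          linarith
      have hginj : InjOn g S := by
        intro t ht t' ht' hgg
        by_contra hne
        have h1 := hn (t, t') (Finset.mem_product.2 ⟨ht, ht'⟩) hne
        have h2 := (hgI t ht).2
        have h3 := (hgI t' ht').2
        rw [← hgg] at h3
        have h4 : ((g t + 1 : ℕ) : ℝ) / n = g t / n + 1 / n := by push_cast; ring
        simp only [hI, mem_Icc] at h2 h3
        rw [h4] at h2 h3
        have h5 : |t - t'| ≤ 1 / n := by
          rw [abs_le]; constructor <;> linarith [h2.1, h2.2, h3.1, h3.2]
        exact absurd h1 (not_lt.2 h5)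
      calc (S.card : ℝ≥0∞) = ∑ i ∈ S.image g, 1 := by
            rw [Finset.sum_const, Finset.card_image_of_injOn hginj]; simp
        _ = ∑ i ∈ S.image g, (h '' I n i).indicator 1 c := by
            refine Finset.sum_congr rfl fun i hi => ?_
            obtain ⟨t, ht, rfl⟩ := Finset.mem_image.1 hi
            rw [indicator_of_mem]
            · rfl
            · exact ⟨t, (hgI t ht).2, (hS t ht).2⟩
        _ ≤ F n c := by
            apply Finset.sum_le_sum_of_subset
            intro i hi
            obtain ⟨t, ht, rfl⟩ := Finset.mem_image.1 hi
            exact Finset.mem_range.2 (hgI t ht).1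
    have h1 : (S.card : ℝ≥0∞) ≤ ENNReal.ofReal (L / (β - α)) :=
      (le_liminf_of_le (by isBoundedDefault) hcard).trans hb
    rw [← ENNReal.ofReal_natCast] at h1
    exact (ENNReal.ofReal_le_ofReal_iff (by positivity)).1 h1
  have hfinite : {t ∈ Icc (0 : ℝ) 1 | h t = c}.Finite := by
    by_contra hinf
    obtain ⟨S, hS, hcard⟩ := Set.Infinite.exists_subset_card_eq hinf (⌊L / (β - α)⌋₊ + 1)
    have h1 := hfin S fun t ht => hS ht
    rw [hcard] at h1
    have h2 := Nat.lt_floor_add_one (L / (β - α))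
    push_cast at h1
    linarith
  refine ⟨c, hcN.1, hcN.2, hfinite, ?_⟩
  rw [ncard_eq_toFinset_card _ hfinite]
  exact hfin _ fun t ht => by simpa using ht

theorem grid_strictMono {c : ℤ → ℝ} {δ : ℝ} (hc : ∀ l : ℤ, c l ∈ Ioo (l * δ) ((l + 1) * δ)) :
    StrictMono c := by
  apply strictMono_int_of_lt_succ
  intro l
  have h1 := (hc l).2
  have h2 := (hc (l + 1)).1
  push_cast at h2
  linarith

/-- A continuous function that avoids the grid stays between two consecutive grid points. -/
theorem exists_grid_gap {c : ℤ → ℝ} {δ : ℝ} (hδ : 0 < δ)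
    (hc : ∀ l : ℤ, c l ∈ Ioo (l * δ) ((l + 1) * δ)) {g : ℝ → ℝ} {a b : ℝ} (hab : a < b)
    (hg : ContinuousOn g (Icc a b)) (hne : ∀ t ∈ Ioo a b, ∀ l, g t ≠ c l) :
    ∃ l : ℤ, ∀ t ∈ Icc a b, g t ∈ Icc (c l) (c (l + 1)) := by
  set m := (a + b) / 2 with hm
  have hmI : m ∈ Ioo a b := ⟨by linarith, by linarith⟩
  obtain ⟨l, hl1, hl2⟩ : ∃ l : ℤ, c l < g m ∧ g m < c (l + 1) := by
    have h1 : ⌊g m / δ⌋ * δ ≤ g m := by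
      rw [← le_div_iff₀ hδ]; exact Int.floor_le _
    have h2 : g m < (⌊g m / δ⌋ + 1) * δ := by
      rw [← div_lt_iff₀ hδ]; exact Int.lt_floor_add_one _
    rcases lt_or_gt_of_ne (hne m hmI ⌊g m / δ⌋) with h | h
    · refine ⟨⌊g m / δ⌋ - 1, ?_, by simpa using h⟩
      have := (hc (⌊g m / δ⌋ - 1)).2
      push_cast at this
      linarith
    · refine ⟨⌊g m / δ⌋, h, ?_⟩
      have := (hc (⌊g m / δ⌋ + 1)).1
      push_cast at this
      linarith
  refine ⟨l, ?_⟩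
  have hIoo : ∀ t ∈ Ioo a b, g t ∈ Icc (c l) (c (l + 1)) := by
    intro t ht
    have hpre : IsPreconnected (g '' Ioo a b) :=
      isPreconnected_Ioo.image _ (hg.mono Ioo_subset_Icc_self)
    have hmm : g m ∈ g '' Ioo a b := mem_image_of_mem _ hmI
    have htm : g t ∈ g '' Ioo a b := mem_image_of_mem _ ht
    constructor
    · by_contra hlt
      obtain ⟨s, hs, hsc⟩ := hpre.Icc_subset htm hmm ⟨(not_le.1 hlt).le, hl1.le⟩
      exact hne s hs l hsc
    · by_contra hlt
      obtain ⟨s, hs, hsc⟩ := hpre.Icc_subset hmm htm ⟨hl2.le, (not_le.1 hlt).le⟩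
      exact hne s hs _ hsc
  intro t ht
  have hcl : Icc a b ⊆ closure (Ioo a b) := by rw [closure_Ioo hab.ne]
  exact isClosed_Icc.closure_subset_iff.2 (image_subset_iff.2 hIoo)
    ((hg.mono (by rw [closure_Ioo hab.ne])).image_closure (mem_image_of_mem _ (hcl ht)))

/-- The affine map of the rectangle with the given sides onto the square `[-1,1]²`. -/
def rectMap (a b c d : ℝ) (hab : a < b) (hcd : c < d) : Plane ≃ᵃ[ℝ] Plane :=
  (AffineEquiv.constVAdd ℝ Plane (-!₂[(a + b) / 2, (c + d) / 2])).trans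
    (LinearEquiv.toAffineEquiv
      { toFun := fun v => !₂[2 / (b - a) * v 0, 2 / (d - c) * v 1]
        invFun := fun v => !₂[(b - a) / 2 * v 0, (d - c) / 2 * v 1]
        map_add' := by
          intro u v
          ext i
          fin_cases i <;> simp [mul_add]
        map_smul' := by
          intro t v
          ext i
          fin_cases i <;> simp [mul_left_comm]
        left_inv := by
          intro v
          have h1 : b - a ≠ 0 := (sub_pos.2 hab).ne'
          have h2 : d - c ≠ 0 := (sub_pos.2 hcd).ne'
          ext i
          fin_cases i <;> simp <;> field_simp
        right_inv := by
          intro v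
          have h1 : b - a ≠ 0 := (sub_pos.2 hab).ne'
          have h2 : d - c ≠ 0 := (sub_pos.2 hcd).ne'
          ext i
          fin_cases i <;> simp <;> field_simp })

theorem abs_rescale {a b x : ℝ} (hab : a < b) :
    |2 / (b - a) * (-((a + b) / 2) + x)| = |2 * x - a - b| / (b - a) := by
  have h : 0 < b - a := sub_pos.2 hab
  rw [← abs_of_pos h, ← abs_div, abs_of_pos h]
  congr 1
  field_simp
  ring

theorem supN_rectMap {a b c d : ℝ} (hab : a < b) (hcd : c < d) (x : Plane) :
    supN (rectMap a b c d hab hcd x) =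
      max (|2 * x 0 - a - b| / (b - a)) (|2 * x 1 - c - d| / (d - c)) := by
  rw [← abs_rescale hab, ← abs_rescale hcd]
  simp [supN, rectMap]

theorem supN_rectMap_le {a b c d : ℝ} (hab : a < b) (hcd : c < d) {x : Plane}
    (h0 : x 0 ∈ Icc a b) (h1 : x 1 ∈ Icc c d) : supN (rectMap a b c d hab hcd x) ≤ 1 := by
  rw [supN_rectMap]
  apply max_le
  · rw [div_le_one (sub_pos.2 hab), abs_le]; constructor <;> linarith [h0.1, h0.2]
  · rw [div_le_one (sub_pos.2 hcd), abs_le]; constructor <;> linarith [h1.1, h1.2]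

theorem supN_rectMap_lt {a b c d : ℝ} (hab : a < b) (hcd : c < d) {x : Plane}
    (h : supN (rectMap a b c d hab hcd x) < 1) : x 0 ∈ Ioo a b ∧ x 1 ∈ Ioo c d := by
  rw [supN_rectMap, max_lt_iff, div_lt_one (sub_pos.2 hab), div_lt_one (sub_pos.2 hcd), abs_lt,
    abs_lt] at h
  refine ⟨⟨?_, ?_⟩, ⟨?_, ?_⟩⟩ <;> linarith [h.1.1, h.1.2, h.2.1, h.2.2]

theorem exists_enumeration (T : Finset ℝ) {J : ℕ} (hT : T.card = J + 1) :
    ∃ τ : ℕ → ℝ, (∀ j < J, τ j < τ (j + 1)) ∧ (∀ j ≤ J, τ j ∈ T) ∧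
      (∀ t ∈ T, ∃ j ≤ J, τ j = t) := by
  refine ⟨fun j => if h : j < J + 1 then T.orderEmbOfFin hT ⟨j, h⟩ else 0, ?_, ?_, ?_⟩
  · intro j hj
    have h1 : j < J + 1 := by omega
    have h2 : j + 1 < J + 1 := by omega
    simp only [h1, h2, dif_pos]
    exact (T.orderEmbOfFin hT).strictMono (by simp)
  · intro j hj
    have h1 : j < J + 1 := by omega
    simp only [h1, dif_pos]
    exact T.orderEmbOfFin_mem hT _
  · intro t ht
    have : t ∈ Set.range (T.orderEmbOfFin hT) := by rw [T.range_orderEmbOfFin]; exact ht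
    obtain ⟨j, rfl⟩ := this
    have h1 : (j : ℕ) < J + 1 := j.2
    exact ⟨j, by omega, dif_pos h1⟩

theorem dist_le_of_mem_rect {a b c d δ : ℝ} {x y : Plane} (hδ : 0 < δ)
    (hx0 : x 0 ∈ Icc a b) (hx1 : x 1 ∈ Icc c d)
    (hy0 : y 0 ∈ Icc a b) (hy1 : y 1 ∈ Icc c d) (hab : b - a ≤ 2 * δ) (hcd : d - c ≤ 2 * δ) :
    dist x y ≤ 3 * δ := by
  rw [EuclideanSpace.dist_eq, Fin.sum_univ_two]
  apply Real.sqrt_le_iff.2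
  refine ⟨by positivity, ?_⟩
  have h0 : dist (x 0) (y 0) ≤ 2 * δ := by
    rw [Real.dist_eq, abs_le]; constructor <;> linarith [hx0.1, hx0.2, hy0.1, hy0.2]
  have h1 : dist (x 1) (y 1) ≤ 2 * δ := by
    rw [Real.dist_eq, abs_le]; constructor <;> linarith [hx1.1, hx1.2, hy1.1, hy1.2]
  -- (2δ)² + (2δ)² = 8δ² ≤ (3δ)².
  nlinarith [dist_nonneg (x := x 0) (y := y 0), dist_nonneg (x := x 1) (y := y 1)]

set_option maxHeartbeats 1000000 in
/-- Every arc of bounded length is close to a simple polygon with a bounded number of vertices,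
which lie near points of the arc. -/
theorem exists_grid_polygon (L R : ℝ) {δ : ℝ} (hδ : 0 < δ) : ∃ M : ℕ, ∀ (z : ℝ → Plane)
    (V : ℝ → ℝ), ContinuousOn z (Icc 0 1) → InjOn z (Icc 0 1) → (∀ t ∈ Icc (0 : ℝ) 1, ‖z t‖ ≤ R) →
    (∀ s ∈ Icc (0 : ℝ) 1, ∀ t ∈ Icc (0 : ℝ) 1, s ≤ t → dist (z t) (z s) ≤ V t - V s) →
    V 1 - V 0 ≤ L → ∀ ν : ℝ, 0 < ν →
    (∀ s ∈ Icc (0 : ℝ) 1, ∀ t ∈ Icc (0 : ℝ) 1, dist (z s) (z t) ≤ 6 * δ) ∨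
    ∃ J : ℕ, 1 ≤ J ∧ J ≤ M ∧ ∃ (τ : ℕ → ℝ) (P : ℕ → Plane), (∀ j < J, τ j < τ (j + 1)) ∧
      (∀ j ≤ J, τ j ∈ Icc (0 : ℝ) 1) ∧ SimplePolygon P (3 * J) ∧ (∀ j ≤ J, P (3 * j) = z (τ j)) ∧
      (∀ j < J, dist (P (3 * j + 1)) (z (τ j)) < ν ∧ dist (P (3 * j + 2)) (z (τ (j + 1))) < ν) ∧
      (∀ j < J, ∀ s ∈ Icc (τ j) (τ (j + 1)), ∀ t ∈ Icc (τ j) (τ (j + 1)),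
        dist (z s) (z t) ≤ 3 * δ) ∧
      (∀ t ∈ Icc 0 (τ 0), dist (z t) (z (τ 0)) ≤ 3 * δ) ∧
      (∀ t ∈ Icc (τ J) 1, dist (z t) (z (τ J)) ≤ 3 * δ) := by
  set K : ℤ := ⌈R / δ⌉ with hK
  set B : Finset ℤ := Finset.Icc (-K - 1) K with hB
  -- Two families of lines, `B.card` relevant levels in each, at most L / δ crossings per level: the
  -- bound does not see the particular arc.
  refine ⟨⌈2 * (B.card * (L / δ))⌉₊, ?_⟩
  intro z V hz hinj hR hV hL ν hν
  have hcoord : ∀ (x : Plane) (i : Fin 2), |x i| ≤ ‖x‖ := fun x i => PiLp.norm_apply_le x i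
  have hzi : ∀ i : Fin 2, ContinuousOn (fun t => z t i) (Icc 0 1) := fun i =>
    (by fun_prop : Continuous fun x : Plane => x i).comp_continuousOn hz
  have hlev := fun (i : Fin 2) (l : ℤ) (N : Set ℝ) (hN : N.Countable) =>
    exists_level (h := fun t => z t i) (V := V) (hzi i) (L := L)
      (fun s hs t ht hst => (hcoord (z t - z s) i).trans (by
        rw [← dist_eq_norm]; exact hV s hs t ht hst)) hL
      (show (l : ℝ) * δ < (l + 1) * δ by nlinarith) hN
  -- The levels to avoid: values at local extrema, where the arc may touch without crossing, and
  -- values at the two ends of the arc, so that 0 and 1 are not crossing times.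
  set E : Fin 2 → Set ℝ := fun i =>
    {c | ∃ t, IsLocalExtr (fun t => z t i) t ∧ z t i = c} ∪ {z 0 i, z 1 i} with hE
  have hEc : ∀ i, (E i).Countable := fun i =>
    (countable_isLocalExtr_values _).union (Set.toFinite _).countable
  have hTB : ∀ (i : Fin 2) (c : ℤ → ℝ), (∀ l : ℤ, c l ∈ Ioo (l * δ) ((l + 1) * δ)) →
      ∀ t ∈ Icc (0 : ℝ) 1, ∀ l, z t i = c l → l ∈ B := by
    intro i c hc t ht l h
    have h1 := (hcoord (z t) i).trans (hR t ht)
    rw [h, abs_le] at h1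
    have h2 := hc l
    rw [hB, Finset.mem_Icc]
    have h3 : R / δ ≤ K := Int.le_ceil _
    rw [div_le_iff₀ hδ] at h3
    constructor
    · by_contra hcon
      have : l + 1 ≤ -K - 1 := by omega
      have : (l : ℝ) + 1 ≤ -K - 1 := by exact_mod_cast this
      nlinarith [h2.2, h1.1]
    · by_contra hcon
      have : K + 1 ≤ l := by omega
      have : (K : ℝ) + 1 ≤ l := by exact_mod_cast this
      nlinarith [h2.1, h1.2]
  have hTfin : ∀ (i : Fin 2) (c : ℤ → ℝ), (∀ l : ℤ, c l ∈ Ioo (l * δ) ((l + 1) * δ)) →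
      (∀ l, {t ∈ Icc (0 : ℝ) 1 | z t i = c l}.Finite ∧
        ({t ∈ Icc (0 : ℝ) 1 | z t i = c l}.ncard : ℝ) ≤ L / δ) →
      ∃ T : Finset ℝ, (∀ t, t ∈ T ↔ t ∈ Icc (0 : ℝ) 1 ∧ ∃ l, z t i = c l) ∧
        (T.card : ℝ) ≤ B.card * (L / δ) := by
    intro i c hc hfin
    refine ⟨B.biUnion fun l => (hfin l).1.toFinset, ?_, ?_⟩
    · intro t
      simp only [Finset.mem_biUnion, Finite.mem_toFinset, mem_ofPred_eq]
      constructor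
      · rintro ⟨l, -, ht, h⟩
        exact ⟨ht, l, h⟩
      · rintro ⟨ht, l, h⟩
        exact ⟨l, hTB i c hc t ht l h, ht, h⟩
    · calc ((B.biUnion fun l => (hfin l).1.toFinset).card : ℝ)
          ≤ ∑ l ∈ B, ((hfin l).1.toFinset.card : ℝ) := by exact_mod_cast Finset.card_biUnion_le
        _ ≤ ∑ l ∈ B, L / δ := by
            refine Finset.sum_le_sum fun l _ => ?_
            rw [← ncard_eq_toFinset_card _ (hfin l).1]
            exact (hfin l).2
        _ = B.card * (L / δ) := by rw [Finset.sum_const, nsmul_eq_mul]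
  have hdelta : ∀ l : ℤ, ((l : ℝ) + 1) * δ - l * δ = δ := fun l => by ring
  choose c hcI hcE hcfin hccard using fun l => hlev 0 l (E 0) (hEc 0)
  simp only [hdelta] at hccard
  obtain ⟨Tx, hTx, hTxc⟩ := hTfin 0 c hcI fun l => ⟨hcfin l, hccard l⟩
  choose d hdI hdE hdfin hdcard using fun l => hlev 1 l (E 1 ∪ (fun t => z t 1) '' Tx)
    ((hEc 1).union (Tx.countable_toSet.image _))
  simp only [hdelta] at hdcard
  obtain ⟨Ty, hTy, hTyc⟩ := hTfin 1 d hdI fun l => ⟨hdfin l, hdcard l⟩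
  have hcm := grid_strictMono hcI
  have hdm := grid_strictMono hdI
  have hclt : ∀ l, c l < c (l + 1) := fun l => hcm (by omega)
  have hdlt : ∀ l, d l < d (l + 1) := fun l => hdm (by omega)
  have hcw : ∀ l, c (l + 1) - c l ≤ 2 * δ := fun l => by
    have h1 := (hcI l).1
    have h2 := (hcI (l + 1)).2
    push_cast at h2
    linarith
  have hdw : ∀ l, d (l + 1) - d l ≤ 2 * δ := fun l => by
    have h1 := (hdI l).1
    have h2 := (hdI (l + 1)).2
    push_cast at h2
    linarith
  set T : Finset ℝ := Tx ∪ Ty with hT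
  have hTmem : ∀ t ∈ T, t ∈ Ioo (0 : ℝ) 1 := by
    intro t ht
    have hI : t ∈ Icc (0 : ℝ) 1 := by
      rcases Finset.mem_union.1 ht with h | h
      · exact ((hTx t).1 h).1
      · exact ((hTy t).1 h).1
    have key : ∀ e, e = 0 ∨ e = 1 → t ≠ e := by
      intro e he hte
      subst hte
      rcases Finset.mem_union.1 ht with h | h
      · obtain ⟨l, hl⟩ := ((hTx t).1 h).2
        apply hcE l
        rw [← hl]
        rcases he with rfl | rfl <;> simp [hE]
      · obtain ⟨l, hl⟩ := ((hTy t).1 h).2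
        apply hdE l
        rw [← hl]
        rcases he with rfl | rfl <;> simp [hE]
    exact ⟨hI.1.lt_of_ne' (key 0 (Or.inl rfl)), hI.2.lt_of_ne (key 1 (Or.inr rfl))⟩
  have hcellE : ∀ a b, 0 ≤ a → a < b → b ≤ 1 → (∀ t ∈ Ioo a b, t ∉ T) → ∃ l k : ℤ,
      ∀ t ∈ Icc a b, z t 0 ∈ Icc (c l) (c (l + 1)) ∧ z t 1 ∈ Icc (d k) (d (k + 1)) := by
    intro a b ha hab hb hT'
    have hsub : Icc a b ⊆ Icc 0 1 := Icc_subset_Icc ha hb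
    obtain ⟨l, hl⟩ := exists_grid_gap hδ hcI hab ((hzi 0).mono hsub) fun t ht l h =>
      hT' t ht (Finset.mem_union_left _ ((hTx t).2 ⟨hsub (Ioo_subset_Icc_self ht), l, h⟩))
    obtain ⟨k, hk⟩ := exists_grid_gap hδ hdI hab ((hzi 1).mono hsub) fun t ht l h =>
      hT' t ht (Finset.mem_union_right _ ((hTy t).2 ⟨hsub (Ioo_subset_Icc_self ht), l, h⟩))
    exact ⟨l, k, fun t ht => ⟨hl t ht, hk t ht⟩⟩
  have hdist : ∀ a b, 0 ≤ a → a < b → b ≤ 1 → (∀ t ∈ Ioo a b, t ∉ T) →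
      ∀ s ∈ Icc a b, ∀ t ∈ Icc a b, dist (z s) (z t) ≤ 3 * δ := by
    intro a b ha hab hb hT' s hs t ht
    obtain ⟨l, k, hlk⟩ := hcellE a b ha hab hb hT'
    exact dist_le_of_mem_rect hδ (hlk s hs).1 (hlk s hs).2 (hlk t ht).1 (hlk t ht).2
      (hcw l) (hdw k)
  -- With no crossing the arc lies in one rectangle; with a single crossing (J = 0 below) it is
  -- within 3δ of the crossing point. Both give the first alternative.
  rcases Nat.eq_zero_or_pos T.card with h0 | hpos
  · left
    intro s hs t ht
    rw [Finset.card_eq_zero] at h0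
    have := hdist 0 1 le_rfl zero_lt_one le_rfl (fun t _ => by rw [h0]; simp) s hs t ht
    linarith
  obtain ⟨τ, hτ, hτT, hτs⟩ := exists_enumeration T (J := T.card - 1) (by omega)
  set J := T.card - 1 with hJ
  have hτmono : ∀ i j, i ≤ j → j ≤ J → τ i ≤ τ j := by
    intro i j hij
    induction j, hij using Nat.le_induction with
    | base => intro; exact le_rfl
    | succ j _ ih => intro h; exact (ih (by omega)).trans (hτ j (by omega)).le
  have hno : ∀ j < J, ∀ t ∈ Ioo (τ j) (τ (j + 1)), t ∉ T := by
    intro j hj t ht htT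
    obtain ⟨i, hi, rfl⟩ := hτs t htT
    rcases Nat.lt_or_ge j i with h | h
    · exact absurd (hτmono (j + 1) i h hi) (not_le.2 ht.2)
    · exact absurd (hτmono i j h hj.le) (not_le.2 ht.1)
  have hno0 : ∀ t ∈ Ioo 0 (τ 0), t ∉ T := by
    intro t ht htT
    obtain ⟨i, hi, rfl⟩ := hτs t htT
    exact absurd (hτmono 0 i (Nat.zero_le _) hi) (not_le.2 ht.2)
  have hno1 : ∀ t ∈ Ioo (τ J) 1, t ∉ T := by
    intro t ht htT
    obtain ⟨i, hi, rfl⟩ := hτs t htT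
    exact absurd (hτmono i J hi le_rfl) (not_le.2 ht.1)
  have hτI : ∀ j ≤ J, τ j ∈ Ioo (0 : ℝ) 1 := fun j hj => hTmem _ (hτT j hj)
  have hd0 := hdist 0 (τ 0) le_rfl (hτI 0 (Nat.zero_le _)).1 (hτI 0 (Nat.zero_le _)).2.le hno0
  have hd1 := hdist (τ J) 1 (hτI J le_rfl).1.le (hτI J le_rfl).2 le_rfl hno1
  have hd0' : ∀ t ∈ Icc 0 (τ 0), dist (z t) (z (τ 0)) ≤ 3 * δ := fun t ht =>
    hd0 t ht _ ⟨(hτI 0 (Nat.zero_le _)).1.le, le_rfl⟩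
  have hd1' : ∀ t ∈ Icc (τ J) 1, dist (z t) (z (τ J)) ≤ 3 * δ := fun t ht =>
    hd1 t ht _ ⟨le_rfl, (hτI J le_rfl).2.le⟩
  rcases Nat.eq_zero_or_pos J with hJ0 | hJ1
  · left
    rw [hJ0] at hd1'
    have key : ∀ t ∈ Icc (0 : ℝ) 1, dist (z t) (z (τ 0)) ≤ 3 * δ := by
      intro t ht
      rcases le_total t (τ 0) with h | h
      · exact hd0' t ⟨ht.1, h⟩
      · exact hd1' t ⟨h, ht.2⟩
    intro s hs t ht
    have h1 := key s hs
    have h2 := key t ht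
    have h3 := dist_triangle_right (z s) (z t) (z (τ 0))
    linarith
  right
  refine ⟨J, hJ1, ?_, ?_⟩
  · have h1 : (T.card : ℝ) ≤ 2 * (B.card * (L / δ)) := by
      have h2 : (T.card : ℝ) ≤ Tx.card + Ty.card := by exact_mod_cast Finset.card_union_le _ _
      linarith
    have h2 : T.card ≤ ⌈2 * (B.card * (L / δ))⌉₊ := by
      exact_mod_cast h1.trans (Nat.le_ceil _)
    omega
  have hcellj : ∀ j, ∃ l k : ℤ, j < J → ∀ t ∈ Icc (τ j) (τ (j + 1)),
      z t 0 ∈ Icc (c l) (c (l + 1)) ∧ z t 1 ∈ Icc (d k) (d (k + 1)) := by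
    intro j
    by_cases hj : j < J
    · obtain ⟨l, k, h⟩ := hcellE (τ j) (τ (j + 1)) (hτI j hj.le).1.le (hτ j hj)
        (hτI (j + 1) hj).2.le (hno j hj)
      exact ⟨l, k, fun _ => h⟩
    · exact ⟨0, 0, fun h => absurd h hj⟩
  choose l k hlk using hcellj
  -- If two consecutive passages stayed in the same strip, the coordinate on a grid level at the
  -- crossing between them would have a local extremum there, and such levels were excluded.
  have hextr : ∀ (i : Fin 2) (e : ℤ → ℝ), StrictMono e → (∀ m, e m ∉ E i) → ∀ j, j + 1 < J →
      ∀ m n : ℤ, z (τ (j + 1)) i = e n →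
      (∀ t ∈ Icc (τ j) (τ (j + 1 + 1)), z t i ∈ Icc (e m) (e (m + 1))) → False := by
    intro i e he heE j hj m n hn hmem
    have hnb : Icc (τ j) (τ (j + 1 + 1)) ∈ 𝓝 (τ (j + 1)) :=
      Icc_mem_nhds (hτ j (by omega)) (hτ (j + 1) hj)
    have h1 := hmem (τ (j + 1)) (mem_of_mem_nhds hnb)
    rw [hn] at h1
    have h2 : n = m ∨ n = m + 1 := by
      have := he.le_iff_le.1 h1.1
      have := he.le_iff_le.1 h1.2
      omega
    apply heE n
    refine Or.inl ⟨τ (j + 1), ?_, hn⟩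
    rcases h2 with rfl | rfl
    · left
      filter_upwards [hnb] with t ht
      rw [hn]; exact (hmem t ht).1
    · right
      filter_upwards [hnb] with t ht
      rw [hn]; exact (hmem t ht).2
  have hline : ∀ j ≤ J, (∃ n, z (τ j) 0 = c n) ∨ ∃ n, z (τ j) 1 = d n := by
    intro j hj
    rcases Finset.mem_union.1 (hτT j hj) with h | h
    · exact Or.inl ((hTx _).1 h).2
    · exact Or.inr ((hTy _).1 h).2
  have hbetween : ∀ (e : ℤ → ℝ), StrictMono e → ∀ m n, e n ∉ Ioo (e m) (e (m + 1)) := by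
    intro e he m n h
    have := he.lt_iff_lt.1 h.1
    have := he.lt_iff_lt.1 h.2
    omega
  have hsame : ∀ (e : ℤ → ℝ), StrictMono e → ∀ m n x, x ∈ Ioo (e m) (e (m + 1)) →
      x ∈ Ioo (e n) (e (n + 1)) → m = n := by
    intro e he m n x h h'
    have := he.lt_iff_lt.1 (h.1.trans h'.2)
    have := he.lt_iff_lt.1 (h'.1.trans h.2)
    omega
  obtain ⟨P, hP, hP1, hP2⟩ := exists_simplePolygon hz hinj hτ
    (fun j hj => Ioo_subset_Icc_self (hτI j hj))
    (fun j => rectMap (c (l j)) (c (l j + 1)) (d (k j)) (d (k j + 1)) (hclt _) (hdlt _))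
    (fun j hj t ht => supN_rectMap_le _ _ (hlk j hj t ht).1 (hlk j hj t ht).2)
    (by
      intro j hj i hi
      by_contra hcon
      obtain ⟨h0, h1⟩ := supN_rectMap_lt _ _ (not_le.1 hcon)
      rcases hline i hi with ⟨n, hn⟩ | ⟨n, hn⟩
      · rw [hn] at h0
        exact hbetween c hcm _ _ h0
      · rw [hn] at h1
        exact hbetween d hdm _ _ h1)
    (by
      intro i hi j hj hij
      -- Two passages have the same cell, hence the same affine map, or their open cells are
      -- disjoint.
      by_cases heq : l i = l j ∧ k i = k j
      · left
        refine ⟨by simp only [heq.1, heq.2], ?_⟩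
        rintro rfl
        have hmem : ∀ t ∈ Icc (τ i) (τ (i + 1 + 1)),
            z t 0 ∈ Icc (c (l i)) (c (l i + 1)) ∧ z t 1 ∈ Icc (d (k i)) (d (k i + 1)) := by
          intro t ht
          rcases le_total t (τ (i + 1)) with h | h
          · exact hlk i hi t ⟨ht.1, h⟩
          · rw [heq.1, heq.2]; exact hlk (i + 1) hj t ⟨h, ht.2⟩
        rcases hline (i + 1) hj.le with ⟨n, hn⟩ | ⟨n, hn⟩
        · exact hextr 0 c hcm hcE i hj _ n hn fun t ht => (hmem t ht).1
        · exact hextr 1 d hdm (fun m h => hdE m (Or.inl h)) i hj _ n hn fun t ht => (hmem t ht).2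
      · right
        intro x hx hx'
        obtain ⟨h0, h1⟩ := supN_rectMap_lt _ _ hx
        obtain ⟨h0', h1'⟩ := supN_rectMap_lt _ _ hx'
        exact heq ⟨hsame c hcm _ _ _ h0 h0', hsame d hdm _ _ _ h1 h1'⟩) hν
  exact ⟨τ, P, hτ, fun j hj => Ioo_subset_Icc_self (hτI j hj), hP, hP1, hP2,
    fun j hj => hdist (τ j) (τ (j + 1)) (hτI j hj.le).1.le (hτ j hj) (hτI (j + 1) hj).2.le
      (hno j hj), hd0', hd1'⟩

/-! ### Piecewise affine maps and their energy -/

/-- `u` is affine on `[a,b]` with slope `B`. -/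
def AffOn (u : ℝ → Plane) (a b : ℝ) (B : Plane) : Prop :=
  ∀ x ∈ Icc a b, u x = u a + (x - a) • B

/-- `u` is continuous and piecewise affine on `[a,b]`. -/
inductive PAff (u : ℝ → Plane) : ℝ → ℝ → Prop
  | seg {a b : ℝ} (B : Plane) : a < b → AffOn u a b B → PAff u a b
  | trans {a b c : ℝ} : PAff u a b → PAff u b c → PAff u a c

theorem AffOn.sub {u : ℝ → Plane} {a b : ℝ} {B : Plane} (h : AffOn u a b B) {a' b' : ℝ}
    (ha : a ≤ a') (hb : b' ≤ b) : AffOn u a' b' B := by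
  intro x hx
  rw [h x ⟨ha.trans hx.1, hx.2.trans hb⟩, h a' ⟨ha, (hx.1.trans hx.2).trans hb⟩]
  module

theorem AffOn.congr {u v : ℝ → Plane} {a b : ℝ} {B : Plane} (h : AffOn u a b B)
    (huv : EqOn v u (Icc a b)) : AffOn v a b B := by
  intro x hx
  rw [huv hx, huv ⟨le_rfl, hx.1.trans hx.2⟩, h x hx]

theorem AffOn.deriv {u : ℝ → Plane} {a b : ℝ} {B : Plane} (h : AffOn u a b B) {x : ℝ}
    (hx : x ∈ Ioo a b) : deriv u x = B := by
  have h1 : HasDerivAt (fun x : ℝ => u a + (x - a) • B) B x := by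
    simpa using (((hasDerivAt_id x).sub_const a).smul_const B).const_add (u a)
  apply HasDerivAt.deriv
  apply h1.congr_of_eventuallyEq
  filter_upwards [Ioo_mem_nhds hx.1 hx.2] with y hy using h y (Ioo_subset_Icc_self hy)

namespace PAff
variable {u v : ℝ → Plane} {a b c : ℝ}

theorem lt (h : PAff u a b) : a < b := by
  induction h with
  | seg B h _ => exact h
  | trans _ _ h1 h2 => exact h1.trans h2

theorem continuousOn (h : PAff u a b) : ContinuousOn u (Icc a b) := by
  induction h with
  | @seg a b B h hB =>
    have : ContinuousOn (fun x : ℝ => u a + (x - a) • B) (Icc a b) := by fun_prop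
    exact this.congr hB
  | trans h1 h2 i1 i2 =>
    rw [← Icc_union_Icc_eq_Icc h1.lt.le h2.lt.le]
    exact i1.union_of_isClosed i2 isClosed_Icc isClosed_Icc

theorem congr (h : PAff u a b) (huv : EqOn v u (Icc a b)) : PAff v a b := by
  induction h with
  | seg B h hB => exact .seg B h (hB.congr huv)
  | trans h1 h2 i1 i2 =>
    exact .trans (i1 (huv.mono (Icc_subset_Icc le_rfl h2.lt.le)))
      (i2 (huv.mono (Icc_subset_Icc h1.lt.le le_rfl)))

theorem sub (h : PAff u a b) : ∀ {a' b' : ℝ}, a ≤ a' → a' < b' → b' ≤ b → PAff u a' b' := by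
  induction h with
  | seg B h hB => exact fun ha hab hb => .seg B hab (hB.sub ha hb)
  | @trans a m b h1 h2 i1 i2 =>
    intro a' b' ha hab hb
    rcases le_or_gt b' m with h | h
    · exact i1 ha hab h
    rcases le_or_gt m a' with h' | h'
    · exact i2 h' hab hb
    · exact .trans (i1 ha h' le_rfl) (i2 le_rfl h hb)

end PAff

/-- The energy of `u` on `(a,b]`. -/
def energyOn (f : Plane → ℝ≥0∞) (u : ℝ → Plane) (a b : ℝ) : ℝ≥0∞ :=
  ∫⁻ x in Ioc a b, f (deriv u x)

theorem energyOn_eq_Ioo (f : Plane → ℝ≥0∞) (u : ℝ → Plane) (a b : ℝ) :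
    energyOn f u a b = ∫⁻ x in Ioo a b, f (deriv u x) :=
  setLIntegral_congr Ioo_ae_eq_Ioc.symm

theorem energyOn_add (f : Plane → ℝ≥0∞) (u : ℝ → Plane) {a b c : ℝ} (hab : a ≤ b) (hbc : b ≤ c) :
    energyOn f u a c = energyOn f u a b + energyOn f u b c := by
  rw [energyOn, ← Ioc_union_Ioc_eq_Ioc hab hbc]
  exact lintegral_union measurableSet_Ioc (Ioc_disjoint_Ioc_of_le le_rfl)

theorem energyOn_congr (f : Plane → ℝ≥0∞) {u v : ℝ → Plane} {a b : ℝ} (h : EqOn u v (Icc a b)) :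
    energyOn f u a b = energyOn f v a b := by
  rw [energyOn_eq_Ioo, energyOn_eq_Ioo]
  apply setLIntegral_congr_fun measurableSet_Ioo
  intro x hx
  have : deriv u x = deriv v x := by
    apply Filter.EventuallyEq.deriv_eq
    filter_upwards [Ioo_mem_nhds hx.1 hx.2] with y hy using h (Ioo_subset_Icc_self hy)
  simp only [this]

theorem energyOn_of_affOn (f : Plane → ℝ≥0∞) {u : ℝ → Plane} {a b : ℝ} {B : Plane}
    (h : AffOn u a b B) : energyOn f u a b = f B * ENNReal.ofReal (b - a) := by
  rw [energyOn_eq_Ioo, setLIntegral_congr_fun (g := fun _ => f B) measurableSet_Ioo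
    (fun x hx => by simp only [h.deriv hx])]
  rw [setLIntegral_const, Real.volume_Ioo]

/-! ### Relaxation on affine pieces by zigzags -/

/-- The piece on `[a,b]` of an injective piecewise affine function that agrees with `u` there can
be modified, by arbitrarily little, so that its energy is at most about `e`. -/
def Improvable (f : Plane → ℝ≥0∞) (u : ℝ → Plane) (a b e : ℝ) : Prop :=
  ∀ v, PAff v 0 1 → InjOn v (Icc 0 1) → EqOn v u (Icc a b) → ∀ ε > 0, ∃ w, PAff w 0 1 ∧
    InjOn w (Icc 0 1) ∧ (∀ x ∉ Ioo a b, w x = v x) ∧ (∀ x, dist (w x) (v x) ≤ ε) ∧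
    energyOn f w a b ≤ ENNReal.ofReal (e + ε)

namespace Improvable
variable {f : Plane → ℝ≥0∞} {u : ℝ → Plane} {a b c e e₁ e₂ : ℝ}

theorem mono (h : Improvable f u a b e₁) (he : e₁ ≤ e₂) : Improvable f u a b e₂ := by
  intro v hv hvi hvu ε hε
  obtain ⟨w, h1, h2, h3, h4, h5⟩ := h v hv hvi hvu ε hε
  exact ⟨w, h1, h2, h3, h4, h5.trans (ENNReal.ofReal_le_ofReal (by linarith))⟩

/-- Modifying the first piece leaves the map unchanged on the second, so the second improvement
applies to the already modified map. This is why `Improvable` quantifies over all injective v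
agreeing with u on the interval. -/
theorem trans (h₁ : Improvable f u a b e₁) (h₂ : Improvable f u b c e₂) (hab : a ≤ b)
    (hbc : b ≤ c) (he₁ : 0 ≤ e₁) (he₂ : 0 ≤ e₂) : Improvable f u a c (e₁ + e₂) := by
  intro v hv hvi hvu ε hε
  obtain ⟨w, h1, h2, h3, h4, h5⟩ :=
    h₁ v hv hvi (hvu.mono (Icc_subset_Icc le_rfl hbc)) (ε / 2) (half_pos hε)
  obtain ⟨w', k1, k2, k3, k4, k5⟩ := h₂ w h1 h2 (fun x hx => by
    rw [h3 x fun h => absurd hx.1 (not_le.2 h.2), hvu ⟨hab.trans hx.1, hx.2⟩]) (ε / 2) (half_pos hε)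
  refine ⟨w', k1, k2, ?_, ?_, ?_⟩
  · intro x hx
    rw [k3 x fun h => hx ⟨hab.trans_lt h.1, h.2⟩, h3 x fun h => hx ⟨h.1, h.2.trans_le hbc⟩]
  · intro x
    have := dist_triangle (w' x) (w x) (v x)
    linarith [h4 x, k4 x]
  · rw [energyOn_add f w' hab hbc, energyOn_congr f (v := w) fun x hx =>
      k3 x fun h => absurd hx.2 (not_le.2 h.1)]
    refine (add_le_add h5 k5).trans ?_
    rw [← ENNReal.ofReal_add (by linarith) (by linarith)]
    exact ENNReal.ofReal_le_ofReal (by linarith)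

/-- A modification need not reach the desired energy at once: it may produce a map that is itself
improvable. Iterated zigzags are built in this way. -/
theorem of_step (h : ∀ v, PAff v 0 1 → InjOn v (Icc 0 1) → EqOn v u (Icc a b) → ∀ ε > 0,
    ∃ w, PAff w 0 1 ∧ InjOn w (Icc 0 1) ∧ (∀ x ∉ Ioo a b, w x = v x) ∧
      (∀ x, dist (w x) (v x) ≤ ε) ∧ Improvable f w a b (e + ε)) : Improvable f u a b e := by
  intro v hv hvi hvu ε hε
  obtain ⟨w, h1, h2, h3, h4, h5⟩ := h v hv hvi hvu (ε / 2) (half_pos hε)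
  obtain ⟨w', k1, k2, k3, k4, k5⟩ := h5 w h1 h2 (fun x _ => rfl) (ε / 2) (half_pos hε)
  refine ⟨w', k1, k2, fun x hx => (k3 x hx).trans (h3 x hx), fun x => ?_, ?_⟩
  · have := dist_triangle (w' x) (w x) (v x)
    linarith [h4 x, k4 x]
  · rwa [add_assoc, add_halves] at k5

end Improvable

/-- Affine pieces of slope `B` can be replaced by pieces of energy density at most about `c`. -/
def Attains (f : Plane → ℝ≥0∞) (B : Plane) (c : ℝ) : Prop :=
  ∀ (u : ℝ → Plane) (a b : ℝ), 0 ≤ a → a < b → b ≤ 1 → AffOn u a b B →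
    Improvable f u a b (c * (b - a))

namespace Attains
variable {f : Plane → ℝ≥0∞} {B : Plane} {c c' : ℝ}

theorem of_le (hc : 0 ≤ c) (h : f B ≤ ENNReal.ofReal c) : Attains f B c := by
  intro u a b _ hab _ hu v hv hvi hvu ε hε
  refine ⟨v, hv, hvi, fun _ _ => rfl, fun x => by simpa using hε.le, ?_⟩
  rw [energyOn_of_affOn f (hu.congr hvu)]
  calc f B * ENNReal.ofReal (b - a) ≤ ENNReal.ofReal c * ENNReal.ofReal (b - a) := by gcongr
    _ = ENNReal.ofReal (c * (b - a)) := (ENNReal.ofReal_mul hc).symm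
    _ ≤ _ := ENNReal.ofReal_le_ofReal (by linarith)

theorem mono (h : Attains f B c) (hc : c ≤ c') : Attains f B c' := fun u a b h0 hab h1 hu =>
  (h u a b h0 hab h1 hu).mono (mul_le_mul_of_nonneg_right hc (sub_nonneg.2 hab.le))

theorem of_forall_add (h : ∀ η > 0, Attains f B (c + η)) : Attains f B c := by
  intro u a b h0 hab h1 hu v hv hvi hvu ε hε
  obtain ⟨w, h1, h2, h3, h4, h5⟩ := h (ε / 2) (half_pos hε) u a b h0 hab h1 hu v hv hvi hvu (ε / 2)
    (half_pos hε)
  refine ⟨w, h1, h2, h3, fun x => (h4 x).trans (by linarith), h5.trans ?_⟩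
  apply ENNReal.ofReal_le_ofReal
  nlinarith

end Attains

/-- The profile of a zigzag with slopes `1 - θ` and `-θ`. -/
def tri (θ r : ℝ) : ℝ := min ((1 - θ) * r) (θ * (1 - r))

theorem tri_of_le {θ r : ℝ} (h : r ≤ θ) : tri θ r = (1 - θ) * r := by
  apply min_eq_left; linarith

theorem tri_of_ge {θ r : ℝ} (h : θ ≤ r) : tri θ r = θ * (1 - r) := by
  apply min_eq_right; linarith

theorem tri_fract {θ : ℝ} (hθ : θ ∈ Ioo (0 : ℝ) 1) (i : ℕ) {r : ℝ} (hr : r ∈ Icc (0 : ℝ) 1) :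
    tri θ (Int.fract (i + r)) = tri θ r := by
  rw [Int.fract_natCast_add]
  rcases hr.2.lt_or_eq with h | h
  · rw [Int.fract_eq_self.2 ⟨hr.1, h⟩]
  · rw [h, Int.fract_one, tri_of_le hθ.1.le, tri_of_ge hθ.2.le]; simp

theorem tri_fract_mem {θ : ℝ} (hθ : θ ∈ Ioo (0 : ℝ) 1) (x : ℝ) :
    tri θ (Int.fract x) ∈ Icc (0 : ℝ) 1 := by
  have h0 := Int.fract_nonneg x
  have h1 := (Int.fract_lt_one x).le
  refine ⟨le_min (mul_nonneg (by linarith [hθ.2]) h0) (mul_nonneg hθ.1.le (by linarith)), ?_⟩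
  exact (min_le_left _ _).trans (by nlinarith [hθ.1, hθ.2])

theorem cross_add_smul (u v : Plane) (s t : ℝ) (w : Plane) :
    cross (s • u + t • v) w = s * cross u w + t * cross v w := by
  simp [cross]; ring

set_option maxHeartbeats 1000000 in
/-- Two independent slopes can be combined by a fine zigzag. -/
theorem Attains.combo {f : Plane → ℝ≥0∞} {a₁ a₂ : Plane} {c₁ c₂ θ : ℝ}
    (hθ : θ ∈ Ioo (0 : ℝ) 1) (hind : cross a₁ a₂ ≠ 0) (h₁ : Attains f a₁ c₁)
    (h₂ : Attains f a₂ c₂) (hc₁ : 0 ≤ c₁) (hc₂ : 0 ≤ c₂)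
    (hfB : f (θ • a₁ + (1 - θ) • a₂) ≠ ∞) :
    Attains f (θ • a₁ + (1 - θ) • a₂) (θ * c₁ + (1 - θ) * c₂) := by
  set B := θ • a₁ + (1 - θ) • a₂ with hB
  set c := θ * c₁ + (1 - θ) * c₂ with hc
  have hθ1 : 0 < 1 - θ := by linarith [hθ.2]
  have hc0 : 0 ≤ c := add_nonneg (mul_nonneg hθ.1.le hc₁) (mul_nonneg hθ1.le hc₂)
  set V := a₁ - a₂ with hV
  -- The zigzag moves in direction V, transversal to the slope B; this gives injectivity below.
  have hBV : cross B V ≠ 0 := by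
    have : cross B V = -cross a₁ a₂ := by
      rw [hB, hV, cross_add_smul]
      simp [cross]; ring
    rw [this]; exact neg_ne_zero.2 hind
  have ha₁ : B + (1 - θ) • V = a₁ := by rw [hB, hV]; module
  have ha₂ : B - θ • V = a₂ := by rw [hB, hV]; module
  intro u a b h0 hab h1 hu
  apply Improvable.of_step
  intro v hv hvi hvu ε hε
  replace hu := hu.congr hvu
  clear hvu
  set F := (f B).toReal with hF
  have hF0 : 0 ≤ F := ENNReal.toReal_nonneg
  -- Margins of length ρ at both ends keep slope B. They separate the zigzag from the rest of the
  -- curve and cost F ρ each.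
  obtain ⟨ρ, hρ, hρab, hρF⟩ : ∃ ρ > 0, ρ < (b - a) / 2 ∧ 2 * (F * ρ) ≤ ε := by
    refine ⟨min ((b - a) / 4) (ε / (2 * (F + 1))), lt_min (by linarith) (by positivity), ?_, ?_⟩
    · exact (min_le_left _ _).trans_lt (by linarith)
    · have h1 : min ((b - a) / 4) (ε / (2 * (F + 1))) ≤ ε / (2 * (F + 1)) := min_le_right _ _
      have h2 : 0 < min ((b - a) / 4) (ε / (2 * (F + 1))) := lt_min (by linarith) (by positivity)
      rw [le_div_iff₀ (by positivity)] at h1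
      nlinarith
  set a' := a + ρ with ha'
  set b' := b - ρ with hb'
  have hab' : a' < b' := by linarith
  have hsub' : Icc a' b' ⊆ Icc 0 1 := Icc_subset_Icc (by linarith) (by linarith)
  obtain ⟨d, hd, hdist⟩ : ∃ d > 0, ∀ x ∈ Icc a' b', ∀ y ∈ Icc (0 : ℝ) 1, y ∉ Icc a b →
      d < dist (v x) (v y) := by
    have hK : IsCompact (v '' Icc a' b') :=
      isCompact_Icc.image_of_continuousOn (hv.continuousOn.mono hsub')
    have hZs : Icc (0 : ℝ) a ∪ Icc b 1 ⊆ Icc 0 1 := union_subset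
      (Icc_subset_Icc le_rfl (by linarith)) (Icc_subset_Icc (by linarith) le_rfl)
    have hZ : IsCompact (v '' (Icc 0 a ∪ Icc b 1)) :=
      (isCompact_Icc.union isCompact_Icc).image_of_continuousOn (hv.continuousOn.mono hZs)
    have hdis : Disjoint (v '' Icc a' b') (v '' (Icc 0 a ∪ Icc b 1)) := by
      rw [Set.disjoint_left]
      rintro _ ⟨x, hx, rfl⟩ ⟨y, hy, hxy⟩
      have := hvi (hZs hy) (hsub' hx) hxy
      subst this
      rcases hy with hy | hy
      · linarith [hy.2, hx.1]
      · linarith [hy.1, hx.2]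
    obtain ⟨r, hr, hrd⟩ := hdis.exists_thickenings hK hZ.isClosed
    refine ⟨r, hr, fun x hx y hy hyab => ?_⟩
    by_contra hcon
    have hyZ : y ∈ Icc (0 : ℝ) a ∪ Icc b 1 := by
      rcases le_or_gt y a with h | h
      · exact Or.inl ⟨hy.1, h⟩
      · rcases le_or_gt b y with h' | h'
        · exact Or.inr ⟨h', hy.2⟩
        · exact absurd ⟨h.le, h'.le⟩ hyab
    -- If the distance were at most r, the midpoint would lie in both of the disjoint r-thickenings.
    have hhalf : 1 / 2 * dist (v x) (v y) < r := by linarith [not_lt.1 hcon]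
    exact Set.disjoint_left.1 hrd
      (show midpoint ℝ (v x) (v y) ∈ Metric.thickening r (v '' Icc a' b') from
        Metric.mem_thickening_iff.2 ⟨v x, mem_image_of_mem v hx, by
          rw [dist_midpoint_left]; simpa using hhalf⟩)
      (Metric.mem_thickening_iff.2 ⟨v y, mem_image_of_mem v hyZ, by
          rw [dist_midpoint_right]; simpa using hhalf⟩)
  -- The n teeth are so fine that their amplitude h‖V‖ is below both the gap d and the tolerance ε.
  obtain ⟨n, hn⟩ := exists_nat_gt ((b' - a') * (‖V‖ + 1) / min d ε)
  have hmin : 0 < min d ε := lt_min hd hε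
  have hn0 : (0 : ℝ) < n := lt_of_le_of_lt
    (div_nonneg (mul_nonneg (by linarith) (by positivity)) hmin.le) hn
  set h := (b' - a') / n with hh
  have hhpos : 0 < h := div_pos (by linarith) hn0
  have hnh : n * h = b' - a' := by rw [hh]; field_simp
  have hhV : h * ‖V‖ < min d ε := by
    rw [div_lt_iff₀ hmin] at hn
    rw [hh, div_mul_eq_mul_div, div_lt_iff₀ hn0]
    nlinarith [norm_nonneg V]
  set ζ : ℝ → ℝ := fun x =>
    if x ∈ Icc a' b' then h * tri θ (Int.fract ((x - a') / h)) else 0 with hζ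
  have hζ_val : ∀ i : ℕ, i < n → ∀ r ∈ Icc (0 : ℝ) 1, ζ (a' + (i + r) * h) = h * tri θ r := by
    intro i hi r hr
    have hi' : ((i : ℝ) + 1) ≤ n := by exact_mod_cast hi
    have hmem : a' + (i + r) * h ∈ Icc a' b' := by
      constructor
      · have : 0 ≤ (i + r) * h := mul_nonneg (add_nonneg (by positivity) hr.1) hhpos.le
        linarith
      · have : (i + r) * h ≤ n * h := mul_le_mul_of_nonneg_right (by linarith [hr.2]) hhpos.le
        linarith
    simp only [hζ, if_pos hmem]
    rw [add_sub_cancel_left, mul_div_assoc, div_self hhpos.ne', mul_one, tri_fract hθ i hr]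
  have hζ_mem : ∀ x, ζ x ∈ Icc 0 h := by
    intro x
    simp only [hζ]
    split_ifs
    · have := tri_fract_mem hθ ((x - a') / h)
      exact ⟨mul_nonneg hhpos.le this.1, mul_le_of_le_one_right hhpos.le this.2⟩
    · exact ⟨le_rfl, hhpos.le⟩
  have hnpos : 0 < n := by exact_mod_cast hn0
  have hζa : ζ a' = 0 := by
    have := hζ_val 0 hnpos 0 (by simp)
    simpa [tri_of_le hθ.1.le] using this
  have hζb : ζ b' = 0 := by
    have := hζ_val (n - 1) (by omega) 1 (by simp)
    rw [Nat.cast_sub (by omega), Nat.cast_one, sub_add_cancel, hnh, add_sub_cancel] at this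
    rw [this, tri_of_ge hθ.2.le]; simp
  have hζ0 : ∀ x, x ∉ Ioo a' b' → ζ x = 0 := by
    intro x hx
    by_cases hx' : x ∈ Icc a' b'
    · rcases hx'.1.lt_or_eq with h | h
      · rcases hx'.2.lt_or_eq with h' | h'
        · exact absurd ⟨h, h'⟩ hx
        · rw [h', hζb]
      · rw [← h, hζa]
    · simp only [hζ, if_neg hx']
  set w : ℝ → Plane := fun x => v x + ζ x • V with hw
  have hwv : ∀ x, x ∉ Ioo a' b' → w x = v x := fun x hx => by simp [hw, hζ0 x hx]
  have hwd : ∀ x, dist (w x) (v x) ≤ h * ‖V‖ := by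
    intro x
    simp only [hw, dist_self_add_left, norm_smul, Real.norm_eq_abs, abs_of_nonneg (hζ_mem x).1]
    exact mul_le_mul_of_nonneg_right (hζ_mem x).2 (norm_nonneg _)
  have hwab : ∀ x ∈ Icc a b, w x = v a + (x - a) • B + ζ x • V := fun x hx => by
    simp only [hw]; rw [hu x hx]
  have hnode : ∀ i : ℕ, i < n → ∀ r ∈ Icc (0 : ℝ) 1, a' + (i + r) * h ∈ Icc a b := by
    intro i hi r hr
    have hi' : ((i : ℝ) + 1) ≤ n := by exact_mod_cast hi
    have h1 : 0 ≤ (i + r) * h := mul_nonneg (add_nonneg (by positivity) hr.1) hhpos.le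
    have h2 : (i + r) * h ≤ n * h := mul_le_mul_of_nonneg_right (by linarith [hr.2]) hhpos.le
    constructor <;> linarith
  have hpiece : ∀ i : ℕ, i < n → ∀ r₀ r₁, 0 ≤ r₀ → r₀ ≤ r₁ → r₁ ≤ 1 → ∀ k : ℝ,
      (∀ r ∈ Icc r₀ r₁, tri θ r = tri θ r₀ + (r - r₀) * k) →
      AffOn w (a' + (i + r₀) * h) (a' + (i + r₁) * h) (B + k • V) := by
    intro i hi r₀ r₁ h0 h01 h1 k hk x hx
    obtain ⟨r, rfl⟩ : ∃ r, x = a' + (i + r) * h := ⟨(x - a') / h - i, by field_simp; ring⟩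
    have hr : r ∈ Icc r₀ r₁ := by
      constructor
      · by_contra hcon
        nlinarith [hx.1]
      · by_contra hcon
        nlinarith [hx.2]
    have hrI : r ∈ Icc (0 : ℝ) 1 := ⟨h0.trans hr.1, hr.2.trans h1⟩
    have hrI0 : r₀ ∈ Icc (0 : ℝ) 1 := ⟨h0, h01.trans h1⟩
    rw [hwab _ (hnode i hi r hrI), hwab _ (hnode i hi r₀ hrI0), hζ_val i hi r hrI,
      hζ_val i hi r₀ hrI0, hk r hr]
    module
  have hp1 : ∀ i : ℕ, i < n → AffOn w (a' + i * h) (a' + (i + θ) * h) a₁ := by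
    intro i hi
    have := hpiece i hi 0 θ le_rfl hθ.1.le hθ.2.le (1 - θ) (fun r hr => by
      rw [tri_of_le hr.2, tri_of_le hθ.1.le]; ring)
    rwa [add_zero, ha₁] at this
  have hp2 : ∀ i : ℕ, i < n → AffOn w (a' + (i + θ) * h) (a' + (i + 1 : ℕ) * h) a₂ := by
    intro i hi
    have := hpiece i hi θ 1 hθ.1.le hθ.2.le le_rfl (-θ) (fun r hr => by
      rw [tri_of_ge hr.1, tri_of_ge le_rfl]; ring)
    rw [neg_smul, ← sub_eq_add_neg, ha₂] at this
    simpa using this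
  have hlt1 : ∀ i : ℕ, a' + i * h < a' + (i + θ) * h := fun i => by nlinarith [hθ.1]
  have hlt2 : ∀ i : ℕ, a' + (i + θ) * h < a' + (i + 1 : ℕ) * h := fun i => by
    push_cast; nlinarith [hθ.2]
  have hmid : ∀ k : ℕ, k < n → PAff w a' (a' + (k + 1 : ℕ) * h) := by
    intro k
    induction k with
    | zero =>
      intro hk
      have e1 := PAff.seg a₁ (hlt1 0) (hp1 0 hk)
      have e2 := PAff.seg a₂ (hlt2 0) (hp2 0 hk)
      have := e1.trans e2
      simpa using this
    | succ k ih =>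
      intro hk
      exact (ih (by omega)).trans ((PAff.seg a₁ (hlt1 (k + 1)) (hp1 _ hk)).trans
        (PAff.seg a₂ (hlt2 (k + 1)) (hp2 _ hk)))
  have hend : a' + (n : ℝ) * h = b' := by linarith
  have hwP : PAff w 0 1 := by
    have e1 : PAff w 0 a' := (hv.sub le_rfl (by linarith) (by linarith)).congr
      fun x hx => hwv x fun hx' => absurd hx.2 (not_le.2 hx'.1)
    have e2 : PAff w a' b' := by
      have := hmid (n - 1) (by omega)
      rwa [Nat.sub_add_cancel hnpos, hend] at this
    have e3 : PAff w b' 1 := (hv.sub (by linarith) (by linarith) le_rfl).congr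
      fun x hx => hwv x fun hx' => absurd hx.1 (not_le.2 hx'.2)
    exact (e1.trans e2).trans e3
  have hwi : InjOn w (Icc 0 1) := by
    -- The determinant with V removes the zigzag term and leaves (x - y) times `cross B V`.
    have case1 : ∀ x ∈ Icc a b, ∀ y ∈ Icc a b, w x = w y → x = y := by
      intro x hx y hy hxy
      rw [hwab x hx, hwab y hy] at hxy
      have e : cross ((x - y) • B + (ζ x - ζ y) • V) V = 0 := by
        have : (x - y) • B + (ζ x - ζ y) • V = 0 := by
          have := sub_eq_zero.2 hxy
          rw [← this]; module
        rw [this]; simp [cross]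
      rw [cross_add_smul] at e
      have hVV : cross V V = 0 := by simp [cross]; ring
      rw [hVV, mul_zero, add_zero] at e
      rcases mul_eq_zero.1 e with h | h
      · linarith
      · exact absurd h hBV
    -- A zigzag point has moved by less than d, the distance from the central part to the curve
    -- outside [a,b].
    have case2 : ∀ x ∈ Icc a b, ∀ y ∈ Icc (0 : ℝ) 1, y ∉ Icc a b → w x = w y → x = y := by
      intro x hx y hy hyab hxy
      have hy' : y ∉ Ioo a' b' := fun h => hyab ⟨by linarith [h.1], by linarith [h.2]⟩
      rw [hwv y hy'] at hxy
      by_cases hx' : x ∈ Ioo a' b'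
      · have h1 := hdist x (Ioo_subset_Icc_self hx') y hy hyab
        have h2 := hwd x
        rw [hxy, dist_comm] at h2
        have := hhV.trans_le (min_le_left d ε)
        linarith
      · rw [hwv x hx'] at hxy
        exact hvi ⟨h0.trans hx.1, hx.2.trans h1⟩ hy hxy
    intro x hx y hy hxy
    by_cases hx' : x ∈ Icc a b
    · by_cases hy' : y ∈ Icc a b
      · exact case1 x hx' y hy' hxy
      · exact case2 x hx' y hy hy' hxy
    · by_cases hy' : y ∈ Icc a b
      · exact (case2 y hy' x hx hx' hxy.symm).symm
      · rw [hwv x fun h => hx' ⟨by linarith [h.1], by linarith [h.2]⟩,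
          hwv y fun h => hy' ⟨by linarith [h.1], by linarith [h.2]⟩] at hxy
        exact hvi hx hy hxy
  refine ⟨w, hwP, hwi, fun x hx => hwv x fun h => hx ⟨by linarith [h.1], by linarith [h.2]⟩,
    fun x => (hwd x).trans (hhV.le.trans (min_le_right _ _)), ?_⟩
  have hBF : Attains f B F := Attains.of_le hF0 (ENNReal.ofReal_toReal hfB).ge
  have i1 : Improvable f w a a' (F * ρ) := by
    have := hBF w a a' h0 (by linarith) (by linarith) ((hu.sub le_rfl (by linarith)).congr
      fun x hx => hwv x fun hx' => absurd hx.2 (not_le.2 hx'.1))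
    rwa [show a' - a = ρ by rw [ha']; ring] at this
  have i3 : Improvable f w b' b (F * ρ) := by
    have := hBF w b' b (by linarith) (by linarith) h1 ((hu.sub (by linarith) le_rfl).congr
      fun x hx => hwv x fun hx' => absurd hx.1 (not_le.2 hx'.2))
    rwa [show b - b' = ρ by rw [hb']; ring] at this
  have hch : 0 ≤ c * h := mul_nonneg hc0 hhpos.le
  -- A tooth spends the fraction θ of its length h with slope a₁ and the rest with slope a₂, so its
  -- energy is about c h.
  have itooth : ∀ i : ℕ, i < n → Improvable f w (a' + i * h) (a' + (i + 1 : ℕ) * h) (c * h) := by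
    intro i hi
    have hi' : ((i : ℝ) + 1) ≤ n := by exact_mod_cast hi
    have hlo : 0 ≤ (i : ℝ) * h := by positivity
    have hhi : ((i : ℝ) + 1) * h ≤ n * h := mul_le_mul_of_nonneg_right hi' hhpos.le
    have l1 := hlt1 i
    have l2 := hlt2 i
    have hhi' : ((i + 1 : ℕ) : ℝ) * h ≤ n * h := by push_cast; exact hhi
    have e1 := h₁ w _ _ (by linarith) l1 (by linarith) (hp1 i hi)
    have e2 := h₂ w _ _ (by linarith) l2 (by linarith) (hp2 i hi)
    have e3 := e1.trans e2 l1.le l2.le (mul_nonneg hc₁ (by linarith)) (mul_nonneg hc₂ (by linarith))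
    apply e3.mono (le_of_eq _)
    rw [hc]; push_cast; ring
  have i2 : ∀ k : ℕ, k ≤ n → k ≠ 0 → Improvable f w a' (a' + (k : ℝ) * h) (k * (c * h)) := by
    intro k
    induction k with
    | zero => intro _ h; exact absurd rfl h
    | succ k ih =>
      intro hk _
      rcases Nat.eq_zero_or_pos k with h0 | hkpos
      · subst h0
        have := itooth 0 hnpos
        simpa using this
      · have e1 := ih (by omega) (by omega)
        have e2 := itooth k (by omega)
        have := e1.trans e2 (by have : 0 ≤ (k : ℝ) * h := by positivity
                                linarith) (by linarith [hlt1 k, hlt2 k]) (by positivity) hch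
        apply this.mono (le_of_eq _)
        push_cast; ring
  have i2' := i2 n le_rfl (by omega)
  rw [hend] at i2'
  have i123 := (i1.trans i2' (by linarith) hab'.le (by positivity) (by positivity)).trans i3
    (by linarith) (by linarith) (by positivity) (by positivity)
  apply i123.mono
  have e4 : (n : ℝ) * (c * h) = c * (b' - a') := by rw [← hnh]; ring
  rw [e4]
  have e5 : c * (b' - a') ≤ c * (b - a) := mul_le_mul_of_nonneg_left (by linarith) hc0
  linarith

theorem cross_same (u : Plane) : cross u u = 0 := by simp [cross]; ring

theorem exists_cross_ne_zero {B : Plane} (hB : B ≠ 0) : ∃ W : Plane, cross W B ≠ 0 := by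
  by_contra hcon
  push Not at hcon
  apply hB
  have h0 := hcon !₂[0, 1]
  have h1 := hcon !₂[1, 0]
  ext i
  fin_cases i
  · simpa [cross] using h0
  · simpa [cross] using h1

/-- Induction on the number of slopes: split off a i, average the others to b, and zigzag between a
i and b, the pieces of slope b being improvable by induction. The slopes a i and b may be parallel,
or b may vanish. So a i is shifted by τW and the others by -τ (l i / μ) W, with W transversal to the
mean B; the mean is unchanged, and continuity of f away from 0 keeps the loss below η. -/
theorem Attains.of_sum {f : Plane → ℝ≥0∞} (hfin : ∀ a, a ≠ 0 → f a < ∞)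
    (hcont : ContinuousOn f {0}ᶜ) {ι : Type} (s : Finset ι) (hs : s.Nonempty) :
    ∀ (l : ι → ℝ) (a : ι → Plane) (c : ι → ℝ), (∀ i ∈ s, 0 < l i) → ∑ i ∈ s, l i = 1 →
      (∀ i ∈ s, a i ≠ 0) → (∀ i ∈ s, 0 ≤ c i) → (∀ i ∈ s, f (a i) ≤ ENNReal.ofReal (c i)) →
      ∑ i ∈ s, l i • a i ≠ 0 → Attains f (∑ i ∈ s, l i • a i) (∑ i ∈ s, l i * c i) := by
  induction hs using Finset.Nonempty.cons_induction with
  | singleton i =>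
    intro l a c hl hl1 ha hc hf _
    simp only [Finset.sum_singleton] at hl1 ⊢
    rw [hl1, one_smul, one_mul]
    exact Attains.of_le (hc i (by simp)) (hf i (by simp))
  | cons i s hi hs ih =>
    intro l a c hl hl1 ha hc hf hB
    rw [Finset.sum_cons] at hl1 hB ⊢
    rw [Finset.sum_cons]
    set μ := ∑ j ∈ s, l j with hμ
    have hli : 0 < l i := hl i (by simp)
    have hμ0 : 0 < μ := Finset.sum_pos (fun j hj => hl j (by simp [hj])) hs
    set B := l i • a i + ∑ j ∈ s, l j • a j with hBdef
    obtain ⟨W, hW⟩ := exists_cross_ne_zero hB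
    apply Attains.of_forall_add
    intro η hη
    have hev : ∀ (k : ℝ) (j : ι), j ∈ Finset.cons i s hi → ∀ᶠ τ : ℝ in 𝓝 0,
        a j + (τ * k) • W ≠ 0 ∧ f (a j + (τ * k) • W) ≤ ENNReal.ofReal (c j + η) := by
      intro k j hj
      have ht : Tendsto (fun τ : ℝ => a j + (τ * k) • W) (𝓝 0) (𝓝 (a j)) :=
        (by fun_prop : Continuous fun τ : ℝ => a j + (τ * k) • W).tendsto' _ _ (by simp)
      have hne := ht.eventually (isOpen_compl_singleton.mem_nhds (ha j hj))
      have hfc : ContinuousAt f (a j) :=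
        hcont.continuousAt (isOpen_compl_singleton.mem_nhds (ha j hj))
      have hlt : f (a j) < ENNReal.ofReal (c j + η) := (hf j hj).trans_lt
        ((ENNReal.ofReal_lt_ofReal_iff (by linarith [hc j hj])).2 (by linarith))
      have := (hfc.tendsto.comp ht).eventually (gt_mem_nhds hlt)
      filter_upwards [hne, this] with τ h1 h2 using ⟨h1, h2.le⟩
    -- If a i is parallel to B, every τ ≠ 0 works since W is transversal to B; otherwise every
    -- sufficiently small τ works.
    have hcr : ∀ᶠ τ : ℝ in 𝓝[≠] 0, cross (a i + τ • W) B ≠ 0 := by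
      by_cases h0 : cross (a i) B = 0
      · filter_upwards [self_mem_nhdsWithin] with τ hτ
        have := cross_add_smul (a i) W 1 τ B
        rw [one_smul] at this
        rw [this, h0]
        simpa using ⟨hτ, hW⟩
      · have hc0 : Continuous fun τ : ℝ => cross (a i + τ • W) B := by
          unfold cross
          fun_prop
        have : ∀ᶠ τ : ℝ in 𝓝 0, cross (a i + τ • W) B ≠ 0 :=
          hc0.continuousAt.eventually_ne (by simpa using h0)
        exact this.filter_mono nhdsWithin_le_nhds
    have hall : ∀ᶠ τ : ℝ in 𝓝[≠] 0, ∀ j ∈ Finset.cons i s hi,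
        (a j + (τ * 1) • W ≠ 0 ∧ f (a j + (τ * 1) • W) ≤ ENNReal.ofReal (c j + η)) ∧
        (a j + (τ * (-(l i / μ))) • W ≠ 0 ∧
          f (a j + (τ * (-(l i / μ))) • W) ≤ ENNReal.ofReal (c j + η)) := by
      rw [Filter.eventually_all_finset]
      intro j hj
      exact ((hev 1 j hj).and (hev _ j hj)).filter_mono nhdsWithin_le_nhds
    obtain ⟨τ, hτ, hτc⟩ := (hall.and hcr).exists
    have hi1 := (hτ i (by simp)).1
    rw [mul_one] at hi1
    set ai := a i + τ • W with hai
    set a' : ι → Plane := fun j => a j + (τ * (-(l i / μ))) • W with ha'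
    set b := ∑ j ∈ s, (l j / μ) • a' j with hb
    have hμb : μ • b = ∑ j ∈ s, l j • a j - (τ * l i) • W := by
      rw [hb, Finset.smul_sum]
      have : ∀ j ∈ s, μ • (l j / μ) • a' j = l j • a j - (l j * (τ * l i / μ)) • W := by
        intro j _
        rw [smul_smul, mul_div_cancel₀ _ hμ0.ne', ha']
        simp only
        module
      rw [Finset.sum_congr rfl this, Finset.sum_sub_distrib, ← Finset.sum_smul, ← Finset.sum_mul]
      congr 2
      rw [← hμ]
      field_simp
    have hBab : l i • ai + (1 - l i) • b = B := by
      rw [show 1 - l i = μ by linarith, hμb, hai, hBdef]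
      module
    -- B is a combination of `ai` and b, so if these were parallel then `ai` would be parallel to B.
    have hcrab : cross ai b ≠ 0 := by
      intro h0
      apply hτc
      rw [← hBab]
      have e : cross ai (l i • ai + (1 - l i) • b) = -cross (l i • ai + (1 - l i) • b) ai :=
        cross_swap _ _
      rw [e, cross_add_smul, cross_same, cross_swap b, h0]
      simp
    have hb0 : b ≠ 0 := by
      intro h
      apply hcrab
      rw [h]; simp [cross]
    have hIH := ih (fun j => l j / μ) a' (fun j => c j + η)
      (fun j hj => div_pos (hl j (by simp [hj])) hμ0)
      (by rw [← Finset.sum_div, ← hμ, div_self hμ0.ne'])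
      (fun j hj => (hτ j (by simp [hj])).2.1) (fun j hj => by linarith [hc j (by simp [hj])])
      (fun j hj => (hτ j (by simp [hj])).2.2) hb0
    have hAi : Attains f ai (c i + η) := Attains.of_le (by linarith [hc i (by simp)]) hi1.2
    have key := Attains.combo (θ := l i) ⟨hli, by linarith⟩ hcrab hAi hIH
      (by linarith [hc i (by simp)])
      (Finset.sum_nonneg fun j hj => mul_nonneg (div_pos (hl j (by simp [hj])) hμ0).le
        (by linarith [hc j (by simp [hj])]))
      (by rw [hBab]; exact (hfin B hB).ne)
    rw [hBab] at key
    apply key.mono (le_of_eq _)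
    have e1 : (1 - l i) * ∑ j ∈ s, l j / μ * (c j + η) = ∑ j ∈ s, l j * c j + μ * η := by
      rw [show 1 - l i = μ by linarith, Finset.mul_sum]
      have : ∀ j ∈ s, μ * (l j / μ * (c j + η)) = l j * c j + l j * η := by
        intro j _
        field_simp
      rw [Finset.sum_congr rfl this, Finset.sum_add_distrib, ← Finset.sum_mul]
    rw [e1]
    have : μ = 1 - l i := by linarith
    rw [this]; ring

/-! ### The convex envelope as the convex hull of the epigraph -/

/-- The real epigraph of `f`. -/
def epi (f : Plane → ℝ≥0∞) : Set (Plane × ℝ) := {x | 0 ≤ x.2 ∧ f x.1 ≤ ENNReal.ofReal x.2}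

/-- The convex hull of the function `f`. -/
def hullFn (f : Plane → ℝ≥0∞) (a : Plane) : ℝ := sInf {c | (a, c) ∈ convexHull ℝ (epi f)}

section
variable {f : Plane → ℝ≥0∞}

theorem nonneg_of_mem_hull {x : Plane × ℝ} (hx : x ∈ convexHull ℝ (epi f)) : 0 ≤ x.2 := by
  have hc : Convex ℝ {x : Plane × ℝ | 0 ≤ x.2} :=
    convex_halfSpace_ge (LinearMap.snd ℝ Plane ℝ).isLinear 0
  exact convexHull_min (fun x hx => hx.1) hc hx

theorem hullFn_le {a : Plane} {c : ℝ} (h : (a, c) ∈ convexHull ℝ (epi f)) : hullFn f a ≤ c :=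
  csInf_le ⟨0, fun _ hc => nonneg_of_mem_hull hc⟩ h

theorem hullFn_nonneg (a : Plane) : 0 ≤ hullFn f a :=
  Real.sInf_nonneg fun _ hc => nonneg_of_mem_hull hc

theorem hullFn_le_of_le {a : Plane} {c : ℝ} (hc : 0 ≤ c) (h : f a ≤ ENNReal.ofReal c) :
    hullFn f a ≤ c := hullFn_le (subset_convexHull ℝ _ ⟨hc, h⟩)

theorem ofReal_hullFn_le (a : Plane) : ENNReal.ofReal (hullFn f a) ≤ f a := by
  by_cases h : f a = ∞
  · rw [h]; exact le_top
  · rw [← ENNReal.ofReal_toReal h]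
    exact ENNReal.ofReal_le_ofReal
      (hullFn_le_of_le ENNReal.toReal_nonneg (ENNReal.ofReal_toReal h).ge)

theorem hull_nonempty (hfin : ∀ a, a ≠ 0 → f a < ∞) (a : Plane) :
    {c | (a, c) ∈ convexHull ℝ (epi f)}.Nonempty := by
  have h : ∀ a, a ≠ 0 → (a, (f a).toReal) ∈ convexHull ℝ (epi f) := fun a ha =>
    subset_convexHull ℝ _ ⟨ENNReal.toReal_nonneg, (ENNReal.ofReal_toReal (hfin a ha).ne).ge⟩
  by_cases ha : a = 0
  · subst ha
    -- The value of f at 0 gives nothing, but 0 is the midpoint of two nonzero vectors.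
    obtain ⟨e, he⟩ := exists_ne (0 : Plane)
    have := (convex_convexHull ℝ (epi f)) (h e he) (h (-e) (neg_ne_zero.2 he))
      (show (0 : ℝ) ≤ 1 / 2 by norm_num) (show (0 : ℝ) ≤ 1 / 2 by norm_num) (by norm_num)
    refine ⟨1 / 2 * (f e).toReal + 1 / 2 * (f (-e)).toReal, ?_⟩
    simpa using this
  · exact ⟨_, h a ha⟩

theorem exists_mem_hull_lt (hfin : ∀ a, a ≠ 0 → f a < ∞) (a : Plane) {η : ℝ} (hη : 0 < η) :
    ∃ c < hullFn f a + η, (a, c) ∈ convexHull ℝ (epi f) := by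
  obtain ⟨c, hc, hlt⟩ := exists_lt_of_csInf_lt (hull_nonempty hfin a)
    (show sInf {c | (a, c) ∈ convexHull ℝ (epi f)} < hullFn f a + η by
      rw [← hullFn]; linarith)
  exact ⟨c, hlt, hc⟩

theorem convexOn_hullFn (hfin : ∀ a, a ≠ 0 → f a < ∞) : ConvexOn ℝ univ (hullFn f) := by
  refine ⟨convex_univ, fun a _ b _ s t hs ht hst => le_of_forall_pos_le_add fun η hη => ?_⟩
  obtain ⟨c, hc, hca⟩ := exists_mem_hull_lt hfin a hη
  obtain ⟨d, hd, hdb⟩ := exists_mem_hull_lt hfin b hη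
  have h := hullFn_le ((convex_convexHull ℝ (epi f)) hca hdb hs ht hst)
  simp only [smul_eq_mul, Prod.smul_fst, Prod.smul_snd] at h ⊢
  refine h.trans ?_
  have h1 := mul_le_mul_of_nonneg_left hc.le hs
  have h2 := mul_le_mul_of_nonneg_left hd.le ht
  have h3 : s * η + t * η = η := by rw [← add_mul, hst, one_mul]
  linarith

theorem continuous_hullFn (hfin : ∀ a, a ≠ 0 → f a < ∞) : Continuous (hullFn f) := by
  have := (convexOn_hullFn hfin).continuousOn isOpen_univ
  rwa [continuousOn_univ] at this

/-- A convex minorant of f has a convex epigraph containing that of f, hence also its hull.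
Conversely `hullFn f` is finite and convex, so it is itself an admissible minorant. -/
theorem convexEnvelope_eq (hfin : ∀ a, a ≠ 0 → f a < ∞) (a : Plane)
    : convexEnvelope f a = ENNReal.ofReal (hullFn f a) := by
  apply le_antisymm
  · refine iSup₂_le fun g hg => iSup_le fun hgf => ENNReal.ofReal_le_ofReal ?_
    refine le_csInf (hull_nonempty hfin a) fun c hc => ?_
    have hsub : convexHull ℝ (epi f) ⊆ {x : Plane × ℝ | x.1 ∈ univ ∧ g x.1 ≤ x.2} :=
      convexHull_min (fun x hx => ⟨trivial,
        (ENNReal.ofReal_le_ofReal_iff hx.1).1 ((hgf x.1).trans hx.2)⟩) hg.convex_epigraph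
    exact (hsub hc).2
  · exact le_iSup₂_of_le (hullFn f) (convexOn_hullFn hfin)
      (le_iSup_of_le ofReal_hullFn_le le_rfl)

/-- The growth condition on f degenerates at the origin, that of the hull does not: for |a| < 1, a
is the midpoint of a + v and a - v with |v| = 2, whose norms lie between 1 and 3. -/
theorem hullFn_growth (hfin : ∀ a, a ≠ 0 → f a < ∞) {q : ℝ} (hq : 0 ≤ q)
    (hgr : ∀ δ : ℝ, 0 < δ → ∃ c : ℝ, 0 < c ∧
      ∀ a : Plane, δ ≤ ‖a‖ → f a ≤ ENNReal.ofReal (c * (1 + ‖a‖ ^ q))) :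
    ∃ C : ℝ, 0 < C ∧ ∀ a, hullFn f a ≤ C * (1 + ‖a‖ ^ q) := by
  obtain ⟨c, hc, hcf⟩ := hgr 1 one_pos
  have hbig : ∀ a : Plane, 1 ≤ ‖a‖ → hullFn f a ≤ c * (1 + ‖a‖ ^ q) := fun a ha =>
    hullFn_le_of_le (by positivity) (hcf a ha)
  have h3 : (1 : ℝ) ≤ 1 + 3 ^ q := by linarith [Real.rpow_nonneg (show (0 : ℝ) ≤ 3 by norm_num) q]
  refine ⟨c * (1 + 3 ^ q), by positivity, fun a => ?_⟩
  have h0 : (1 : ℝ) ≤ 1 + ‖a‖ ^ q := by linarith [Real.rpow_nonneg (norm_nonneg a) q]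
  rcases le_or_gt 1 ‖a‖ with h | h
  · refine (hbig a h).trans ?_
    nlinarith [mul_nonneg hc.le (show (0 : ℝ) ≤ 1 + ‖a‖ ^ q by linarith)]
  · have hv : ‖(!₂[2, 0] : Plane)‖ = 2 := by
      simp [EuclideanSpace.norm_eq, Fin.sum_univ_two]
    set v : Plane := !₂[2, 0]
    have key : ∀ b : Plane, ‖b‖ ≤ 3 → 1 ≤ ‖b‖ → hullFn f b ≤ c * (1 + 3 ^ q) := fun b hb hb1 =>
      (hbig b hb1).trans (by gcongr)
    have h1 := key (a + v) ((norm_add_le _ _).trans (by linarith)) (by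
      have := norm_sub_norm_le v (-a)
      rw [norm_neg, sub_neg_eq_add, add_comm] at this
      linarith)
    have h2 := key (a - v) ((norm_sub_le _ _).trans (by linarith)) (by
      have := norm_sub_norm_le v a
      rw [norm_sub_rev] at this
      linarith)
    have h4 := (convexOn_hullFn hfin).2 (mem_univ (a + v)) (mem_univ (a - v))
      (show (0 : ℝ) ≤ 1 / 2 by norm_num) (show (0 : ℝ) ≤ 1 / 2 by norm_num) (by norm_num)
    have h5 : (1 / 2 : ℝ) • (a + v) + (1 / 2 : ℝ) • (a - v) = a := by module
    rw [h5] at h4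
    simp only [smul_eq_mul] at h4
    have h6 : hullFn f a ≤ c * (1 + 3 ^ q) := by linarith
    refine h6.trans ?_
    exact le_mul_of_one_le_right (by positivity) h0

/-- The convex hulls of `f + ε |·|^q` decrease to that of `f`. -/
theorem tendsto_hullFn_add (hfin : ∀ a, a ≠ 0 → f a < ∞) (q : ℝ) (a : Plane) :
    Tendsto (fun n : ℕ => hullFn (fun x => f x + ENNReal.ofReal (1 / (n + 1 : ℝ) * ‖x‖ ^ q)) a)
      atTop (𝓝 (hullFn f a)) := by
  set fn : ℕ → Plane → ℝ≥0∞ := fun n x => f x + ENNReal.ofReal (1 / (n + 1 : ℝ) * ‖x‖ ^ q) with hfn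
  have hfinn : ∀ n a, a ≠ 0 → fn n a < ∞ := fun n a ha =>
    ENNReal.add_lt_top.2 ⟨hfin a ha, ENNReal.ofReal_lt_top⟩
  have hle : ∀ n, hullFn f a ≤ hullFn (fn n) a := by
    intro n
    refine le_csInf (hull_nonempty (hfinn n) a) fun c hc => hullFn_le ?_
    have hsub : epi (fn n) ⊆ epi f := fun x hx => ⟨hx.1, le_self_add.trans hx.2⟩
    exact convexHull_mono hsub hc
  -- The bound with some K independent of n is clear on the epigraph, with K = ‖x‖^q, and survives
  -- convex combinations.
  have hup : ∀ x ∈ convexHull ℝ (epi f), ∃ K : ℝ, ∀ n : ℕ,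
      hullFn (fn n) x.1 ≤ x.2 + 1 / (n + 1 : ℝ) * K := by
    have hconv : Convex ℝ {x : Plane × ℝ | ∃ K : ℝ, ∀ n : ℕ,
        hullFn (fn n) x.1 ≤ x.2 + 1 / (n + 1 : ℝ) * K} := by
      rintro x ⟨K, hK⟩ y ⟨K', hK'⟩ s t hs ht hst
      refine ⟨s * K + t * K', fun n => ?_⟩
      have h1 := (convexOn_hullFn (hfinn n)).2 (mem_univ x.1) (mem_univ y.1) hs ht hst
      have h2 := mul_le_mul_of_nonneg_left (hK n) hs
      have h3 := mul_le_mul_of_nonneg_left (hK' n) ht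
      simp only [smul_eq_mul, Prod.fst_add, Prod.smul_fst, Prod.snd_add, Prod.smul_snd] at h1 ⊢
      refine h1.trans ((add_le_add h2 h3).trans (le_of_eq ?_))
      ring
    refine fun x hx => convexHull_min ?_ hconv hx
    intro x hx
    refine ⟨‖x.1‖ ^ q, fun n => hullFn_le_of_le (by have := hx.1; positivity) ?_⟩
    rw [ENNReal.ofReal_add hx.1 (by positivity)]
    exact add_le_add hx.2 le_rfl
  rw [Metric.tendsto_atTop]
  intro ε hε
  obtain ⟨c, hc, hca⟩ := exists_mem_hull_lt hfin a (half_pos hε)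
  obtain ⟨K, hK⟩ := hup _ hca
  have ht : Tendsto (fun n : ℕ => 1 / (n + 1 : ℝ) * K) atTop (𝓝 0) := by
    simpa using (tendsto_one_div_add_atTop_nhds_zero_nat (𝕜 := ℝ)).mul_const K
  obtain ⟨N, hN⟩ := eventually_atTop.1 (ht.eventually (gt_mem_nhds (half_pos hε)))
  refine ⟨N, fun n hn => ?_⟩
  have h1 := hK n
  have h2 := hN n hn
  have h3 := hle n
  simp only at h1
  rw [Real.dist_eq, abs_lt]
  constructor <;> linarith

/-- A nearly optimal point of the hull is a finite convex combination of points of the epigraph.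
None of the slopes is 0 since f 0 = ∞, and `Attains.of_sum` applies. -/
theorem Attains.hullFn (hfin : ∀ a, a ≠ 0 → f a < ∞) (hcont : ContinuousOn f {0}ᶜ) (h0 : f 0 = ∞)
    {B : Plane} (hB : B ≠ 0) :
    Attains f B (hullFn f B) := by
  apply Attains.of_forall_add
  intro η hη
  obtain ⟨c, hc, hmem⟩ := exists_mem_hull_lt hfin B hη
  refine Attains.mono ?_ hc.le
  rw [mem_convexHull_iff_exists_fintype] at hmem
  obtain ⟨ι, _, w, x, hw0, hw1, hx, hsum⟩ := hmem
  classical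
  -- Zero weights are dropped, since the zigzags need positive ones.
  set s := Finset.univ.filter fun i => 0 < w i with hs
  have hres : ∀ {M : Type} [AddCommMonoid M] [Module ℝ M] (g : ι → M),
      ∑ i, w i • g i = ∑ i ∈ s, w i • g i := by
    intro M _ _ g
    symm
    apply Finset.sum_subset (Finset.subset_univ _)
    intro i _ hi
    have : w i = 0 := by
      have := hw0 i
      simp only [hs, Finset.mem_filter, Finset.mem_univ, true_and, not_lt] at hi
      linarith
    rw [this, zero_smul]
  have h1 : ∑ i ∈ s, w i • (x i).1 = B := by
    rw [← hres]
    have := congrArg Prod.fst hsum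
    simpa [Prod.fst_sum] using this
  have h2 : ∑ i ∈ s, w i * (x i).2 = c := by
    have e := hres (fun i => (x i).2)
    simp only [smul_eq_mul] at e
    rw [← e]
    have := congrArg Prod.snd hsum
    simpa [Prod.snd_sum] using this
  have h3 : ∑ i ∈ s, w i = 1 := by
    have e := hres (fun _ => (1 : ℝ))
    simp only [smul_eq_mul, mul_one] at e
    rw [← e, hw1]
  have hne : s.Nonempty := by
    by_contra hcon
    rw [Finset.not_nonempty_iff_eq_empty] at hcon
    rw [hcon] at h3
    simp at h3
  rw [← h1, ← h2]
  refine Attains.of_sum hfin hcont s hne w (fun i => (x i).1) (fun i => (x i).2)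
    (fun i hi => (Finset.mem_filter.1 hi).2) h3 (fun i _ h => ?_) (fun i _ => (hx i).1)
    (fun i _ => (hx i).2) (by rw [h1]; exact hB)
  have := (hx i).2
  rw [h, h0] at this
  exact ENNReal.ofReal_ne_top (top_le_iff.1 this)

/-- Relaxation on piecewise affine injective functions. -/
theorem exists_relaxed (hfin : ∀ a, a ≠ 0 → f a < ∞) (hcont : ContinuousOn f {0}ᶜ) (h0 : f 0 = ∞)
    {u : ℝ → Plane}
    (hu : PAff u 0 1) (hinj : InjOn u (Icc 0 1)) {ε : ℝ} (hε : 0 < ε) :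
    ∃ w, PAff w 0 1 ∧ InjOn w (Icc 0 1) ∧ (∀ x, dist (w x) (u x) ≤ ε) ∧
      energyOn f w 0 1 ≤
        energyOn (fun a => ENNReal.ofReal (_root_.hullFn f a)) u 0 1 + ENNReal.ofReal ε := by
  have main : ∀ a b, PAff u a b → 0 ≤ a → b ≤ 1 → ∃ e : ℝ, 0 ≤ e ∧
      ENNReal.ofReal e = energyOn (fun a => ENNReal.ofReal (_root_.hullFn f a)) u a b ∧
      Improvable f u a b e := by
    intro a b hab
    induction hab with
    | @seg a b B hlt hB =>
      intro ha hb
      -- A vanishing slope would make u constant on the piece, against injectivity.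
      have hB0 : B ≠ 0 := by
        rintro rfl
        have h1 := hB b ⟨hlt.le, le_rfl⟩
        rw [smul_zero, add_zero] at h1
        exact hlt.ne' (hinj ⟨ha.trans hlt.le, hb⟩ ⟨ha, hlt.le.trans hb⟩ h1)
      refine ⟨_root_.hullFn f B * (b - a), mul_nonneg (hullFn_nonneg B) (by linarith), ?_, ?_⟩
      · rw [energyOn_of_affOn _ hB, ENNReal.ofReal_mul (hullFn_nonneg B)]
      · exact Attains.hullFn hfin hcont h0 hB0 u a b ha hlt hb hB
    | @trans a m b h1 h2 i1 i2 =>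
      intro ha hb
      obtain ⟨e, he, hee, hei⟩ := i1 ha (h2.lt.le.trans hb)
      obtain ⟨e', he', hee', hei'⟩ := i2 (ha.trans h1.lt.le) hb
      refine ⟨e + e', add_nonneg he he', ?_, hei.trans hei' h1.lt.le h2.lt.le he he'⟩
      rw [ENNReal.ofReal_add he he', hee, hee', ← energyOn_add _ u h1.lt.le h2.lt.le]
  obtain ⟨e, he, hee, hei⟩ := main 0 1 hu le_rfl le_rfl
  obtain ⟨w, h1, h2, -, h4, h5⟩ := hei u hu hinj (fun x _ => rfl) ε hε
  refine ⟨w, h1, h2, h4, h5.trans ?_⟩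
  rw [ENNReal.ofReal_add he hε.le, hee]

end

/-! ### Parametrizing a simple polygon with little energy -/

theorem le_of_forall_lt_succ {σ : ℕ → ℝ} {n : ℕ} (hσ : ∀ i < n, σ i < σ (i + 1)) {i j : ℕ}
    (hij : i ≤ j) (hj : j ≤ n) : σ i ≤ σ j := by
  induction j, hij using Nat.le_induction with
  | base => exact le_rfl
  | succ j _ ih => exact (ih (by omega)).trans (hσ j (by omega)).le

theorem exists_polygonFn (P : ℕ → Plane) (σ : ℕ → ℝ) (n : ℕ) (hσ : ∀ i < n, σ i < σ (i + 1)) :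
    ∃ u : ℝ → Plane, (∀ i ≤ n, u (σ i) = P i) ∧
      ∀ i < n, AffOn u (σ i) (σ (i + 1)) ((σ (i + 1) - σ i)⁻¹ • (P (i + 1) - P i)) := by
  induction n with
  | zero => exact ⟨fun _ => P 0, fun i hi => by rw [Nat.le_zero.1 hi], fun i hi => by omega⟩
  | succ n ih =>
    obtain ⟨u, hu1, hu2⟩ := ih fun i hi => hσ i (by omega)
    have hlt := hσ n (by omega)
    have hmono : ∀ i ≤ n, σ i ≤ σ n := fun i hi =>
      le_of_forall_lt_succ (fun k hk => hσ k (by omega)) hi le_rfl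
    set B := (σ (n + 1) - σ n)⁻¹ • (P (n + 1) - P n) with hB
    set w : ℝ → Plane := fun x => if x ≤ σ n then u x else P n + (x - σ n) • B with hw
    have hw1 : ∀ x, x ≤ σ n → w x = u x := fun x hx => if_pos hx
    have hw2 : ∀ x, σ n ≤ x → w x = P n + (x - σ n) • B := by
      intro x hx
      rcases hx.lt_or_eq with h | h
      · exact if_neg (not_le.2 h)
      · rw [← h, hw1 _ le_rfl, hu1 n le_rfl, sub_self, zero_smul, add_zero]
    refine ⟨w, ?_, ?_⟩
    · intro i hi
      rcases Nat.lt_or_ge i (n + 1) with h | h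
      · rw [hw1 _ (hmono i (by omega)), hu1 i (by omega)]
      · obtain rfl : i = n + 1 := by omega
        rw [hw2 _ hlt.le, hB, smul_smul, mul_inv_cancel₀ (sub_pos.2 hlt).ne', one_smul,
          add_sub_cancel]
    · intro i hi
      rcases Nat.lt_or_ge i n with h | h
      · exact (hu2 i h).congr fun x hx => hw1 x (hx.2.trans (hmono (i + 1) h))
      · obtain rfl : i = n := by omega
        intro x hx
        rw [hw2 x hx.1, hw2 _ le_rfl, sub_self, zero_smul, add_zero]

section
variable {P : ℕ → Plane} {σ : ℕ → ℝ} {n : ℕ} {u : ℝ → Plane}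

theorem PAff.of_pieces {B : ℕ → Plane} (hn : 0 < n) (hσ : ∀ i < n, σ i < σ (i + 1))
    (hu : ∀ i < n, AffOn u (σ i) (σ (i + 1)) (B i)) : PAff u (σ 0) (σ n) := by
  induction n, hn using Nat.le_induction with
  | base => exact .seg _ (hσ 0 (by omega)) (hu 0 (by omega))
  | succ n hn ih =>
    exact (ih (fun i hi => hσ i (by omega)) (fun i hi => hu i (by omega))).trans
      (.seg _ (hσ n (by omega)) (hu n (by omega)))

theorem exists_mem_piece (hn : 0 < n) {x : ℝ} (hx : x ∈ Icc (σ 0) (σ n)) :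
    ∃ i < n, x ∈ Icc (σ i) (σ (i + 1)) ∧ (x < σ (i + 1) ∨ x = σ n) := by
  induction n, hn using Nat.le_induction with
  | base =>
    refine ⟨0, by omega, hx, ?_⟩
    exact hx.2.lt_or_eq
  | succ n hn ih =>
    rcases lt_or_ge x (σ n) with h | h
    · obtain ⟨i, hi, h1, h2⟩ := ih ⟨hx.1, h.le⟩
      exact ⟨i, by omega, h1, h2.elim Or.inl fun h' => absurd h' h.ne⟩
    · exact ⟨n, by omega, ⟨h, hx.2⟩, hx.2.lt_or_eq⟩

theorem AffOn.eq_lineMap {a b : ℝ}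
    (hu : AffOn u a b ((b - a)⁻¹ • (u b - u a))) {x : ℝ} (hx : x ∈ Icc a b) :
    u x = AffineMap.lineMap (u a) (u b) ((x - a) / (b - a)) := by
  rw [hu x hx, smul_smul, AffineMap.lineMap_apply, vsub_eq_sub, vadd_eq_add, div_eq_mul_inv,
    add_comm]

theorem SimplePolygon.injOn (hP : SimplePolygon P n) (hn : 0 < n) (hσ : ∀ i < n, σ i < σ (i + 1))
    (hu1 : ∀ i ≤ n, u (σ i) = P i)
    (hu2 : ∀ i < n, AffOn u (σ i) (σ (i + 1)) ((σ (i + 1) - σ i)⁻¹ • (P (i + 1) - P i))) :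
    InjOn u (Icc (σ 0) (σ n)) := by
  have hline : ∀ i < n, ∀ x ∈ Icc (σ i) (σ (i + 1)),
      u x = AffineMap.lineMap (P i) (P (i + 1)) ((x - σ i) / (σ (i + 1) - σ i)) := by
    intro i hi x hx
    have := hu2 i hi
    rw [← hu1 i hi.le, ← hu1 (i + 1) hi] at this ⊢
    exact this.eq_lineMap hx
  have hmem : ∀ i < n, ∀ x ∈ Icc (σ i) (σ (i + 1)), x < σ (i + 1) → u x ∈ hseg (P i) (P (i + 1)) := by
    intro i hi x hx hlt
    have h0 := sub_pos.2 (hσ i hi)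
    refine ⟨_, ⟨div_nonneg (sub_nonneg.2 hx.1) h0.le, ?_⟩, (hline i hi x hx).symm⟩
    rw [div_lt_one h0]; linarith
  intro x hx y hy hxy
  obtain ⟨i, hi, hxi, hxi'⟩ := exists_mem_piece hn hx
  obtain ⟨j, hj, hyj, hyj'⟩ := exists_mem_piece hn hy
  rcases hxi' with h1 | h1 <;> rcases hyj' with h2 | h2
  · have m1 := hmem i hi x hxi h1
    have m2 := hmem j hj y hyj h2
    by_cases hij : i = j
    · subst hij
      rw [hline i hi x hxi, hline i hi y hyj] at hxy
      have h0 := sub_pos.2 (hσ i hi)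
      have := AffineMap.lineMap_injective ℝ (hP.ne i hi) hxy
      rw [div_left_inj' h0.ne'] at this
      linarith
    · rw [hxy] at m1
      exact absurd m2 (hP.disj i hi j hj hij _ m1)
  · have m1 := hmem i hi x hxi h1
    rw [hxy, h2, hu1 n le_rfl] at m1
    exact absurd m1 (hP.last i hi)
  · have m2 := hmem j hj y hyj h2
    rw [← hxy, h1, hu1 n le_rfl] at m2
    exact absurd m2 (hP.last j hj)
  · rw [h1, h2]

end

theorem energyOn_sum (F : Plane → ℝ≥0∞) (u : ℝ → Plane) (σ : ℕ → ℝ) (n : ℕ)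
    (hσ : ∀ i < n, σ i < σ (i + 1)) :
    energyOn F u (σ 0) (σ n) = ∑ i ∈ Finset.range n, energyOn F u (σ i) (σ (i + 1)) := by
  induction n with
  | zero => simp [energyOn]
  | succ n ih =>
    have hmono : σ 0 ≤ σ n := le_of_forall_lt_succ hσ (Nat.zero_le _) (Nat.le_succ n)
    rw [Finset.sum_range_succ, ← ih fun i hi => hσ i (by omega),
      energyOn_add F u hmono (hσ n (by omega)).le]

/-- Jensen's inequality with some additional time during which the function is constant. -/
theorem jensen_pad {G : Plane → ℝ} (hG : ConvexOn ℝ univ G) (hGc : Continuous G)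
    {g : ℝ → Plane} {a b ρ : ℝ} (hab : a ≤ b) (hρ : 0 < ρ) (hg : IntegrableOn g (Ioc a b))
    (hGg : IntegrableOn (fun x => G (g x)) (Ioc a b)) :
    (b - a + ρ) * G ((b - a + ρ)⁻¹ • ∫ x in Ioc a b, g x) ≤
      (∫ x in Ioc a b, G (g x)) + ρ * G 0 := by
  rcases hab.lt_or_eq with h | h
  · have hd : 0 < b - a := sub_pos.2 h
    have hvol : volume (Ioc a b) = ENNReal.ofReal (b - a) := Real.volume_Ioc
    have hreal : volume.real (Ioc a b) = b - a := by
      rw [Measure.real, hvol, ENNReal.toReal_ofReal hd.le]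
    have hJ := hG.map_set_average_le hGc.continuousOn isClosed_univ (μ := volume) (t := Ioc a b)
      (f := g) (by rw [hvol]; simpa using h) (by rw [hvol]; exact ENNReal.ofReal_ne_top) (by simp)
      hg hGg
    rw [setAverage_eq, setAverage_eq, hreal, smul_eq_mul] at hJ
    -- The mean over the prolonged interval is a convex combination of the mean of g, with weight
    -- proportional to b - a, and of 0, with weight proportional to ρ.
    have hw := hG.2 (mem_univ ((b - a)⁻¹ • ∫ x in Ioc a b, g x)) (mem_univ (0 : Plane))
      (show 0 ≤ (b - a) / (b - a + ρ) by positivity) (show 0 ≤ ρ / (b - a + ρ) by positivity)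
      (by field_simp)
    rw [smul_zero, add_zero, smul_smul, show (b - a) / (b - a + ρ) * (b - a)⁻¹ = (b - a + ρ)⁻¹ by
      field_simp] at hw
    simp only [smul_eq_mul] at hw
    have h1 := mul_le_mul_of_nonneg_left hw (show 0 ≤ b - a + ρ by positivity)
    have e : (b - a + ρ) * ((b - a) / (b - a + ρ) * G ((b - a)⁻¹ • ∫ x in Ioc a b, g x) +
        ρ / (b - a + ρ) * G 0) = (b - a) * G ((b - a)⁻¹ • ∫ x in Ioc a b, g x) + ρ * G 0 := by
      field_simp
    rw [e] at h1
    have h2 := mul_le_mul_of_nonneg_left hJ hd.le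
    rw [← mul_assoc, mul_inv_cancel₀ hd.ne', one_mul] at h2
    linarith
  · subst h
    simp

/-- The convex function that controls `G (a + b)` for `‖b‖ ≤ s (‖a‖ + 1)`. -/
def powBound (q : ℝ) (a : Plane) : ℝ := 1 + (2 * ‖a‖ + 1) ^ q

theorem convexOn_powBound {q : ℝ} (hq : 1 ≤ q) : ConvexOn ℝ univ (powBound q) := by
  refine ⟨convex_univ, fun a _ b _ s t hs ht hst => ?_⟩
  have h1 : 2 * ‖s • a + t • b‖ + 1 ≤ s * (2 * ‖a‖ + 1) + t * (2 * ‖b‖ + 1) := by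
    have := norm_add_le (s • a) (t • b)
    rw [norm_smul, norm_smul, Real.norm_of_nonneg hs, Real.norm_of_nonneg ht] at this
    nlinarith
  have h2 := (convexOn_rpow hq).2 (show 2 * ‖a‖ + 1 ∈ Ici (0 : ℝ) from by
    have := norm_nonneg a; simp only [mem_Ici]; linarith)
    (show 2 * ‖b‖ + 1 ∈ Ici (0 : ℝ) from by
      have := norm_nonneg b; simp only [mem_Ici]; linarith) hs ht hst
  have h3 := Real.rpow_le_rpow (by positivity) h1 (zero_le_one.trans hq)
  simp only [smul_eq_mul] at h2 ⊢
  unfold powBound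
  calc 1 + (2 * ‖s • a + t • b‖ + 1) ^ q
      ≤ 1 + (s * (2 * ‖a‖ + 1) ^ q + t * (2 * ‖b‖ + 1) ^ q) := by linarith
    _ = s * (1 + (2 * ‖a‖ + 1) ^ q) + t * (1 + (2 * ‖b‖ + 1) ^ q) := by
      linear_combination -1 * hst

theorem continuous_powBound {q : ℝ} (hq : 0 ≤ q) : Continuous (powBound q) := by
  unfold powBound
  exact continuous_const.add ((by fun_prop : Continuous fun a : Plane => 2 * ‖a‖ + 1).rpow_const
    fun _ => Or.inr hq)

theorem powBound_nonneg (q : ℝ) (a : Plane) : 0 ≤ powBound q a := by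
  unfold powBound; positivity

/-- A simple polygon whose vertices follow `y` up to small errors can be parametrized with almost
no more energy than `y`. -/
theorem exists_reparametrization {H : Plane → ℝ} (hH : ConvexOn ℝ univ H) (hHc : Continuous H)
    (hH0 : ∀ a, 0 ≤ H a) {C q : ℝ} (hC : 0 ≤ C) (hq : 1 ≤ q)
    (hgr : ∀ a, H a ≤ C * (1 + ‖a‖ ^ q)) {y g : ℝ → Plane} (hg : IntegrableOn g (Ioc 0 1))
    (hHg : IntegrableOn (fun x => H (g x)) (Ioc 0 1))
    (hBg : IntegrableOn (fun x => powBound q (g x)) (Ioc 0 1))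
    (hy : ∀ a b, 0 ≤ a → a ≤ b → b ≤ 1 → y b - y a = ∫ x in Ioc a b, g x)
    {n : ℕ} (hn : 0 < n) {T ρ : ℕ → ℝ} {P : ℕ → Plane} {κ s r : ℝ} (hT0 : T 0 = 0) (hT1 : T n = 1)
    (hT : ∀ i < n, T i ≤ T (i + 1)) (hρ : ∀ i < n, 0 < ρ i)
    (hs : 0 < s) (hs1 : s ≤ 1) (hρs : ∑ i ∈ Finset.range n, ρ i ≤ s) (hκ : 2 * κ ≤ s)
    (hP : SimplePolygon P n)
    (herr : ∀ i < n, ‖(P (i + 1) - P i) - (y (T (i + 1)) - y (T i))‖ ≤ κ * ρ i)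
    (hr : ∀ i < n, ∀ t ∈ Icc (T i) (T (i + 1)), dist (P i) (y t) ≤ r ∧ dist (P (i + 1)) (y t) ≤ r) :
    ∃ u, PAff u 0 1 ∧ InjOn u (Icc 0 1) ∧
      (∀ x ∈ Icc (0 : ℝ) 1, ∃ t ∈ Icc (0 : ℝ) 1, |x - t| ≤ s ∧ dist (u x) (y t) ≤ r) ∧
      energyOn (fun a => ENNReal.ofReal (H a)) u 0 1 ≤
        ENNReal.ofReal ((∫ x in Ioc (0 : ℝ) 1, H (g x)) +
          s * (H 0 + C * ((∫ x in Ioc (0 : ℝ) 1, powBound q (g x)) + powBound q 0))) := by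
  set sumρ : ℕ → ℝ := fun i => ∑ j ∈ Finset.range i, ρ j with hsum
  set S := 1 + sumρ n with hS
  have hsum0 : ∀ i ≤ n, 0 ≤ sumρ i := fun i hi =>
    Finset.sum_nonneg fun j hj => (hρ j (by have := Finset.mem_range.1 hj; omega)).le
  have hsumn : ∀ i ≤ n, sumρ i ≤ sumρ n := fun i hi =>
    Finset.sum_le_sum_of_subset_of_nonneg (Finset.range_mono hi)
      fun j hj _ => (hρ j (Finset.mem_range.1 hj)).le
  have hsums : sumρ n ≤ s := hρs
  have hS1 : 1 ≤ S := by have := hsum0 n le_rfl; linarith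
  have hS0 : 0 < S := by linarith
  -- The segment i takes time T (i + 1) - T i + ρ i, and the total time S is rescaled to 1. The
  -- positive ρ i makes all nodes distinct even where T does not increase.
  set σ : ℕ → ℝ := fun i => (T i + sumρ i) / S with hσdef
  have hsumsucc : ∀ i, sumρ (i + 1) = sumρ i + ρ i := fun i => Finset.sum_range_succ _ _
  have hσd : ∀ i, σ (i + 1) - σ i = (T (i + 1) - T i + ρ i) / S := by
    intro i
    simp only [hσdef, hsumsucc]
    ring
  have hDpos : ∀ i < n, 0 < T (i + 1) - T i + ρ i := fun i hi => by
    linarith [hT i hi, hρ i hi]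
  have hσ : ∀ i < n, σ i < σ (i + 1) := by
    intro i hi
    rw [← sub_pos, hσd]
    exact div_pos (hDpos i hi) hS0
  have hσ0 : σ 0 = 0 := by simp [hσdef, hT0, hsum]
  have hσn : σ n = 1 := by
    simp only [hσdef, hT1]
    exact div_self hS0.ne'
  have hTmono : ∀ i j, i ≤ j → j ≤ n → T i ≤ T j := by
    intro i j hij
    induction j, hij using Nat.le_induction with
    | base => intro; exact le_rfl
    | succ j _ ih => intro h; exact (ih (by omega)).trans (hT j (by omega))
  have hTI : ∀ i ≤ n, T i ∈ Icc (0 : ℝ) 1 := fun i hi =>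
    ⟨hT0 ▸ hTmono 0 i (Nat.zero_le _) hi, hT1 ▸ hTmono i n hi le_rfl⟩
  have hσT : ∀ i ≤ n, |σ i - T i| ≤ s := by
    intro i hi
    have e : σ i - T i = (sumρ i - sumρ n * T i) / S := by
      simp only [hσdef]
      rw [div_sub' hS0.ne']
      congr 1
      rw [hS]
      ring
    have h1 := hTI i hi
    have h2 := hsum0 i hi
    have h3 := hsumn i hi
    have h4 : 0 ≤ sumρ n := h2.trans h3
    rw [e, abs_div, abs_of_pos hS0, div_le_iff₀ hS0, abs_le]
    have h5 : sumρ n * T i ≤ sumρ n := mul_le_of_le_one_right h4 h1.2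
    have h6 : 0 ≤ sumρ n * T i := mul_nonneg h4 h1.1
    have h7 : s ≤ s * S := le_mul_of_one_le_right hs.le hS1
    constructor <;> linarith
  obtain ⟨u, hu1, hu2⟩ := exists_polygonFn P σ n hσ
  refine ⟨u, ?_, ?_, ?_, ?_⟩
  · have := PAff.of_pieces hn hσ hu2
    rwa [hσ0, hσn] at this
  · have := hP.injOn hn hσ hu1 hu2
    rwa [hσ0, hσn] at this
  · intro x hx
    obtain ⟨i, hi, hxi, -⟩ := exists_mem_piece (σ := σ) hn (x := x) (by rwa [hσ0, hσn])
    have e1 := abs_le.1 (hσT i hi.le)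
    have e2 := abs_le.1 (hσT (i + 1) hi)
    -- The comparison time is x clamped to [T i, T (i + 1)]; both vertices of the segment lie in the
    -- ball around y at that time, hence so does u x.
    have hux : u x ∈ Metric.closedBall (y (max (T i) (min x (T (i + 1))))) r := by
      have hm : max (T i) (min x (T (i + 1))) ∈ Icc (T i) (T (i + 1)) :=
        ⟨le_max_left _ _, max_le (hT i hi) (min_le_right _ _)⟩
      obtain ⟨r1, r2⟩ := hr i hi _ hm
      have h := hu2 i hi
      rw [← hu1 i hi.le, ← hu1 (i + 1) hi] at h
      rw [← hu1 i hi.le] at r1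
      rw [← hu1 (i + 1) hi] at r2
      rw [h.eq_lineMap hxi]
      refine (convex_closedBall _ _).lineMap_mem r1 r2 ?_
      have h0 := sub_pos.2 (hσ i hi)
      refine ⟨div_nonneg (sub_nonneg.2 hxi.1) h0.le, ?_⟩
      rw [div_le_one h0]; linarith [hxi.2]
    refine ⟨max (T i) (min x (T (i + 1))), ⟨le_max_of_le_left (hTI i hi.le).1,
      max_le (hTI i hi.le).2 ((min_le_right _ _).trans (hTI (i + 1) hi).2)⟩, ?_, hux⟩
    have hTT := hT i hi
    rw [abs_le]
    rcases le_total x (T (i + 1)) with h1 | h1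
    · rw [min_eq_left h1]
      rcases le_total (T i) x with h2 | h2
      · rw [max_eq_right h2]; constructor <;> linarith
      · rw [max_eq_left h2]; constructor <;> linarith [hxi.1]
    · rw [min_eq_right h1, max_eq_right hTT]
      constructor <;> linarith [hxi.2]
  · have hsubI : ∀ i < n, Ioc (T i) (T (i + 1)) ⊆ Ioc 0 1 := fun i hi =>
      Ioc_subset_Ioc (hTI i hi.le).1 (hTI (i + 1) hi).2
    have hpiece : ∀ i < n, energyOn (fun a => ENNReal.ofReal (H a)) u (σ i) (σ (i + 1)) ≤
        ENNReal.ofReal (((∫ x in Ioc (T i) (T (i + 1)), H (g x)) + ρ i * H 0) +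
          s * C * ((∫ x in Ioc (T i) (T (i + 1)), powBound q (g x)) + ρ i * powBound q 0)) := by
      intro i hi
      have hD := hDpos i hi
      have hJ1 := jensen_pad hH hHc (hT i hi) (hρ i hi) (hg.mono_set (hsubI i hi))
        (hHg.mono_set (hsubI i hi))
      have hJ2 := jensen_pad (convexOn_powBound hq) (continuous_powBound (by linarith)) (hT i hi)
        (hρ i hi) (hg.mono_set (hsubI i hi)) (hBg.mono_set (hsubI i hi))
      rw [energyOn_of_affOn _ (hu2 i hi), ← ENNReal.ofReal_mul (hH0 _), hσd, ← hy _ _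
        (hTI i hi.le).1 (hT i hi) (hTI (i + 1) hi).2] at *
      apply ENNReal.ofReal_le_ofReal
      set D := T (i + 1) - T i + ρ i with hDdef
      set m := D⁻¹ • (y (T (i + 1)) - y (T i)) with hm
      set e := (P (i + 1) - P i) - (y (T (i + 1)) - y (T i)) with he
      -- The actual slope is m + d, where m is the mean slope of y over the prolonged time D, and d
      -- collects the rescaling by S and the errors of the vertices.
      set d := (S - 1) • m + (S / D) • e with hd
      have hslope : (D / S)⁻¹ • (P (i + 1) - P i) = m + d := by
        rw [hd, hm, he, inv_div]
        module
      have hdn : ‖d‖ ≤ s * (‖m‖ + 1) := by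
        have h1 : ‖(S - 1) • m‖ ≤ s * ‖m‖ := by
          rw [norm_smul, Real.norm_of_nonneg (by linarith)]
          exact mul_le_mul_of_nonneg_right (by linarith) (norm_nonneg _)
        have h2 : ‖(S / D) • e‖ ≤ s := by
          rw [norm_smul, Real.norm_of_nonneg (by positivity)]
          calc S / D * ‖e‖ ≤ S / D * (κ * ρ i) := by gcongr; exact herr i hi
            _ = S * κ * (ρ i / D) := by ring
            _ ≤ s * 1 := by
                have hκ0 : 0 ≤ κ := by
                  have := (norm_nonneg _).trans (herr i hi)
                  exact nonneg_of_mul_nonneg_left this (hρ i hi)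
                have hρD : ρ i / D ≤ 1 := by
                  rw [div_le_one hD]; linarith [hT i hi]
                have hSκ : S * κ ≤ s := by nlinarith
                exact mul_le_mul hSκ hρD (div_nonneg (hρ i hi).le hD.le) hs.le
            _ = s := mul_one s
        calc ‖d‖ ≤ ‖(S - 1) • m‖ + ‖(S / D) • e‖ := norm_add_le _ _
          _ ≤ s * ‖m‖ + s := add_le_add h1 h2
          _ = s * (‖m‖ + 1) := by ring
      -- Here m + d lies at the fraction s between m and m + d/s. The latter point has norm at most
      -- 2‖m‖ + 1, so convexity bounds the increase of H by s times a power bound in m.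
      have hHmd : H (m + d) ≤ H m + s * (C * powBound q m) := by
        have h1 := hH.2 (mem_univ m) (mem_univ (m + s⁻¹ • d)) (show 0 ≤ 1 - s by linarith) hs.le
          (by ring)
        have h2 : (1 - s) • m + s • (m + s⁻¹ • d) = m + d := by
          rw [smul_add, smul_inv_smul₀ hs.ne']
          module
        rw [h2] at h1
        simp only [smul_eq_mul] at h1
        have h3 : ‖m + s⁻¹ • d‖ ≤ 2 * ‖m‖ + 1 := by
          have h4 : ‖s⁻¹ • d‖ ≤ ‖m‖ + 1 := by
            rw [norm_smul, Real.norm_of_nonneg (by positivity), inv_mul_le_iff₀ hs]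
            exact hdn
          linarith [norm_add_le m (s⁻¹ • d)]
        have h5 : H (m + s⁻¹ • d) ≤ C * powBound q m := by
          refine (hgr _).trans (mul_le_mul_of_nonneg_left ?_ hC)
          unfold powBound
          have := Real.rpow_le_rpow (norm_nonneg _) h3 (by linarith : 0 ≤ q)
          linarith
        have h6 := mul_le_mul_of_nonneg_left h5 hs.le
        have h7 : (1 - s) * H m ≤ H m := mul_le_of_le_one_left (hH0 m) (by linarith)
        linarith
      rw [hslope]
      calc H (m + d) * (D / S) ≤ (H m + s * (C * powBound q m)) * D := by
            have h1 : D / S ≤ D := div_le_self hD.le hS1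
            exact mul_le_mul hHmd h1 (by positivity)
              (add_nonneg (hH0 m) (mul_nonneg hs.le (mul_nonneg hC (powBound_nonneg q m))))
        _ = D * H m + s * C * (D * powBound q m) := by ring
        _ ≤ _ := add_le_add hJ1 (mul_le_mul_of_nonneg_left hJ2 (mul_nonneg hs.le hC))
    have hsumI : ∀ G : ℝ → ℝ, IntegrableOn G (Ioc 0 1) →
        ∑ i ∈ Finset.range n, ∫ x in Ioc (T i) (T (i + 1)), G x = ∫ x in Ioc (0 : ℝ) 1, G x := by
      intro G hG
      have := intervalIntegral.sum_integral_adjacent_intervals (f := G) (μ := volume) (a := T)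
        (n := n) (fun k hk => (intervalIntegrable_iff_integrableOn_Ioc_of_le (hT k hk)).2
          (hG.mono_set (hsubI k hk)))
      rw [hT0, hT1, intervalIntegral.integral_of_le zero_le_one] at this
      rw [← this]
      refine Finset.sum_congr rfl fun i hi => ?_
      rw [intervalIntegral.integral_of_le (hT i (Finset.mem_range.1 hi))]
    have hnn : ∀ i ∈ Finset.range n, 0 ≤ ((∫ x in Ioc (T i) (T (i + 1)), H (g x)) + ρ i * H 0) +
          s * C * ((∫ x in Ioc (T i) (T (i + 1)), powBound q (g x)) + ρ i * powBound q 0) := by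
      intro i hi
      have hρi := (hρ i (Finset.mem_range.1 hi)).le
      refine add_nonneg (add_nonneg (integral_nonneg fun x => hH0 _) (mul_nonneg hρi (hH0 0)))
        (mul_nonneg (mul_nonneg hs.le hC) (add_nonneg (integral_nonneg fun x => powBound_nonneg q _)
          (mul_nonneg hρi (powBound_nonneg q 0))))
    calc energyOn (fun a => ENNReal.ofReal (H a)) u 0 1
        = ∑ i ∈ Finset.range n,
            energyOn (fun a => ENNReal.ofReal (H a)) u (σ i) (σ (i + 1)) := by
          rw [← energyOn_sum _ u σ n hσ, hσ0, hσn]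
      _ ≤ ∑ i ∈ Finset.range n, ENNReal.ofReal
            (((∫ x in Ioc (T i) (T (i + 1)), H (g x)) + ρ i * H 0) +
          s * C * ((∫ x in Ioc (T i) (T (i + 1)), powBound q (g x)) + ρ i * powBound q 0)) :=
          Finset.sum_le_sum fun i hi => hpiece i (Finset.mem_range.1 hi)
      _ = ENNReal.ofReal (∑ i ∈ Finset.range n,
            (((∫ x in Ioc (T i) (T (i + 1)), H (g x)) + ρ i * H 0) +
          s * C * ((∫ x in Ioc (T i) (T (i + 1)), powBound q (g x)) + ρ i * powBound q 0))) :=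
          (ENNReal.ofReal_sum_of_nonneg hnn).symm
      _ ≤ _ := by
          apply ENNReal.ofReal_le_ofReal
          rw [Finset.sum_add_distrib, Finset.sum_add_distrib, ← Finset.mul_sum,
            Finset.sum_add_distrib, hsumI _ hHg, hsumI _ hBg, ← Finset.sum_mul, ← Finset.sum_mul]
          have h1 : (∑ i ∈ Finset.range n, ρ i) * H 0 ≤ s * H 0 :=
            mul_le_mul_of_nonneg_right hρs (hH0 0)
          have h2 : (∑ i ∈ Finset.range n, ρ i) * powBound q 0 ≤ 1 * powBound q 0 :=
            mul_le_mul_of_nonneg_right (hρs.trans hs1) (powBound_nonneg q 0)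
          have h3 := mul_le_mul_of_nonneg_left
            (add_le_add (le_refl (∫ x in Ioc (0 : ℝ) 1, powBound q (g x))) h2)
            (mul_nonneg hs.le hC)
          linarith

theorem simplePolygon_one {P : ℕ → Plane} (h : P 0 ≠ P 1) : SimplePolygon P 1 where
  ne i hi := by obtain rfl : i = 0 := by omega
                exact h
  disj i hi j hj hij := by omega
  last i hi := by
    obtain rfl : i = 0 := by omega
    rintro ⟨t, ht, h'⟩
    have : t = 1 := AffineMap.lineMap_injective ℝ h (by rw [h', AffineMap.lineMap_apply_one])
    exact ht.2.ne this

/-- The parameters assigned to the vertices of a polygon with three segments between consecutive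
crossing parameters `τ j`. -/
def vertexTime (τ : ℕ → ℝ) (J i : ℕ) : ℝ :=
  if i = 0 then 0 else if i = 3 * J then 1 else τ ((i + 1) / 3)

/-- The extra duration of the segments: long for the first and last one, short for the others. -/
def extraTime (a b : ℝ) (J i : ℕ) : ℝ := if i = 0 ∨ i + 1 = 3 * J then a else b

theorem sum_extraTime_le {a b : ℝ} (ha : 0 ≤ a) (hb : 0 ≤ b) (J : ℕ) :
    ∑ i ∈ Finset.range (3 * J), extraTime a b J i ≤ 2 * a + 3 * J * b := by
  calc ∑ i ∈ Finset.range (3 * J), extraTime a b J i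
      ≤ ∑ i ∈ Finset.range (3 * J),
          ((if i = 0 then a else 0) + (if i = 3 * J - 1 then a else 0) + b) := by
        refine Finset.sum_le_sum fun i hi => ?_
        unfold extraTime
        split_ifs <;> first | linarith | (exfalso; omega)
    _ ≤ 2 * a + 3 * J * b := by
        rw [Finset.sum_add_distrib, Finset.sum_add_distrib, Finset.sum_ite_eq',
          Finset.sum_ite_eq', Finset.sum_const, Finset.card_range, nsmul_eq_mul]
        push_cast
        split_ifs <;> linarith

theorem norm_sub_sub_sub_le_dist {a b c d : Plane} : ‖(a - b) - (c - d)‖ ≤ dist a c + dist b d := by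
  rw [dist_eq_norm, dist_eq_norm, sub_sub_sub_comm]
  exact norm_sub_le _ _

section
variable {z : ℝ → Plane} {τ : ℕ → ℝ} {J : ℕ} {δ : ℝ}

theorem vertexTime_zero : vertexTime τ J 0 = 0 := if_pos rfl

theorem vertexTime_last (hJ : 1 ≤ J) : vertexTime τ J (3 * J) = 1 := by
  rw [vertexTime, if_neg (by omega), if_pos rfl]

/-- The vertices 3j - 1, 3j and 3j + 1 all lie near the crossing point of τ j and share that time,
whence the index (i + 1) / 3. Time on the scale of y passes only on the chords and, at both ends, on
the first and last stub. -/
theorem vertexTime_mid {i : ℕ} (h0 : i ≠ 0) (hi : i ≠ 3 * J) :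
    vertexTime τ J i = τ ((i + 1) / 3) := by
  rw [vertexTime, if_neg h0, if_neg hi]

theorem vertexTime_le (hτ : ∀ j < J, τ j < τ (j + 1)) (hτI : ∀ j ≤ J, τ j ∈ Icc (0 : ℝ) 1) {i : ℕ}
    (hi : i < 3 * J) : vertexTime τ J i ≤ vertexTime τ J (i + 1) := by
  by_cases h0 : i = 0
  · subst h0
    rw [vertexTime_zero, vertexTime_mid (by omega) (by omega)]
    exact (hτI _ (by omega)).1
  rw [vertexTime_mid h0 hi.ne]
  by_cases h1 : i + 1 = 3 * J
  · rw [h1, vertexTime_last (by omega)]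
    exact (hτI _ (by omega)).2
  rw [vertexTime_mid (by omega) h1]
  rcases (by omega : (i + 1 + 1) / 3 = (i + 1) / 3 ∨ (i + 1 + 1) / 3 = (i + 1) / 3 + 1) with h | h
  · rw [h]
  · rw [h]; exact (hτ _ (by omega)).le

theorem dist_vertexTime_le (hδ : 0 ≤ δ) (hτ : ∀ j < J, τ j < τ (j + 1))
    (h0 : ∀ t ∈ Icc 0 (τ 0), dist (z t) (z (τ 0)) ≤ δ)
    (h1 : ∀ t ∈ Icc (τ J) 1, dist (z t) (z (τ J)) ≤ δ)
    (hm : ∀ j < J, ∀ s ∈ Icc (τ j) (τ (j + 1)), ∀ t ∈ Icc (τ j) (τ (j + 1)), dist (z s) (z t) ≤ δ)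
    {i : ℕ} (hi : i < 3 * J) {t : ℝ} (ht : t ∈ Icc (vertexTime τ J i) (vertexTime τ J (i + 1))) :
    dist (z t) (z (τ ((i + 1) / 3))) ≤ δ ∧ dist (z t) (z (τ ((i + 1 + 1) / 3))) ≤ δ := by
  by_cases hi0 : i = 0
  · subst hi0
    rw [vertexTime_zero, vertexTime_mid (by omega) (by omega)] at ht
    exact ⟨h0 t ht, h0 t ht⟩
  rw [vertexTime_mid hi0 hi.ne] at ht
  by_cases hi1 : i + 1 = 3 * J
  · rw [hi1, vertexTime_last (by omega)] at ht
    rw [show (i + 1 + 1) / 3 = J by omega]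
    rw [show (i + 1) / 3 = J by omega]
    rw [show 3 * J / 3 = J by omega] at ht
    exact ⟨h1 t ht, h1 t ht⟩
  rw [vertexTime_mid (by omega) hi1] at ht
  rcases (by omega : (i + 1 + 1) / 3 = (i + 1) / 3 ∨ (i + 1 + 1) / 3 = (i + 1) / 3 + 1) with h | h
  · rw [h] at ht ⊢
    rw [le_antisymm ht.2 ht.1, dist_self]
    exact ⟨hδ, hδ⟩
  · rw [h] at ht ⊢
    have hlt := hτ ((i + 1) / 3) (by omega)
    exact ⟨hm _ (by omega) t ht _ (left_mem_Icc.2 hlt.le),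
      hm _ (by omega) t ht _ (right_mem_Icc.2 hlt.le)⟩

end

/-- A map that is uniformly approximated by arcs of bounded length can be approximated by injective
piecewise affine maps with almost no more energy. -/
theorem exists_PA_approx {H : Plane → ℝ} (hH : ConvexOn ℝ univ H) (hHc : Continuous H)
    (hH0 : ∀ a, 0 ≤ H a) {C q : ℝ} (hC : 0 ≤ C) (hq : 1 ≤ q)
    (hgr : ∀ a, H a ≤ C * (1 + ‖a‖ ^ q)) {y g : ℝ → Plane} (hg : IntegrableOn g (Ioc 0 1))
    (hHg : IntegrableOn (fun x => H (g x)) (Ioc 0 1))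
    (hBg : IntegrableOn (fun x => powBound q (g x)) (Ioc 0 1))
    (hy : ∀ a b, 0 ≤ a → a ≤ b → b ≤ 1 → y b - y a = ∫ x in Ioc a b, g x)
    (hyc : ContinuousOn y (Icc 0 1)) {L R : ℝ}
    (harc : ∀ ε : ℝ, 0 < ε → ∃ (z : ℝ → Plane) (V : ℝ → ℝ), ContinuousOn z (Icc 0 1) ∧
      InjOn z (Icc 0 1) ∧ (∀ t ∈ Icc (0 : ℝ) 1, ‖z t‖ ≤ R) ∧
      (∀ s ∈ Icc (0 : ℝ) 1, ∀ t ∈ Icc (0 : ℝ) 1, s ≤ t → dist (z t) (z s) ≤ V t - V s) ∧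
      V 1 - V 0 ≤ L ∧ ∀ t ∈ Icc (0 : ℝ) 1, dist (z t) (y t) ≤ ε)
    {ε : ℝ} (hε : 0 < ε) :
    ∃ u, PAff u 0 1 ∧ InjOn u (Icc 0 1) ∧ (∀ x ∈ Icc (0 : ℝ) 1, dist (u x) (y x) ≤ ε) ∧
      energyOn (fun a => ENNReal.ofReal (H a)) u 0 1 ≤
        ENNReal.ofReal ((∫ x in Ioc (0 : ℝ) 1, H (g x)) + ε) := by
  set K := H 0 + C * ((∫ x in Ioc (0 : ℝ) 1, powBound q (g x)) + powBound q 0) with hK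
  have hK0 : 0 ≤ K := add_nonneg (hH0 0) (mul_nonneg hC (add_nonneg
    (integral_nonneg fun x => powBound_nonneg q _) (powBound_nonneg q 0)))
  obtain ⟨ω, hω, hmod⟩ := Metric.uniformContinuousOn_iff.1
    (isCompact_Icc.uniformContinuousOn_of_continuous hyc) (ε / 2) (half_pos hε)
  -- The order of choices matters: s controls the time shift and the energy error, δ depends on s, M
  -- on δ, and only then is the distance ν of arc and map chosen, depending on M.
  obtain ⟨s, hs, hs1, hsω, hsK⟩ : ∃ s : ℝ, 0 < s ∧ s ≤ 1 ∧ s < ω ∧ s * K ≤ ε := by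
    refine ⟨min 1 (min (ω / 2) (ε / (K + 1))), by positivity, min_le_left _ _, ?_, ?_⟩
    · exact ((min_le_right _ _).trans (min_le_left _ _)).trans_lt (by linarith)
    · calc _ ≤ ε / (K + 1) * K := mul_le_mul_of_nonneg_right
            ((min_le_right _ _).trans (min_le_right _ _)) hK0
        _ ≤ ε / (K + 1) * (K + 1) := by gcongr; linarith
        _ = ε := by field_simp
  -- The first and last segments get extra time s/4, and the tolerated error is s/2 times that;
  -- their actual error is at most 2(3δ + 2ν) ≤ 10δ.
  obtain ⟨δ, hδ, hδs, hδε⟩ : ∃ δ : ℝ, 0 < δ ∧ 10 * δ ≤ s / 2 * (s / 4) ∧ 8 * δ ≤ ε / 2 := by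
    refine ⟨min (s ^ 2 / 80) (ε / 16), by positivity, ?_, ?_⟩
    · have := min_le_left (s ^ 2 / 80) (ε / 16)
      nlinarith
    · have := min_le_right (s ^ 2 / 80) (ε / 16)
      linarith
  obtain ⟨M, hM⟩ := exists_grid_polygon L R hδ
  -- With at most 3M segments this extra time adds up to at most s/4; the two long ones add s/2.
  set ρ₀ := s / (12 * (M + 1)) with hρ₀
  have hρ₀pos : 0 < ρ₀ := by positivity
  -- An inner segment has error at most 4ν: at each of its two ends, ν from polygon to arc and ν
  -- from arc to y.
  obtain ⟨ν, hν, hνρ, hνδ⟩ : ∃ ν : ℝ, 0 < ν ∧ 4 * ν ≤ s / 2 * ρ₀ ∧ ν ≤ δ := by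
    refine ⟨min (s / 2 * ρ₀ / 4) δ, by positivity, ?_, min_le_right _ _⟩
    have := min_le_left (s / 2 * ρ₀ / 4) δ
    linarith
  obtain ⟨z, V, hzc, hzi, hzR, hzV, hVL, hzy⟩ := harc ν hν
  have key : ∀ {n : ℕ}, 0 < n → ∀ {T ρ : ℕ → ℝ} {P : ℕ → Plane}, T 0 = 0 → T n = 1 →
      (∀ i < n, T i ≤ T (i + 1)) → (∀ i < n, 0 < ρ i) → ∑ i ∈ Finset.range n, ρ i ≤ s →
      SimplePolygon P n →
      (∀ i < n, ‖(P (i + 1) - P i) - (y (T (i + 1)) - y (T i))‖ ≤ s / 2 * ρ i) →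
      (∀ i < n, ∀ t ∈ Icc (T i) (T (i + 1)), dist (P i) (y t) ≤ 8 * δ ∧
        dist (P (i + 1)) (y t) ≤ 8 * δ) →
      ∃ u, PAff u 0 1 ∧ InjOn u (Icc 0 1) ∧ (∀ x ∈ Icc (0 : ℝ) 1, dist (u x) (y x) ≤ ε) ∧
      energyOn (fun a => ENNReal.ofReal (H a)) u 0 1 ≤
        ENNReal.ofReal ((∫ x in Ioc (0 : ℝ) 1, H (g x)) + ε) := by
    intro n hn T ρ P hT0 hT1 hT hρ hρs hP herr hr
    obtain ⟨u, h1, h2, h3, h4⟩ := exists_reparametrization hH hHc hH0 hC hq hgr hg hHg hBg hy hn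
      hT0 hT1 hT hρ hs hs1 hρs (by linarith) hP herr hr
    refine ⟨u, h1, h2, fun x hx => ?_, h4.trans (ENNReal.ofReal_le_ofReal (by linarith))⟩
    obtain ⟨t, ht, hxt, hut⟩ := h3 x hx
    have := hmod t ht x hx (by rw [dist_comm, Real.dist_eq]; exact hxt.trans_lt hsω)
    linarith [dist_triangle (u x) (y t) (y x)]
  have h0I : (0 : ℝ) ∈ Icc (0 : ℝ) 1 := left_mem_Icc.2 zero_le_one
  have h1I : (1 : ℝ) ∈ Icc (0 : ℝ) 1 := right_mem_Icc.2 zero_le_one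
  rcases hM z V hzc hzi hzR hzV hVL ν hν with hsmall |
    ⟨J, hJ, hJM, τ, P, hτ, hτI, hP, hP0, hP12, hmid, hfst, hlst⟩
  -- An arc of small diameter is replaced by a single segment of length δ, traversed over the whole
  -- time interval.
  · set e : Plane := EuclideanSpace.single 0 1 with he
    have hen : ‖e‖ = 1 := by simp [he]
    have hPd : ∀ i : ℕ, i ≤ 1 → dist (z 0 + ((i : ℝ) * δ) • e) (z 0) ≤ δ := by
      intro i hi
      rw [dist_self_add_left, norm_smul, hen, mul_one, Real.norm_of_nonneg (by positivity)]
      exact mul_le_of_le_one_left hδ.le (by exact_mod_cast hi)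
    have hr : ∀ i : ℕ, i ≤ 1 → ∀ t ∈ Icc (0 : ℝ) 1, dist (z 0 + ((i : ℝ) * δ) • e) (y t) ≤ 8 * δ := by
      intro i hi t ht
      have a1 := hPd i hi
      have a2 := hsmall 0 h0I t ht
      have a3 := hzy t ht
      linarith [dist_triangle4 (z 0 + ((i : ℝ) * δ) • e) (z 0) (z t) (y t)]
    refine key (n := 1) one_pos (T := fun i => (i : ℝ)) (ρ := fun _ => s / 4)
      (P := fun i => z 0 + ((i : ℝ) * δ) • e) (by simp) (by simp) (fun i _ => by simp)
      (fun _ _ => by positivity) (by simp; linarith) (simplePolygon_one ?_) ?_ ?_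
    · intro h
      have : (δ : ℝ) • e = 0 := by simpa using h
      rw [smul_eq_zero] at this
      rcases this with h | h
      · exact hδ.ne' h
      · rw [h, norm_zero] at hen; exact zero_ne_one hen
    · intro i hi
      obtain rfl : i = 0 := by omega
      have a1 : ‖(δ : ℝ) • e‖ = δ := by rw [norm_smul, hen, mul_one, Real.norm_of_nonneg hδ.le]
      have a2 : dist (y 1) (y 0) ≤ 8 * δ := by
        have := dist_triangle4 (y 1) (z 1) (z 0) (y 0)
        have b1 := hzy 1 h1I
        have b2 := hzy 0 h0I
        have b3 := hsmall 1 h1I 0 h0I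
        rw [dist_comm] at b1
        linarith
      rw [dist_eq_norm] at a2
      have := norm_sub_le ((δ : ℝ) • e) (y 1 - y 0)
      simp only [zero_add, Nat.cast_one, one_mul, Nat.cast_zero, zero_mul, zero_smul, add_zero,
        add_sub_cancel_left]
      linarith
    · intro i hi t ht
      obtain rfl : i = 0 := by omega
      have ht' : t ∈ Icc (0 : ℝ) 1 := by simpa using ht
      exact ⟨hr 0 (by omega) t ht', hr 1 le_rfl t ht'⟩
  · have hT : ∀ i < 3 * J, vertexTime τ J i ≤ vertexTime τ J (i + 1) := fun i hi =>
      vertexTime_le hτ hτI hi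
    have hTI : ∀ i ≤ 3 * J, vertexTime τ J i ∈ Icc (0 : ℝ) 1 := by
      intro i hi
      by_cases h0 : i = 0
      · rw [h0, vertexTime_zero]; exact h0I
      by_cases h1 : i = 3 * J
      · rw [h1, vertexTime_last hJ]; exact h1I
      rw [vertexTime_mid h0 h1]
      exact hτI _ (by omega)
    have hPz : ∀ i ≤ 3 * J, dist (P i) (z (τ ((i + 1) / 3))) ≤ ν := by
      intro i hi
      obtain ⟨j, hj⟩ : ∃ j, i = 3 * j ∨ i = 3 * j + 1 ∨ i = 3 * j + 2 := ⟨i / 3, by omega⟩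
      rcases hj with rfl | rfl | rfl
      · rw [show (3 * j + 1) / 3 = j by omega, hP0 j (by omega), dist_self]; exact hν.le
      · rw [show (3 * j + 1 + 1) / 3 = j by omega]; exact (hP12 j (by omega)).1.le
      · rw [show (3 * j + 2 + 1) / 3 = j + 1 by omega]; exact (hP12 j (by omega)).2.le
    have hz3 : ∀ i < 3 * J, ∀ t ∈ Icc (vertexTime τ J i) (vertexTime τ J (i + 1)),
        dist (z t) (z (τ ((i + 1) / 3))) ≤ 3 * δ ∧ dist (z t) (z (τ ((i + 1 + 1) / 3))) ≤ 3 * δ :=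
      fun i hi t ht => dist_vertexTime_le (by linarith) hτ hfst hlst hmid hi ht
    have hr : ∀ i < 3 * J, ∀ t ∈ Icc (vertexTime τ J i) (vertexTime τ J (i + 1)),
        dist (P i) (y t) ≤ 3 * δ + 2 * ν ∧ dist (P (i + 1)) (y t) ≤ 3 * δ + 2 * ν := by
      intro i hi t ht
      have htI : t ∈ Icc (0 : ℝ) 1 := ⟨(hTI i hi.le).1.trans ht.1, ht.2.trans (hTI (i + 1) hi).2⟩
      have a1 := hzy t htI
      obtain ⟨a2, a3⟩ := hz3 i hi t ht
      rw [dist_comm] at a2 a3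
      have a4 := hPz i hi.le
      have a5 := hPz (i + 1) hi
      constructor
      · linarith [dist_triangle4 (P i) (z (τ ((i + 1) / 3))) (z t) (y t)]
      · linarith [dist_triangle4 (P (i + 1)) (z (τ ((i + 1 + 1) / 3))) (z t) (y t)]
    refine key (n := 3 * J) (by omega) (T := vertexTime τ J) (ρ := extraTime (s / 4) ρ₀ J) (P := P)
      vertexTime_zero (vertexTime_last hJ) hT (fun i _ => ?_) ?_ hP ?_ fun i hi t ht => ?_
    · unfold extraTime; split_ifs <;> positivity
    · refine (sum_extraTime_le (by positivity) hρ₀pos.le J).trans ?_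
      have hJM' : (J : ℝ) ≤ M := by exact_mod_cast hJM
      have : 3 * (J : ℝ) * ρ₀ ≤ s / 4 := by
        calc 3 * (J : ℝ) * ρ₀ ≤ 3 * (M + 1) * ρ₀ := by gcongr; linarith
          _ = s / 4 := by rw [hρ₀]; field_simp; norm_num
      linarith
    · intro i hi
      refine norm_sub_sub_sub_le_dist.trans ?_
      by_cases hi' : i = 0 ∨ i + 1 = 3 * J
      · have hl := (hr i hi _ (left_mem_Icc.2 (hT i hi))).1
        have hr' := (hr i hi _ (right_mem_Icc.2 (hT i hi))).2
        rw [extraTime, if_pos hi']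
        linarith
      · rw [not_or] at hi'
        rw [extraTime, if_neg (by tauto), vertexTime_mid (by omega) hi'.2,
          vertexTime_mid hi'.1 hi.ne]
        have a1 := hPz i hi.le
        have a2 := hPz (i + 1) hi
        have a3 := hzy _ (hτI ((i + 1) / 3) (by omega))
        have a4 := hzy _ (hτI ((i + 1 + 1) / 3) (by omega))
        have a5 := dist_triangle (P i) (z (τ ((i + 1) / 3))) (y (τ ((i + 1) / 3)))
        have a6 := dist_triangle (P (i + 1)) (z (τ ((i + 1 + 1) / 3))) (y (τ ((i + 1 + 1) / 3)))
        linarith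
    · obtain ⟨a1, a2⟩ := hr i hi t ht
      exact ⟨by linarith, by linarith⟩

/-! ### Weak derivatives on the interval and absolutely continuous representatives -/

/-- The primitive of `g` on `(0,1)` that vanishes at `0`. -/
def prim (g : ℝ → Plane) (x : ℝ) : Plane := ∫ t in (0 : ℝ)..x, g t ∂unitVol

section
variable {g : ℝ → Plane}

theorem continuous_prim (hg : Integrable g unitVol) : Continuous (prim g) :=
  intervalIntegral.continuous_primitive (fun _ _ => hg.intervalIntegrable) 0

theorem prim_sub (hg : Integrable g unitVol) {a b : ℝ} (hab : a ≤ b) :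
    prim g b - prim g a = ∫ t in Ioc a b, g t ∂unitVol := by
  rw [prim, prim, intervalIntegral.integral_interval_sub_left hg.intervalIntegrable
    hg.intervalIntegrable, intervalIntegral.integral_of_le hab]

theorem unitVol_restrict_Ioc {a b : ℝ} (ha : 0 ≤ a) (hb : b ≤ 1) :
    unitVol.restrict (Ioc a b) = volume.restrict (Ioc a b) := by
  rw [unitVol, Measure.restrict_congr_set Ioo_ae_eq_Ioc, Measure.restrict_restrict
    measurableSet_Ioc, inter_eq_left.2 (Ioc_subset_Ioc ha hb)]

theorem unitVol_eq : unitVol = volume.restrict (Ioc (0 : ℝ) 1) :=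
  Measure.restrict_congr_set Ioo_ae_eq_Ioc

instance : IsProbabilityMeasure unitVol := ⟨by simp [unitVol]⟩

theorem IsTestFun.eq_zero {φ : ℝ → ℝ} (hφ : IsTestFun φ) {x : ℝ} (hx : x ∉ Ioo (0 : ℝ) 1) :
    φ x = 0 := image_eq_zero_of_notMem_tsupport fun h => hx (hφ.support h)

theorem setIntegral_Ici_deriv {φ : ℝ → ℝ} (hφ : IsTestFun φ) {t : ℝ} (ht : t ∈ Ioo (0 : ℝ) 1) :
    ∫ x in Ici t, deriv φ x ∂unitVol = -φ t := by
  have h1 : Ici t ∩ Ioc 0 1 = Icc t 1 := by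
    ext x; simp only [mem_inter_iff, mem_Ici, mem_Ioc, mem_Icc]
    exact ⟨fun h => ⟨h.1, h.2.2⟩, fun h => ⟨h.1, ht.1.trans_le h.1, h.2⟩⟩
  rw [unitVol_eq, Measure.restrict_restrict measurableSet_Ici, h1, integral_Icc_eq_integral_Ioc,
    ← intervalIntegral.integral_of_le ht.2.le,
    intervalIntegral.integral_deriv_eq_sub
      (fun x _ => (hφ.smooth.differentiable (by simp)).differentiableAt)
      (hφ.continuous_deriv.intervalIntegrable _ _), hφ.eq_zero (x := 1) (by simp), zero_sub]

theorem prim_eq_setIntegral_Iic {x : ℝ} (hx : 0 ≤ x) :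
    prim g x = ∫ t in Iic x, g t ∂unitVol := by
  rw [prim, intervalIntegral.integral_of_le hx]
  refine setIntegral_congr_set ?_
  have : ∀ᵐ t ∂unitVol, t ∈ Ioo (0 : ℝ) 1 := ae_restrict_mem measurableSet_Ioo
  filter_upwards [this] with t ht
  exact propext ⟨fun h => h.2, fun h => ⟨ht.1, h⟩⟩

theorem isWeakDeriv_prim (hg : Integrable g unitVol) : IsWeakDeriv (prim g) g := by
  intro φ hφ
  obtain ⟨C, hC⟩ := hφ.bdd_deriv
  have hφ' : Integrable (deriv φ) unitVol :=
    Integrable.of_bound hφ.continuous_deriv.aestronglyMeasurable C (ae_of_all _ hC)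
  -- Fubini on the triangle t ≤ x: integrating the derivative of φ over [t,1] gives -φ t.
  set F : ℝ → ℝ → Plane := fun x t => {z : ℝ × ℝ | z.2 ≤ z.1}.indicator
    (fun z => deriv φ z.1 • g z.2) (x, t) with hF
  have hFi : Integrable (Function.uncurry F) (unitVol.prod unitVol) :=
    (hφ'.smul_prod hg).indicator (measurableSet_le measurable_snd measurable_fst)
  have hsw := integral_integral_swap hFi
  have e1 : ∀ x, ∫ t, F x t ∂unitVol = deriv φ x • ∫ t in Iic x, g t ∂unitVol := by
    intro x
    rw [← integral_smul, ← integral_indicator measurableSet_Iic]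
    rfl
  have e2 : ∀ t, ∫ x, F x t ∂unitVol = (∫ x in Ici t, deriv φ x ∂unitVol) • g t := by
    intro t
    rw [← integral_smul_const, ← integral_indicator measurableSet_Ici]
    rfl
  simp only [e1, e2] at hsw
  have h0 : ∀ᵐ t ∂unitVol, t ∈ Ioo (0 : ℝ) 1 := ae_restrict_mem measurableSet_Ioo
  rw [← integral_neg]
  calc ∫ x, deriv φ x • prim g x ∂unitVol
      = ∫ x, deriv φ x • ∫ t in Iic x, g t ∂unitVol ∂unitVol := by
        refine integral_congr_ae (h0.mono fun x hx => ?_)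
        simp only [prim_eq_setIntegral_Iic hx.1.le]
    _ = ∫ t, (∫ x in Ici t, deriv φ x ∂unitVol) • g t ∂unitVol := hsw
    _ = ∫ t, -(φ t • g t) ∂unitVol := by
        refine integral_congr_ae (h0.mono fun t ht => ?_)
        simp only [setIntegral_Ici_deriv hφ ht, neg_smul]

end

/-- A function on `(0,1)` that integrates to zero against all test functions vanishes. -/
theorem ae_eq_zero_of_testFun {u : ℝ → Plane} (hu : Integrable u unitVol)
    (h : ∀ φ, IsTestFun φ → ∫ x, φ x • u x ∂unitVol = 0) : u =ᵐ[unitVol] 0 := by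
  have := isOpen_Ioo.ae_eq_zero_of_integral_contDiff_smul_eq_zero (μ := volume) (f := u)
    (U := Ioo (0 : ℝ) 1) (IntegrableOn.locallyIntegrableOn hu) fun φ h1 h2 h3 => by
      rw [← h φ ⟨h1, h2, h3⟩]
      refine (setIntegral_eq_integral_of_forall_compl_eq_zero fun x hx => ?_).symm
      rw [image_eq_zero_of_notMem_tsupport fun h => hx (h3 h), zero_smul]
  exact (ae_restrict_iff' measurableSet_Ioo).2 this

theorem IsWeakDeriv.unique {u g h : ℝ → Plane} (hg : Integrable g unitVol)
    (hh : Integrable h unitVol) (H : IsWeakDeriv u g) (K : IsWeakDeriv u h) : g =ᵐ[unitVol] h := by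
  have := ae_eq_zero_of_testFun (hg.sub hh) fun φ hφ => by
    simp only [Pi.sub_apply, smul_sub]
    rw [integral_sub (hφ.integrable_smul hg) (hφ.integrable_smul hh), sub_eq_zero]
    exact neg_injective ((H φ hφ).symm.trans (K φ hφ))
  filter_upwards [this] with x hx
  exact sub_eq_zero.1 hx

theorem exists_testFun_integral_one : ∃ η, IsTestFun η ∧ ∫ x, η x ∂unitVol = 1 := by
  let b : ContDiffBump (1 / 2 : ℝ) := ⟨1 / 8, 1 / 4, by norm_num, by norm_num⟩
  have hsupp : tsupport (b.normed volume) ⊆ Ioo (0 : ℝ) 1 := by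
    rw [b.tsupport_normed_eq, Real.closedBall_eq_Icc]
    intro x hx
    have h1 := hx.1
    have h2 := hx.2
    simp only [b] at h1 h2
    constructor <;> linarith
  refine ⟨b.normed volume, ⟨b.contDiff_normed, b.hasCompactSupport_normed, hsupp⟩, ?_⟩
  rw [setIntegral_eq_integral_of_forall_compl_eq_zero fun x hx =>
    image_eq_zero_of_notMem_tsupport fun h => hx (hsupp h)]
  exact b.integral_normed

/-- The primitive from 0 vanishes to the left of the support of χ, and to the right of it because
the total integral is zero. -/
theorem exists_testFun_deriv_eq {χ : ℝ → ℝ} (hχ : IsTestFun χ) (h0 : ∫ x, χ x ∂unitVol = 0) :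
    ∃ φ, IsTestFun φ ∧ deriv φ = χ := by
  set φ : ℝ → ℝ := fun x => ∫ t in (0 : ℝ)..x, χ t with hφ
  have hc := hχ.smooth.continuous
  have hd : ∀ x, HasDerivAt φ (χ x) x := fun x =>
    intervalIntegral.integral_hasDerivAt_right (hc.intervalIntegrable _ _)
      (hc.stronglyMeasurableAtFilter _ _) hc.continuousAt
  have hderiv : deriv φ = χ := funext fun x => (hd x).deriv
  obtain ⟨a, b, ha, hb, hab⟩ : ∃ a b : ℝ, 0 < a ∧ b < 1 ∧ tsupport χ ⊆ Icc a b := by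
    rcases (tsupport χ).eq_empty_or_nonempty with h | h
    · exact ⟨1 / 2, 1 / 2, by norm_num, by norm_num, by rw [h]; exact empty_subset _⟩
    · have hK : IsCompact (tsupport χ) := hχ.compact
      obtain ⟨a, ha, ha'⟩ := hK.exists_isLeast h
      obtain ⟨b, hb, hb'⟩ := hK.exists_isGreatest h
      exact ⟨a, b, (hχ.support ha).1, (hχ.support hb).2, fun x hx => ⟨ha' hx, hb' hx⟩⟩
  have hz : ∀ x, x ∉ Icc a b → χ x = 0 := fun x hx =>
    image_eq_zero_of_notMem_tsupport fun h => hx (hab h)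
  have htot : φ 1 = 0 := by
    rw [← h0, unitVol_eq]
    exact intervalIntegral.integral_of_le zero_le_one
  have hsupp : Function.support φ ⊆ Icc a b := by
    intro x hx
    by_contra hn
    apply hx
    rcases lt_or_ge x a with h | h
    · change ∫ t in (0 : ℝ)..x, χ t = 0
      rw [intervalIntegral.integral_zero_ae]
      refine ae_of_all _ fun t ht => hz t fun h' => ?_
      have := ht.2
      have h4 := h'.1
      rw [le_max_iff] at this
      rcases this with h5 | h5 <;> linarith
    · have hbx : b < x := by
        by_contra hh
        exact hn ⟨h, not_lt.1 hh⟩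
      have h2 : ∫ t in x..(1 : ℝ), χ t = 0 := by
        rw [intervalIntegral.integral_zero_ae]
        refine ae_of_all _ fun t ht => hz t fun h' => ?_
        have := ht.1
        have h4 := h'.2
        rw [min_lt_iff] at this
        rcases this with h5 | h5 <;> linarith
      have h3 := intervalIntegral.integral_add_adjacent_intervals
        (hc.intervalIntegrable (μ := volume) 0 x) (hc.intervalIntegrable (μ := volume) x 1)
      rw [h2, add_zero] at h3
      exact h3.trans htot
  have htsupp : tsupport φ ⊆ Icc a b := closure_minimal hsupp isClosed_Icc
  refine ⟨φ, ⟨?_, HasCompactSupport.of_support_subset_isCompact isCompact_Icc hsupp,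
    htsupp.trans fun x hx => ⟨ha.trans_le hx.1, hx.2.trans_lt hb⟩⟩, hderiv⟩
  refine contDiff_infty_iff_deriv.2 ⟨fun x => (hd x).differentiableAt, ?_⟩
  rw [hderiv]
  exact hχ.smooth

theorem IsTestFun.sub_smul {φ η : ℝ → ℝ} (hφ : IsTestFun φ) (hη : IsTestFun η) (m : ℝ) :
    IsTestFun fun x => φ x - m * η x := by
  have hK : IsCompact (tsupport φ ∪ tsupport η) :=
    IsCompact.union hφ.compact hη.compact
  have hsupp : Function.support (fun x => φ x - m * η x) ⊆ tsupport φ ∪ tsupport η := by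
    intro x hx
    by_contra h
    rw [mem_union, not_or] at h
    apply hx
    simp only [image_eq_zero_of_notMem_tsupport h.1, image_eq_zero_of_notMem_tsupport h.2,
      mul_zero, sub_zero]
  exact ⟨hφ.smooth.sub (contDiff_const.mul hη.smooth),
    HasCompactSupport.of_support_subset_isCompact hK hsupp,
    (closure_minimal hsupp hK.isClosed).trans (union_subset hφ.support hη.support)⟩

/-- The lemma of du Bois-Reymond. -/
theorem IsWeakDeriv.exists_eq_const {v : ℝ → Plane} (hv : Integrable v unitVol)
    (h : IsWeakDeriv v 0) : ∃ c, v =ᵐ[unitVol] fun _ => c := by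
  obtain ⟨η, hη, hη1⟩ := exists_testFun_integral_one
  refine ⟨∫ x, η x • v x ∂unitVol, ?_⟩
  set c := ∫ x, η x • v x ∂unitVol with hc
  -- Subtracting from ψ its mean times η gives a test function of mean zero, hence a derivative,
  -- against which v integrates to 0.
  have := ae_eq_zero_of_testFun (hv.sub (integrable_const c)) fun ψ hψ => by
    have hint : ∀ {φ : ℝ → ℝ}, IsTestFun φ → Integrable φ unitVol := fun {φ} hφ => by
      obtain ⟨C, hC⟩ := hφ.bdd
      exact Integrable.of_bound hφ.smooth.continuous.aestronglyMeasurable C (ae_of_all _ hC)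
    set m := ∫ x, ψ x ∂unitVol with hm
    have hχ := hψ.sub_smul hη m
    obtain ⟨φ, hφ, hφd⟩ := exists_testFun_deriv_eq hχ (by
      rw [integral_sub (hint hψ) ((hint hη).const_mul m), integral_const_mul, hη1, mul_one, sub_self])
    have h1 := h φ hφ
    simp only [hφd, sub_smul, mul_smul, Pi.zero_apply, smul_zero, integral_zero, neg_zero] at h1
    have hs : Integrable (fun x => m • η x • v x) unitVol := (hη.integrable_smul hv).smul m
    rw [integral_sub (hψ.integrable_smul hv) hs, integral_smul,
      ← hc, sub_eq_zero] at h1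
    simp only [Pi.sub_apply, smul_sub]
    rw [integral_sub (hψ.integrable_smul hv) ((hint hψ).smul_const c), integral_smul_const, h1,
      sub_self]
  filter_upwards [this] with x hx
  exact sub_eq_zero.1 hx

theorem IsWeakDeriv.exists_eq_prim {u g : ℝ → Plane} (hu : Integrable u unitVol)
    (hg : Integrable g unitVol) (h : IsWeakDeriv u g) :
    ∃ c, u =ᵐ[unitVol] fun x => c + prim g x := by
  have hp : Integrable (prim g) unitVol :=
    ((continuous_prim hg).integrableOn_Icc (a := 0) (b := 1)).mono_set Ioo_subset_Icc_self
  have h1 := h.add hu hp.neg hg hg.neg (by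
    have := (isWeakDeriv_prim hg).smul (-1)
    simpa only [neg_smul, one_smul] using this)
  rw [add_neg_cancel] at h1
  obtain ⟨c, hc⟩ := h1.exists_eq_const (hu.add hp.neg)
  refine ⟨c, ?_⟩
  filter_upwards [hc] with x hx
  rw [← hx, Pi.add_apply, Pi.neg_apply, neg_add_cancel_right]

namespace PAff
variable {u : ℝ → Plane} {a b : ℝ}

theorem exists_bound_deriv (h : PAff u a b) :
    ∃ C : ℝ, ∀ᵐ x ∂volume.restrict (Ioc a b), ‖deriv u x‖ ≤ C := by
  induction h with
  | @seg a b B hab hB =>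
    refine ⟨‖B‖, ?_⟩
    rw [← Measure.restrict_congr_set Ioo_ae_eq_Ioc]
    exact (ae_restrict_mem measurableSet_Ioo).mono fun x hx => by rw [hB.deriv hx]
  | trans h1 h2 i1 i2 =>
    obtain ⟨C, hC⟩ := i1
    obtain ⟨D, hD⟩ := i2
    refine ⟨max C D, ?_⟩
    rw [← Ioc_union_Ioc_eq_Ioc h1.lt.le h2.lt.le, ae_restrict_union_iff]
    exact ⟨hC.mono fun x hx => hx.trans (le_max_left _ _),
      hD.mono fun x hx => hx.trans (le_max_right _ _)⟩

theorem integrableOn_deriv (h : PAff u a b) : IntegrableOn (deriv u) (Ioc a b) := by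
  obtain ⟨C, hC⟩ := h.exists_bound_deriv
  exact Integrable.of_bound (aestronglyMeasurable_deriv u _) C hC

theorem sub_eq_integral (h : PAff u a b) : u b - u a = ∫ x in Ioc a b, deriv u x := by
  induction h with
  | @seg a b B hab hB =>
    rw [integral_Ioc_eq_integral_Ioo, setIntegral_congr_fun measurableSet_Ioo
      (g := fun _ => B) (fun x hx => hB.deriv hx), setIntegral_const, Measure.real,
      Real.volume_Ioo, ENNReal.toReal_ofReal (by linarith), hB b (right_mem_Icc.2 hab.le),
      add_sub_cancel_left]
  | @trans a m b h1 h2 i1 i2 =>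
    rw [← Ioc_union_Ioc_eq_Ioc h1.lt.le h2.lt.le, setIntegral_union (Ioc_disjoint_Ioc_of_le le_rfl)
      measurableSet_Ioc h1.integrableOn_deriv h2.integrableOn_deriv, ← i1, ← i2]
    abel

theorem exists_nodes (h : PAff u a b) : ∃ (n : ℕ) (t : ℕ → ℝ), t 0 = a ∧ t n = b ∧
    ∀ i < n, t i < t (i + 1) ∧ ∃ B, AffOn u (t i) (t (i + 1)) B := by
  induction h with
  | @seg a b B hab hB =>
    refine ⟨1, fun i => if i = 0 then a else b, by simp, by simp, fun i hi => ?_⟩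
    obtain rfl : i = 0 := by omega
    simpa using ⟨hab, B, hB⟩
  | @trans a m b h1 h2 i1 i2 =>
    obtain ⟨k, s, hs0, hsk, hs⟩ := i1
    obtain ⟨l, t, ht0, htl, ht⟩ := i2
    have e1 : ∀ i ≤ k, (fun i => if i ≤ k then s i else t (i - k)) i = s i := fun i hi => if_pos hi
    have e2 : ∀ i, (fun i => if i ≤ k then s i else t (i - k)) (k + i) = t i := by
      intro i
      rcases Nat.eq_zero_or_pos i with rfl | hi
      · rw [add_zero, e1 k le_rfl, hsk, ht0]
      · simp only
        rw [if_neg (by omega), Nat.add_sub_cancel_left]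
    refine ⟨k + l, fun i => if i ≤ k then s i else t (i - k), ?_, ?_, fun i hi => ?_⟩
    · rw [e1 0 (Nat.zero_le _), hs0]
    · rw [e2, htl]
    · rcases Nat.lt_or_ge i k with h | h
      · rw [e1 i h.le, e1 (i + 1) h]
        exact hs i h
      · obtain ⟨j, rfl⟩ := Nat.exists_eq_add_of_le h
        rw [e2 j, add_assoc, e2 (j + 1)]
        exact ht j (by omega)

end PAff

/-! ### Continuous representatives in the Sobolev space -/

namespace W1p
variable {p : ℝ≥0∞} [Fact (1 ≤ p)]

theorem memLp_fn (y : W1p p) : MemLp (fn y) p unitVol := Lp.memLp _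

theorem memLp_wderiv (y : W1p p) : MemLp (wderiv y) p unitVol := Lp.memLp _

theorem integrable_fn (y : W1p p) : Integrable (fn y) unitVol := (memLp_fn y).integrable Fact.out

theorem integrable_wderiv (y : W1p p) : Integrable (wderiv y) unitVol :=
  (memLp_wderiv y).integrable Fact.out

theorem exists_fn_eq (y : W1p p) : ∃ c, fn y =ᵐ[unitVol] fun x => c + prim (wderiv y) x :=
  IsWeakDeriv.exists_eq_prim (integrable_fn y) (integrable_wderiv y) y.2

/-- The absolutely continuous representative. -/
def rep (y : W1p p) (x : ℝ) : Plane := (exists_fn_eq y).choose + prim (wderiv y) x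

theorem rep_ae_eq (y : W1p p) : rep y =ᵐ[unitVol] fn y := (exists_fn_eq y).choose_spec.symm

theorem continuous_rep (y : W1p p) : Continuous (rep y) :=
  continuous_const.add (continuous_prim (integrable_wderiv y))

theorem isContRep_rep (y : W1p p) : IsContRep y (rep y) :=
  ⟨(continuous_rep y).continuousOn, rep_ae_eq y⟩

theorem IsContRep.eqOn {y : W1p p} {v : ℝ → Plane} (h : IsContRep y v) :
    EqOn v (rep y) (Ioo 0 1) :=
  Measure.eqOn_open_of_ae_eq (h.2.trans (rep_ae_eq y).symm) isOpen_Ioo h.1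
    (continuous_rep y).continuousOn

theorem rep_sub (y : W1p p) {a b : ℝ} (hab : a ≤ b) :
    rep y b - rep y a = ∫ t in Ioc a b, wderiv y t ∂unitVol := by
  rw [rep, rep, add_sub_add_left_eq_sub, prim_sub (integrable_wderiv y) hab]

theorem prim_congr {g h : ℝ → Plane} (hgh : g =ᵐ[unitVol] h) : prim g = prim h :=
  funext fun _ => intervalIntegral.integral_congr_ae (hgh.mono fun _ hx _ => hx)

/-- The constant in `rep` is only chosen; comparing both formulas at a single common point of
validity identifies it. -/
theorem rep_eq {y : W1p p} {g : ℝ → Plane} {c : Plane} (hg : wderiv y =ᵐ[unitVol] g)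
    (h : fn y =ᵐ[unitVol] fun x => c + prim g x) (x : ℝ) : rep y x = c + prim g x := by
  obtain ⟨t, ht1, ht2⟩ := ((rep_ae_eq y).and h).exists
  have e := congrFun (prim_congr hg)
  have h1 : (exists_fn_eq y).choose + prim (wderiv y) t = c + prim g t := ht1.trans ht2
  rw [e t, add_left_inj] at h1
  rw [rep, h1, e x]

theorem exists_of_memLp {g : ℝ → Plane} (hg : MemLp g p unitVol) (c : Plane) :
    ∃ y : W1p p, wderiv y =ᵐ[unitVol] g ∧ ∀ x, rep y x = c + prim g x := by
  have hgi : Integrable g unitVol := hg.integrable Fact.out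
  have hc : Continuous fun x => c + prim g x := continuous_const.add (continuous_prim hgi)
  obtain ⟨C, hC⟩ := (isCompact_Icc (a := (0 : ℝ)) (b := 1)).exists_bound_of_continuousOn
    hc.continuousOn
  have hu : MemLp (fun x => c + prim g x) p unitVol :=
    MemLp.of_bound hc.aestronglyMeasurable C
      ((ae_restrict_mem measurableSet_Ioo).mono fun x hx => hC x (Ioo_subset_Icc_self hx))
  have hw : IsWeakDeriv (fun x => c + prim g x) g := by
    have h0 : IsWeakDeriv (fun _ => c) 0 := by
      intro φ hφ
      obtain ⟨D, hD⟩ := hφ.bdd_deriv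
      rw [integral_smul_const, unitVol_eq, ← intervalIntegral.integral_of_le zero_le_one,
        intervalIntegral.integral_deriv_eq_sub
          (fun x _ => (hφ.smooth.differentiable (by simp)).differentiableAt)
          (hφ.continuous_deriv.intervalIntegrable _ _), hφ.eq_zero (x := 1) (by simp),
        hφ.eq_zero (x := 0) (by simp)]
      simp
    have := h0.add (integrable_const c)
      (((continuous_prim hgi).integrableOn_Icc (a := 0) (b := 1)).mono_set Ioo_subset_Icc_self)
      (integrable_zero _ _ _) hgi (isWeakDeriv_prim hgi)
    rwa [zero_add] at this
  let y : W1p p := ⟨WithLp.toLp p (hu.toLp _, hg.toLp _),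
    hw.congr hu.coeFn_toLp.symm hg.coeFn_toLp.symm⟩
  have h1 : wderiv y =ᵐ[unitVol] g := hg.coeFn_toLp
  have h2 : fn y =ᵐ[unitVol] fun x => c + prim g x := hu.coeFn_toLp
  exact ⟨y, h1, rep_eq h1 h2⟩

theorem isHomeo_iff {y : W1p p} : IsHomeo y ↔ IsEmbedding ((Ioo (0 : ℝ) 1).domRestrict (rep y))
    := by
  constructor
  · rintro ⟨v, hv, h⟩
    have : (Ioo (0 : ℝ) 1).domRestrict (rep y) = (Ioo (0 : ℝ) 1).domRestrict v :=
      funext fun x => (hv.eqOn x.2).symm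
    rwa [this]
  · exact fun h => ⟨rep y, isContRep_rep y, h⟩

theorem IsHomeo.injOn {y : W1p p} (h : IsHomeo y) : InjOn (rep y) (Ioo 0 1) := by
  intro s hs t ht hst
  have := (isHomeo_iff.1 h).injective (a₁ := ⟨s, hs⟩) (a₂ := ⟨t, ht⟩) hst
  exact congrArg Subtype.val this

/-- Injectivity on the compact interval gives a closed embedding, which restricts to the open
interval. -/
theorem isHomeo_of_injOn {y : W1p p} (h : InjOn (rep y) (Icc 0 1)) : IsHomeo y := by
  rw [isHomeo_iff]
  have h1 : IsClosedEmbedding ((Icc (0 : ℝ) 1).domRestrict (rep y)) :=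
    ((continuous_rep y).comp continuous_subtype_val).isClosedEmbedding fun s t hst =>
      Subtype.ext (h s.2 t.2 hst)
  exact h1.isEmbedding.comp (IsEmbedding.inclusion Ioo_subset_Icc_self)

theorem tendstoC0_iff {z : ℕ → W1p p} {y : W1p p} :
    TendstoC0 z y ↔ TendstoUniformlyOn (fun k => rep (z k)) (rep y) atTop (Ioo 0 1) := by
  constructor
  · rintro ⟨w, v, hw, hv, h⟩
    exact (h.congr (Eventually.of_forall fun k => (hw k).eqOn)).congr_right hv.eqOn
  · exact fun h => ⟨_, _, fun k => isContRep_rep _, isContRep_rep _, h⟩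

theorem exists_of_PAff {u : ℝ → Plane} (hu : PAff u 0 1) (hinj : InjOn u (Icc 0 1)) :
    ∃ y : W1p p, IsHomeo y ∧ IsPiecewiseAffine y ∧ wderiv y =ᵐ[unitVol] deriv u ∧
      EqOn (rep y) u (Icc 0 1) := by
  obtain ⟨C, hC⟩ := hu.exists_bound_deriv
  rw [← unitVol_eq] at hC
  obtain ⟨y, hy1, hy2⟩ := exists_of_memLp (p := p)
    (MemLp.of_bound (aestronglyMeasurable_deriv u _) C hC) (u 0)
  have hrep : EqOn (rep y) u (Icc 0 1) := by
    intro x hx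
    rw [hy2, prim, intervalIntegral.integral_of_le hx.1, unitVol_restrict_Ioc le_rfl hx.2]
    rcases hx.1.lt_or_eq with h | h
    · rw [← (hu.sub le_rfl h hx.2).sub_eq_integral, add_sub_cancel]
    · simp [← h]
  refine ⟨y, isHomeo_of_injOn fun s hs t ht hst => hinj hs ht ?_, ?_, hy1, hrep⟩
  · rwa [hrep hs, hrep ht] at hst
  · obtain ⟨n, t, ht0, htn, ht⟩ := hu.exists_nodes
    have hlt : ∀ i < n, t i < t (i + 1) := fun i hi => (ht i hi).1
    refine ⟨rep y, isContRep_rep y, n, fun i => t i, Fin.strictMono_iff_lt_succ.2 fun i => ?_,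
      ht0, by simpa using htn, fun i => ?_⟩
    · simpa using hlt i i.2
    · obtain ⟨B, hB⟩ := (ht i i.2).2
      refine ⟨B, u (t i) - t i • B, fun x hx => ?_⟩
      have hx' : x ∈ Ioo (t i) (t (i + 1)) := by simpa using hx
      have h0 : 0 ≤ t i := ht0 ▸ le_of_forall_lt_succ hlt (Nat.zero_le _) i.2.le
      have h1 : t (i + 1) ≤ 1 := htn ▸ le_of_forall_lt_succ hlt (Nat.succ_le_of_lt i.2) le_rfl
      rw [hrep ⟨h0.trans hx'.1.le, hx'.2.le.trans h1⟩, hB x (Ioo_subset_Icc_self hx')]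
      module

end W1p

/-! ### Weak convergence implies boundedness and uniform convergence -/

theorem prim_add {g h : ℝ → Plane} (hg : Integrable g unitVol) (hh : Integrable h unitVol) (x : ℝ) :
    prim (g + h) x = prim g x + prim h x :=
  intervalIntegral.integral_add hg.intervalIntegrable hh.intervalIntegrable

theorem prim_smul (c : ℝ) (g : ℝ → Plane) (x : ℝ) : prim (c • g) x = c • prim g x :=
  intervalIntegral.integral_smul c g

/-- The uniform boundedness principle is applied to the images in the bidual, so the complete space
involved is the dual and not E. -/
theorem exists_norm_le_of_forall_dual {E : Type*} [NormedAddCommGroup E] [NormedSpace ℝ E]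
    {z : ℕ → E} (h : ∀ T : StrongDual ℝ E, ∃ C, ∀ k, ‖T (z k)‖ ≤ C) : ∃ C, ∀ k, ‖z k‖ ≤ C := by
  obtain ⟨C, hC⟩ := banach_steinhaus
    (g := fun k => NormedSpace.inclusionInDoubleDual ℝ E (z k)) h
  refine ⟨C, fun k => ?_⟩
  rw [← LinearIsometry.norm_map (NormedSpace.inclusionInDoubleDualLi ℝ (E := E))]
  exact hC k

namespace W1p
variable {p : ℝ≥0∞} [Fact (1 ≤ p)]

theorem fn_add (y z : W1p p) : fn (y + z) =ᵐ[unitVol] fn y + fn z := Lp.coeFn_add _ _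

theorem wderiv_add (y z : W1p p) : wderiv (y + z) =ᵐ[unitVol] wderiv y + wderiv z :=
  Lp.coeFn_add _ _

theorem fn_smul (c : ℝ) (y : W1p p) : fn (c • y) =ᵐ[unitVol] c • fn y := Lp.coeFn_smul _ _

theorem wderiv_smul (c : ℝ) (y : W1p p) : wderiv (c • y) =ᵐ[unitVol] c • wderiv y :=
  Lp.coeFn_smul _ _

theorem rep_add (y z : W1p p) (x : ℝ) : rep (y + z) x = rep y x + rep z x := by
  have h := prim_add (integrable_wderiv y) (integrable_wderiv z)
  rw [rep_eq (c := (exists_fn_eq y).choose + (exists_fn_eq z).choose) (wderiv_add y z) ?_ x, h,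
    rep, rep]
  · abel
  · filter_upwards [fn_add y z, rep_ae_eq y, rep_ae_eq z] with t h1 h2 h3
    rw [h1, Pi.add_apply, ← h2, ← h3, h, rep, rep]
    abel

theorem rep_smul (c : ℝ) (y : W1p p) (x : ℝ) : rep (c • y) x = c • rep y x := by
  rw [rep_eq (c := c • (exists_fn_eq y).choose) (wderiv_smul c y) ?_ x, prim_smul, rep, smul_add]
  filter_upwards [fn_smul c y, rep_ae_eq y] with t h1 h2
  rw [h1, Pi.smul_apply, ← h2, prim_smul, rep, smul_add]

/-- The function component as a continuous linear map. -/
def fnL : W1p p →L[ℝ] Lp Plane p unitVol := (WithLp.fstL p ℝ _ _).comp (W1p p).subtypeL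

/-- The derivative component as a continuous linear map. -/
def wderivL : W1p p →L[ℝ] Lp Plane p unitVol := (WithLp.sndL p ℝ _ _).comp (W1p p).subtypeL

theorem coe_fnL (y : W1p p) : (fnL y : ℝ → Plane) = fn y := rfl

theorem norm_fnL_le (y : W1p p) : ‖fnL y‖ ≤ ‖y‖ := WithLp.norm_fst_le _ _

theorem norm_wderivL_le (y : W1p p) : ‖wderivL y‖ ≤ ‖y‖ := WithLp.norm_snd_le _ _

theorem integral_norm_le (f : Lp Plane p unitVol) : ∫ x, ‖f x‖ ∂unitVol ≤ ‖f‖ := by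
  rw [integral_norm_eq_lintegral_enorm (Lp.aestronglyMeasurable f), ← eLpNorm_one_eq_lintegral_enorm,
    Lp.norm_def]
  exact ENNReal.toReal_mono (Lp.eLpNorm_ne_top f)
    (eLpNorm_le_eLpNorm_of_exponent_le Fact.out (Lp.aestronglyMeasurable f))

/-- Hölder's inequality; it yields the Hölder exponent 1 - 1/p of the representatives, positive
exactly when p > 1. -/
theorem setIntegral_norm_le (f : Lp Plane p unitVol) {a b : ℝ} (hab : a ≤ b) :
    ∫ x in Ioc a b, ‖f x‖ ∂unitVol ≤ ‖f‖ * (b - a) ^ (1 - 1 / p.toReal) := by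
  have hp : 0 ≤ 1 - 1 / p.toReal := by
    rw [sub_nonneg]
    by_cases h : p = ∞
    · simp [h]
    have h1 : 1 ≤ p.toReal := by
      have := ENNReal.toReal_mono h (Fact.out : 1 ≤ p)
      simpa using this
    exact div_le_one_of_le₀ h1 (by positivity)
  have hm := (Lp.aestronglyMeasurable f).restrict (s := Ioc a b)
  have h1 := eLpNorm_le_eLpNorm_mul_rpow_measure_univ (p := 1) (q := p)
    (μ := unitVol.restrict (Ioc a b)) Fact.out hm
  have h2 : eLpNorm f p (unitVol.restrict (Ioc a b)) ≤ eLpNorm f p unitVol :=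
    eLpNorm_restrict_le _ _ _ _
  have h3 : (unitVol.restrict (Ioc a b)) univ ≤ ENNReal.ofReal (b - a) := by
    rw [Measure.restrict_apply_univ, ← Real.volume_Ioc]
    exact Measure.restrict_apply_le _ _
  rw [ENNReal.toReal_one, div_one] at h1
  rw [integral_norm_eq_lintegral_enorm hm, ← eLpNorm_one_eq_lintegral_enorm, Lp.norm_def]
  refine ENNReal.toReal_le_of_le_ofReal (by have := sub_nonneg.2 hab; positivity) ?_
  rw [ENNReal.ofReal_mul ENNReal.toReal_nonneg, ENNReal.ofReal_toReal (Lp.eLpNorm_ne_top f),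
    ← ENNReal.ofReal_rpow_of_nonneg (sub_nonneg.2 hab) hp]
  exact h1.trans (mul_le_mul' h2 (ENNReal.rpow_le_rpow h3 hp))

theorem dist_rep_le_integral (y : W1p p) {a b : ℝ} (hab : a ≤ b) :
    dist (rep y b) (rep y a) ≤ ∫ t in Ioc a b, ‖wderiv y t‖ ∂unitVol := by
  rw [dist_eq_norm, rep_sub y hab]
  exact norm_integral_le_integral_norm _

theorem dist_rep_le (y : W1p p) (a b : ℝ) :
    dist (rep y b) (rep y a) ≤ ‖y‖ * |b - a| ^ (1 - 1 / p.toReal) := by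
  wlog hab : a ≤ b generalizing a b
  · rw [dist_comm, abs_sub_comm]
    exact this b a (le_of_not_ge hab)
  rw [abs_of_nonneg (sub_nonneg.2 hab)]
  exact ((dist_rep_le_integral y hab).trans (setIntegral_norm_le (wderivL y) hab)).trans
    (mul_le_mul_of_nonneg_right (norm_wderivL_le y) (Real.rpow_nonneg (sub_nonneg.2 hab) _))

theorem integral_norm_wderiv_le (y : W1p p) : ∫ x, ‖wderiv y x‖ ∂unitVol ≤ ‖y‖ :=
  (integral_norm_le (wderivL y)).trans (norm_wderivL_le y)

/-- The oscillation of `rep y` is at most the L¹ norm of the derivative; averaging ‖rep y x‖ ≤ ‖rep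
y t‖ + ‖y‖ over t gives the bound. -/
theorem norm_rep_le (y : W1p p) (x : ℝ) : ‖rep y x‖ ≤ 2 * ‖y‖ := by
  have hw := (integrable_wderiv y).norm
  have h1 : ∀ t, ‖rep y x‖ ≤ ‖rep y t‖ + ‖y‖ := by
    intro t
    have h2 : ∀ a b, a ≤ b → dist (rep y b) (rep y a) ≤ ‖y‖ := fun a b hab =>
      ((dist_rep_le_integral y hab).trans (setIntegral_le_integral hw
        (ae_of_all _ fun _ => norm_nonneg _))).trans (integral_norm_wderiv_le y)
    have h3 : dist (rep y x) (rep y t) ≤ ‖y‖ := by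
      rcases le_total t x with h | h
      · exact h2 t x h
      · rw [dist_comm]; exact h2 x t h
    rw [dist_eq_norm] at h3
    linarith [norm_le_norm_add_norm_sub' (rep y x) (rep y t)]
  have hr : Integrable (fun t => ‖rep y t‖) unitVol :=
    ((integrable_fn y).congr (rep_ae_eq y).symm).norm
  have h2 := integral_mono (integrable_const ‖rep y x‖) (hr.add (integrable_const ‖y‖)) h1
  have h3 : ∫ t, ‖rep y t‖ ∂unitVol ≤ ‖y‖ := by
    rw [integral_congr_ae ((rep_ae_eq y).mono fun t ht => by rw [ht])]
    exact (integral_norm_le (fnL y)).trans (norm_fnL_le y)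
  simp only [Pi.add_apply] at h2
  rw [integral_add hr (integrable_const _)] at h2
  simp only [integral_const, probReal_univ, one_smul] at h2
  linarith

/-- Evaluation of the continuous representative. -/
def evalL (x : ℝ) : W1p p →L[ℝ] Plane :=
  LinearMap.mkContinuous ⟨⟨fun y => rep y x, fun y z => rep_add y z x⟩, fun c y => rep_smul c y x⟩ 2
    fun y => norm_rep_le y x

theorem tendstoWeakly_iff {z : ℕ → W1p p} {y : W1p p} :
    TendstoWeakly z y ↔ ∀ T : W1p p →L[ℝ] ℝ, Tendsto (fun k => T (z k)) atTop (𝓝 (T y)) := by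
  refine WeakBilin.tendsto_iff_forall_eval_tendsto (B := (topDualPairing ℝ (W1p p)).flip)
    fun a b hab => ?_
  by_contra hne
  obtain ⟨T, hT⟩ := SeparatingDual.exists_separating_of_ne (R := ℝ) hne
  exact hT (LinearMap.congr_fun hab T)

theorem TendstoWeakly.comp {z : ℕ → W1p p} {y : W1p p} (h : TendstoWeakly z y) {φ : ℕ → ℕ}
    (hφ : Tendsto φ atTop atTop) : TendstoWeakly (z ∘ φ) y := by
  unfold TendstoWeakly at *
  exact h.comp hφ

theorem TendstoWeakly.isBounded {z : ℕ → W1p p} {y : W1p p} (h : TendstoWeakly z y) :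
    Bornology.IsBounded (range z) := by
  rw [tendstoWeakly_iff] at h
  obtain ⟨C, hC⟩ := exists_norm_le_of_forall_dual fun T => by
    obtain ⟨C, hC⟩ := (Metric.isBounded_range_of_tendsto _ (h T)).exists_norm_le
    exact ⟨C, fun k => hC _ ⟨k, rfl⟩⟩
  refine isBounded_iff_forall_norm_le.2 ⟨C, ?_⟩
  rintro _ ⟨k, rfl⟩
  exact hC k

theorem TendstoWeakly.tendsto_rep {z : ℕ → W1p p} {y : W1p p} (h : TendstoWeakly z y) (x : ℝ) :
    Tendsto (fun k => rep (z k) x) atTop (𝓝 (rep y x)) := by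
  rw [tendstoWeakly_iff] at h
  have h1 : Tendsto (fun k => WithLp.ofLp (rep (z k) x)) atTop (𝓝 (WithLp.ofLp (rep y x))) :=
    tendsto_pi_nhds.2 fun i => h ((EuclideanSpace.proj i).comp (evalL x))
  exact ((PiLp.continuous_toLp 2 _).tendsto _).comp h1

/-- Point evaluations are continuous functionals, so the representatives converge pointwise; being
equi-Hölder by boundedness in norm, they converge uniformly on the compact interval. -/
theorem TendstoWeakly.tendstoUniformlyOn (hp : 1 < p) (hp' : p < ∞) {z : ℕ → W1p p} {y : W1p p}
    (h : TendstoWeakly z y) :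
    TendstoUniformlyOn (fun k => rep (z k)) (rep y) atTop (Icc 0 1) := by
  obtain ⟨C, hC⟩ := h.isBounded.exists_norm_le
  have hC' : ∀ k, ‖z k‖ ≤ C := fun k => hC _ (mem_range_self k)
  set K := max C ‖y‖ with hK
  have hα : 0 < 1 - 1 / p.toReal := by
    have : 1 < p.toReal := by
      have := (ENNReal.toReal_lt_toReal ENNReal.one_ne_top hp'.ne).2 hp
      simpa using this
    rw [sub_pos, div_lt_one (by linarith)]
    exact this
  rw [Metric.tendstoUniformlyOn_iff]
  intro ε hε
  have hlim : Tendsto (fun x : ℝ => K * x ^ (1 - 1 / p.toReal)) (𝓝 0) (𝓝 0) := by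
    have := ((Real.continuousAt_rpow_const 0 _ (Or.inr hα.le)).tendsto).const_mul K
    rwa [Real.zero_rpow hα.ne', mul_zero] at this
  obtain ⟨ω, hω, hω'⟩ := Metric.eventually_nhds_iff.1 (hlim.eventually (gt_mem_nhds (show 0 < ε / 3 by positivity)))
  have hmod : ∀ w : W1p p, ‖w‖ ≤ K → ∀ s t : ℝ, dist s t < ω → dist (rep w s) (rep w t) < ε / 3 := by
    intro w hw s t hst
    refine (dist_rep_le w t s).trans_lt ((mul_le_mul_of_nonneg_right hw (by positivity)).trans_lt ?_)
    exact hω' (by rwa [Real.dist_eq, sub_zero, abs_abs, ← Real.dist_eq])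
  obtain ⟨S, hS, hSf, hcov⟩ := (isCompact_Icc (a := (0 : ℝ)) (b := 1)).finite_cover_balls hω
  have hev : ∀ᶠ k in atTop, ∀ s ∈ S, dist (rep (z k) s) (rep y s) < ε / 3 :=
    (eventually_all_finite hSf).2 fun s _ =>
      (Metric.tendsto_nhds.1 (h.tendsto_rep s)) _ (by positivity)
  filter_upwards [hev] with k hk x hx
  obtain ⟨s, hs, hxs⟩ := mem_iUnion₂.1 (hcov hx)
  have h1 := hk s hs
  have h2 := hmod y (le_max_right _ _) x s hxs
  have h3 := hmod (z k) ((hC' k).trans (le_max_left _ _)) s x (by rw [dist_comm]; exact hxs)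
  rw [dist_comm] at h1
  linarith [dist_triangle4 (rep y x) (rep y s) (rep (z k) s) (rep (z k) x)]

end W1p

/-! ### Uniform convexity, and weak convergence from uniform convergence -/

/-- The convexity gap of `‖·‖ ^ q` at the midpoint. -/
def powGap (q : ℝ) (a b : Plane) : ℝ :=
  (‖a‖ ^ q + ‖b‖ ^ q) / 2 - ‖(1 / 2 : ℝ) • (a + b)‖ ^ q

theorem norm_half_add_le (a b : Plane) : ‖(1 / 2 : ℝ) • (a + b)‖ ≤ (‖a‖ + ‖b‖) / 2 := by
  rw [norm_smul, Real.norm_of_nonneg (by norm_num)]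
  linarith [norm_add_le a b]

theorem rpow_half_add_le {q : ℝ} (hq : 1 ≤ q) {s t : ℝ} (hs : 0 ≤ s) (ht : 0 ≤ t) :
    ((s + t) / 2) ^ q ≤ (s ^ q + t ^ q) / 2 := by
  have := (convexOn_rpow hq).2 (mem_Ici.2 hs) (mem_Ici.2 ht)
    (show (0 : ℝ) ≤ 1 / 2 by norm_num) (show (0 : ℝ) ≤ 1 / 2 by norm_num) (by norm_num)
  simp only [smul_eq_mul] at this
  rw [show (s + t) / 2 = 1 / 2 * s + 1 / 2 * t by ring]
  linarith

theorem powGap_nonneg {q : ℝ} (hq : 1 ≤ q) (a b : Plane) : 0 ≤ powGap q a b := by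
  have h1 := Real.rpow_le_rpow (norm_nonneg _) (norm_half_add_le a b) (by linarith : 0 ≤ q)
  have h2 := rpow_half_add_le hq (norm_nonneg a) (norm_nonneg b)
  unfold powGap
  linarith

/-- For equal norms the Euclidean norm is strictly convex along the segment; for different norms the
power function is. -/
theorem powGap_pos {q : ℝ} (hq : 1 < q) {a b : Plane} (hab : a ≠ b) : 0 < powGap q a b := by
  have h1 := norm_half_add_le a b
  by_cases h : ‖a‖ = ‖b‖
  · have h2 : ‖(1 / 2 : ℝ) • a + (1 / 2 : ℝ) • b‖ < ‖a‖ :=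
      norm_combo_lt_of_ne le_rfl h.ge hab (by norm_num) (by norm_num) (by norm_num)
    rw [← smul_add] at h2
    have h3 := Real.rpow_lt_rpow (norm_nonneg _) h2 (by linarith : 0 < q)
    unfold powGap
    rw [← h]
    linarith
  · have h2 := (strictConvexOn_rpow hq).2 (mem_Ici.2 (norm_nonneg a)) (mem_Ici.2 (norm_nonneg b)) h
      (show (0 : ℝ) < 1 / 2 by norm_num) (show (0 : ℝ) < 1 / 2 by norm_num) (by norm_num)
    simp only [smul_eq_mul] at h2
    have h3 := Real.rpow_le_rpow (norm_nonneg _) h1 (by linarith : 0 ≤ q)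
    rw [show (‖a‖ + ‖b‖) / 2 = 1 / 2 * ‖a‖ + 1 / 2 * ‖b‖ by ring] at h3
    unfold powGap
    linarith

theorem powGap_smul {q r : ℝ} (hr : 0 ≤ r) (a b : Plane) :
    powGap q (r • a) (r • b) = r ^ q * powGap q a b := by
  have h : ∀ c : Plane, ‖r • c‖ ^ q = r ^ q * ‖c‖ ^ q := fun c => by
    rw [norm_smul, Real.norm_of_nonneg hr, Real.mul_rpow hr (norm_nonneg _)]
  unfold powGap
  rw [← smul_add, smul_comm, h, h, h]
  ring

/-- Uniform convexity of `‖·‖ ^ q`, quantified pointwise. -/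
theorem exists_norm_sub_rpow_le {q : ℝ} (hq : 1 < q) {ε : ℝ} (hε : 0 < ε) :
    ∃ K : ℝ, 0 ≤ K ∧ ∀ a b : Plane, ‖a - b‖ ^ q ≤ ε * (‖a‖ ^ q + ‖b‖ ^ q) + K * powGap q a b := by
  have hq0 : 0 < q := by linarith
  have hcn : ∀ {F : Plane × Plane → Plane}, Continuous F → Continuous fun x => ‖F x‖ ^ q :=
    fun hF => hF.norm.rpow_const fun _ => Or.inr hq0.le
  have hgap : Continuous fun x : Plane × Plane => powGap q x.1 x.2 := by
    unfold powGap
    exact (((hcn continuous_fst).add (hcn continuous_snd)).div_const 2).sub (hcn (by fun_prop))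
  -- On this compact set a ≠ b, so the gap is positive and the quotient is bounded. Off it, on the
  -- normalized pairs, the ε term suffices, and homogeneity of degree q removes the normalization.
  set S : Set (Plane × Plane) := {x | ‖x.1‖ ^ q + ‖x.2‖ ^ q = 1 ∧ ε ≤ ‖x.1 - x.2‖ ^ q} with hS
  have hSc : IsCompact S := by
    refine Metric.isCompact_of_isClosed_isBounded ?_ ?_
    · exact (isClosed_eq ((hcn continuous_fst).add (hcn continuous_snd)) continuous_const).inter
        (isClosed_le continuous_const (hcn (continuous_fst.sub continuous_snd)))
    · refine isBounded_iff_forall_norm_le.2 ⟨1, fun x hx => ?_⟩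
      have h1 : ‖x.1‖ ^ q + ‖x.2‖ ^ q = 1 := hx.1
      have h2 : 0 ≤ ‖x.1‖ ^ q := by positivity
      have h3 : 0 ≤ ‖x.2‖ ^ q := by positivity
      have h4 : ∀ t : ℝ, 0 ≤ t → t ^ q ≤ 1 → t ≤ 1 := fun t ht htq => by
        by_contra hlt
        exact absurd htq (not_le.2 (Real.one_lt_rpow (not_le.1 hlt) hq0))
      exact max_le (h4 _ (norm_nonneg _) (by linarith)) (h4 _ (norm_nonneg _) (by linarith))
  have hpos : ∀ x ∈ S, 0 < powGap q x.1 x.2 := fun x hx => powGap_pos hq fun h => by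
    have h1 : ε ≤ ‖x.1 - x.2‖ ^ q := hx.2
    rw [h, sub_self, norm_zero, Real.zero_rpow hq0.ne'] at h1
    linarith
  obtain ⟨K, hK⟩ := hSc.exists_bound_of_continuousOn
    (f := fun x => ‖x.1 - x.2‖ ^ q / powGap q x.1 x.2)
    ((hcn (continuous_fst.sub continuous_snd)).continuousOn.div hgap.continuousOn
      fun x hx => (hpos x hx).ne')
  refine ⟨max K 0, le_max_right _ _, ?_⟩
  have hunit : ∀ a b : Plane, ‖a‖ ^ q + ‖b‖ ^ q = 1 →
      ‖a - b‖ ^ q ≤ ε + max K 0 * powGap q a b := by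
    intro a b hab
    have hg := mul_nonneg (le_max_right K 0) (powGap_nonneg hq.le a b)
    by_cases h : ε ≤ ‖a - b‖ ^ q
    · have h1 := (le_abs_self _).trans (hK (a, b) ⟨hab, h⟩)
      rw [div_le_iff₀ (hpos (a, b) ⟨hab, h⟩)] at h1
      have h2 := mul_le_mul_of_nonneg_right (le_max_left K 0) (powGap_nonneg hq.le a b)
      simp only at h1
      linarith
    · linarith
  intro a b
  set m := ‖a‖ ^ q + ‖b‖ ^ q with hm
  have ha0 : 0 ≤ ‖a‖ ^ q := by positivity
  have hb0 : 0 ≤ ‖b‖ ^ q := by positivity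
  have hm0 : 0 ≤ m := by positivity
  rcases hm0.eq_or_lt with h | h
  · have ha : a = 0 := by
      have : ‖a‖ ^ q = 0 := by linarith
      rwa [Real.rpow_eq_zero (norm_nonneg _) hq0.ne', norm_eq_zero] at this
    have hb : b = 0 := by
      have : ‖b‖ ^ q = 0 := by linarith
      rwa [Real.rpow_eq_zero (norm_nonneg _) hq0.ne', norm_eq_zero] at this
    subst ha hb
    rw [sub_zero, norm_zero, Real.zero_rpow hq0.ne']
    exact add_nonneg (mul_nonneg hε.le hm0)
      (mul_nonneg (le_max_right _ _) (powGap_nonneg hq.le _ _))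
  · set r := m ^ q⁻¹ with hr
    have hr0 : 0 < r := Real.rpow_pos_of_pos h _
    have hrq : r ^ q = m := Real.rpow_inv_rpow hm0 hq0.ne'
    have hn : ∀ c : Plane, ‖r⁻¹ • c‖ ^ q = m⁻¹ * ‖c‖ ^ q := fun c => by
      rw [norm_smul, Real.norm_of_nonneg (by positivity), Real.mul_rpow (by positivity)
        (norm_nonneg _), Real.inv_rpow hr0.le, hrq]
    have h1 := hunit (r⁻¹ • a) (r⁻¹ • b) (by
      rw [hn, hn, ← mul_add, ← hm, inv_mul_cancel₀ h.ne'])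
    rw [← smul_sub, hn, powGap_smul (by positivity), Real.inv_rpow hr0.le, hrq,
      inv_mul_le_iff₀ h] at h1
    calc ‖a - b‖ ^ q ≤ m * (ε + max K 0 * (m⁻¹ * powGap q a b)) := h1
      _ = ε * m + max K 0 * powGap q a b := by field_simp

section
variable {α : Type*} [MeasurableSpace α] {μ : Measure α} {p : ℝ≥0∞} [Fact (1 ≤ p)]

theorem Lp_norm_rpow_eq (hp' : p ≠ ∞) (f : Lp Plane p μ) :
    ‖f‖ ^ p.toReal = ∫ x, ‖f x‖ ^ p.toReal ∂μ := by
  have hp0 : p ≠ 0 := (zero_lt_one.trans_le Fact.out).ne'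
  have hq : 0 < p.toReal := ENNReal.toReal_pos hp0 hp'
  have hI : 0 ≤ ∫ x, ‖f x‖ ^ p.toReal ∂μ := integral_nonneg fun x => by positivity
  rw [Lp.norm_def, (Lp.memLp f).eLpNorm_eq_integral_rpow_norm hp0 hp', ENNReal.toReal_ofReal
    (by positivity), Real.rpow_inv_rpow hI hq.ne']

theorem integrable_norm_rpow_Lp (hp' : p ≠ ∞) (f : Lp Plane p μ) :
    Integrable (fun x => ‖f x‖ ^ p.toReal) μ :=
  (Lp.memLp f).integrable_norm_rpow (zero_lt_one.trans_le Fact.out).ne' hp'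

/-- Uniform convexity of the `L^p` norm. -/
theorem exists_norm_sub_rpow_le_Lp (hp : 1 < p) (hp' : p ≠ ∞) {ε : ℝ} (hε : 0 < ε) :
    ∃ K : ℝ, 0 ≤ K ∧ ∀ f g : Lp Plane p μ, ‖f - g‖ ^ p.toReal ≤
      ε * (‖f‖ ^ p.toReal + ‖g‖ ^ p.toReal) + K * ((‖f‖ ^ p.toReal + ‖g‖ ^ p.toReal) / 2 -
        ‖(1 / 2 : ℝ) • (f + g)‖ ^ p.toReal) := by
  have hq : 1 < p.toReal := by
    have := (ENNReal.toReal_lt_toReal ENNReal.one_ne_top hp').2 hp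
    simpa using this
  obtain ⟨K, hK, h⟩ := exists_norm_sub_rpow_le hq hε
  refine ⟨K, hK, fun f g => ?_⟩
  have hf := integrable_norm_rpow_Lp hp' f
  have hg := integrable_norm_rpow_Lp hp' g
  have hm := integrable_norm_rpow_Lp hp' ((1 / 2 : ℝ) • (f + g))
  have hd := integrable_norm_rpow_Lp hp' (f - g)
  have hfg : Integrable (fun x => ‖f x‖ ^ p.toReal + ‖g x‖ ^ p.toReal) μ := hf.add hg
  have h1 : Integrable (fun x => ε * (‖f x‖ ^ p.toReal + ‖g x‖ ^ p.toReal)) μ := hfg.const_mul ε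
  have h2 : Integrable (fun x => (‖f x‖ ^ p.toReal + ‖g x‖ ^ p.toReal) / 2 -
      ‖((1 / 2 : ℝ) • (f + g) : Lp Plane p μ) x‖ ^ p.toReal) μ := (hfg.div_const 2).sub hm
  simp only [Lp_norm_rpow_eq hp']
  rw [← integral_add hf hg, ← integral_const_mul, ← integral_div,
    ← integral_sub (hfg.div_const 2) hm, ← integral_const_mul, ← integral_add h1 (h2.const_mul K)]
  refine integral_mono_ae hd (h1.add (h2.const_mul K)) ?_
  filter_upwards [Lp.coeFn_sub f g, Lp.coeFn_smul (1 / 2 : ℝ) (f + g), Lp.coeFn_add f g] with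
    x h1 h2 h3
  simp only [h1, h2, Pi.sub_apply, Pi.smul_apply, h3, Pi.add_apply]
  exact h (f x) (g x)

end

theorem cauchySeq_of_gap {α : Type*} [MeasurableSpace α] {μ : Measure α} {p : ℝ≥0∞} [Fact (1 ≤ p)]
    (hp : 1 < p) (hp' : p ≠ ∞) {f : ℕ → Lp Plane p μ} {R : ℝ} (hR : ∀ k, ‖f k‖ ≤ R)
    (hgap : ∀ δ : ℝ, 0 < δ → ∃ N, ∀ k, N ≤ k → ∀ l, k ≤ l →
      (‖f k‖ ^ p.toReal + ‖f l‖ ^ p.toReal) / 2 - ‖(1 / 2 : ℝ) • (f k + f l)‖ ^ p.toReal < δ) :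
    CauchySeq f := by
  have hq : 0 < p.toReal := ENNReal.toReal_pos (zero_lt_one.trans hp).ne' hp'
  have hR0 : 0 ≤ R := (norm_nonneg _).trans (hR 0)
  rw [Metric.cauchySeq_iff']
  intro ε hε
  have hεq : 0 < ε ^ p.toReal := by positivity
  -- Chosen so that the ε term of uniform convexity contributes at most half of ε^p and the gap term
  -- at most a quarter.
  set D := 4 * (R ^ p.toReal + 1) with hD
  have hRq : 0 ≤ R ^ p.toReal := by positivity
  obtain ⟨K, hK, hUC⟩ := exists_norm_sub_rpow_le_Lp (μ := μ) hp hp'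
    (show 0 < ε ^ p.toReal / D by positivity)
  obtain ⟨N, hN⟩ := hgap (ε ^ p.toReal / (4 * (K + 1))) (by positivity)
  refine ⟨N, fun l hl => ?_⟩
  have h1 := hUC (f N) (f l)
  have h2 := hN N le_rfl l hl
  have hbd : ∀ k, ‖f k‖ ^ p.toReal ≤ R ^ p.toReal := fun k =>
    Real.rpow_le_rpow (norm_nonneg _) (hR k) hq.le
  have h3 : ε ^ p.toReal / D * (‖f N‖ ^ p.toReal + ‖f l‖ ^ p.toReal) ≤ ε ^ p.toReal / 2 := by
    calc _ ≤ ε ^ p.toReal / D * (2 * (R ^ p.toReal + 1)) := by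
          gcongr
          linarith [hbd N, hbd l]
      _ = ε ^ p.toReal / 2 := by rw [hD]; field_simp; norm_num
  have h4 := mul_le_mul_of_nonneg_left h2.le hK
  have h5 : K * (ε ^ p.toReal / (4 * (K + 1))) ≤ ε ^ p.toReal / 4 := by
    rw [← mul_div_assoc, div_le_div_iff₀ (by positivity) (by norm_num)]
    nlinarith
  have h6 : ‖f N - f l‖ ^ p.toReal < ε ^ p.toReal := by
    refine h1.trans_lt ?_
    linarith
  rw [dist_comm, dist_eq_norm]
  exact lt_of_not_ge fun hge => absurd h6 (not_lt.2 (Real.rpow_le_rpow hε.le hge hq.le))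

/-- A decreasing sequence of nonempty midpoint convex sets on which `Φ` is bounded has elements
that almost minimize `Φ`; these form a Cauchy sequence with respect to any distance that is
controlled by the midpoint convexity gap of `Φ`. -/
theorem exists_almost_minimizers {E : Type*} [AddCommGroup E] [Module ℝ E] {C : ℕ → Set E}
    (hC : Antitone C) (hne : ∀ k, (C k).Nonempty)
    (hconv : ∀ k, ∀ f ∈ C k, ∀ g ∈ C k, (1 / 2 : ℝ) • (f + g) ∈ C k) {Φ : E → ℝ} {B : ℝ}
    (h0 : ∀ f, 0 ≤ Φ f) (hB : ∀ f ∈ C 0, Φ f ≤ B) :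
    ∃ h : ℕ → E, (∀ k, h k ∈ C k) ∧ ∀ δ : ℝ, 0 < δ → ∃ N, ∀ k, N ≤ k → ∀ l, k ≤ l →
      (Φ (h k) + Φ (h l)) / 2 - Φ ((1 / 2 : ℝ) • (h k + h l)) < δ := by
  have hbdd : ∀ k, BddBelow (Φ '' C k) := fun k => ⟨0, by rintro _ ⟨f, -, rfl⟩; exact h0 f⟩
  set m : ℕ → ℝ := fun k => sInf (Φ '' C k) with hm
  have hmle : ∀ k, ∀ f ∈ C k, m k ≤ Φ f := fun k f hf => csInf_le (hbdd k) (mem_image_of_mem _ hf)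
  have hmono : Monotone m := fun k l hkl =>
    csInf_le_csInf (hbdd k) ((hne l).image _) (image_mono (hC hkl))
  have hmB : BddAbove (range m) := by
    refine ⟨B, ?_⟩
    rintro _ ⟨k, rfl⟩
    obtain ⟨f, hf⟩ := hne k
    exact (hmle k f hf).trans (hB f (hC (Nat.zero_le k) hf))
  -- The infima over the shrinking sets increase to a finite limit. A midpoint stays in the larger
  -- set C k, so Φ there is at least m k, while the values at both almost minimizers barely exceed
  -- that limit.
  have hlim := tendsto_atTop_ciSup hmono hmB
  have hle : ∀ k, m k ≤ ⨆ k, m k := fun k => le_ciSup hmB k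
  have hex : ∀ k : ℕ, ∃ f ∈ C k, Φ f < m k + 1 / ((k : ℝ) + 1) := by
    intro k
    obtain ⟨_, ⟨f, hf, rfl⟩, hlt⟩ := exists_lt_of_csInf_lt ((hne k).image Φ)
      (show sInf (Φ '' C k) < m k + 1 / ((k : ℝ) + 1) from lt_add_of_pos_right _ (by positivity))
    exact ⟨f, hf, hlt⟩
  choose h hh hlt using hex
  refine ⟨h, hh, fun δ hδ => ?_⟩
  have hev := (hlim.eventually (lt_mem_nhds (show (⨆ k, m k) - δ / 2 < ⨆ k, m k by linarith))).and
    ((tendsto_one_div_add_atTop_nhds_zero_nat (𝕜 := ℝ)).eventually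
      (gt_mem_nhds (show 0 < δ / 2 by linarith)))
  obtain ⟨N, hN⟩ := eventually_atTop.1 hev
  refine ⟨N, fun k hk l hkl => ?_⟩
  have h1 := hmle k _ (hconv k _ (hh k) _ (hC hkl (hh l)))
  obtain ⟨a1, a2⟩ := hN k hk
  obtain ⟨b1, b2⟩ := hN l (hk.trans hkl)
  have h2 := hlt k
  have h3 := hlt l
  have h4 := hle l
  linarith

namespace W1p
variable {p : ℝ≥0∞} [Fact (1 ≤ p)]

theorem tendsto_integral_smul {φ : ℝ → ℝ} {C : ℝ} (hφ : Continuous φ) (hC : ∀ x, ‖φ x‖ ≤ C)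
    {f : ℕ → Lp Plane p unitVol} {g : Lp Plane p unitVol} (h : Tendsto f atTop (𝓝 g)) :
    Tendsto (fun k => ∫ x, φ x • f k x ∂unitVol) atTop (𝓝 (∫ x, φ x • g x ∂unitVol)) := by
  have hint : ∀ w : Lp Plane p unitVol, Integrable (fun x => φ x • w x) unitVol := fun w =>
    ((Lp.memLp w).integrable Fact.out).bdd_smul C hφ.aestronglyMeasurable (ae_of_all _ hC)
  have hC0 : 0 ≤ C := (norm_nonneg _).trans (hC 0)
  rw [tendsto_iff_norm_sub_tendsto_zero] at h ⊢
  have h' := h.const_mul C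
  rw [mul_zero] at h'
  refine squeeze_zero (fun _ => norm_nonneg _) (fun k => ?_) h'
  rw [← integral_sub (hint _) (hint _)]
  refine (norm_integral_le_integral_norm _).trans ?_
  calc ∫ x, ‖φ x • f k x - φ x • g x‖ ∂unitVol ≤ ∫ x, C * ‖(f k - g) x‖ ∂unitVol := by
        refine integral_mono_ae ((hint _).sub (hint _)).norm
          (((Lp.memLp (f k - g)).integrable Fact.out).norm.const_mul C) ?_
        filter_upwards [Lp.coeFn_sub (f k) g] with x hx
        simp only [hx, Pi.sub_apply, ← smul_sub, norm_smul]
        exact mul_le_mul_of_nonneg_right (hC x) (norm_nonneg _)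
    _ ≤ C * ‖f k - g‖ := by
        rw [integral_const_mul]
        exact mul_le_mul_of_nonneg_left (integral_norm_le _) hC0

theorem ext_fnL {y w : W1p p} (h : fnL y = fnL w) : y = w := by
  have h1 : wderiv y =ᵐ[unitVol] wderiv w := by
    refine IsWeakDeriv.unique (integrable_wderiv y) (integrable_wderiv w) y.2 ?_
    have h2 : fn y = fn w := congrArg (fun f : Lp Plane p unitVol => (f : ℝ → Plane)) h
    have : IsWeakDeriv (fn w) (wderiv w) := w.2
    rw [← h2] at this
    exact this
  have h3 : wderivL y = wderivL w := Lp.ext h1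
  exact Subtype.ext ((WithLp.ofLp_injective p) (Prod.ext h h3))

/-- Convergence of the functions together with the Cauchy property of the derivatives gives
convergence in `W^{1,p}`. -/
theorem tendsto_of_cauchySeq {h : ℕ → W1p p} {y : W1p p}
    (h1 : Tendsto (fun k => fnL (h k)) atTop (𝓝 (fnL y))) (h2 : CauchySeq fun k => wderivL (h k)) :
    Tendsto h atTop (𝓝 y) := by
  obtain ⟨s, hs⟩ := cauchySeq_tendsto_of_complete h2
  -- The weak derivative passes to the limit, so the limit of the derivatives is a weak derivative
  -- of y and hence equals y'.
  have hw : IsWeakDeriv (fnL y) s := by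
    intro φ hφ
    obtain ⟨C, hC⟩ := hφ.bdd
    obtain ⟨D, hD⟩ := hφ.bdd_deriv
    refine tendsto_nhds_unique (tendsto_integral_smul hφ.continuous_deriv hD h1) ?_
    refine Tendsto.congr (fun k => ?_) (tendsto_integral_smul hφ.smooth.continuous hC hs).neg
    exact ((h k).2 φ hφ).symm
  let w : W1p p := ⟨WithLp.toLp p (fnL y, s), hw⟩
  have hwy : w = y := ext_fnL rfl
  rw [tendsto_subtype_rng, ← hwy]
  exact ((WithLp.prod_continuous_toLp p _ _).tendsto _).comp (h1.prodMk_nhds hs)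

theorem TendstoC0.tendsto_fnL {z : ℕ → W1p p} {y : W1p p} (h : TendstoC0 z y) :
    Tendsto (fun k => fnL (z k)) atTop (𝓝 (fnL y)) := by
  rw [tendstoC0_iff, Metric.tendstoUniformlyOn_iff] at h
  rw [Metric.tendsto_atTop]
  intro ε hε
  obtain ⟨N, hN⟩ := eventually_atTop.1 (h (ε / 2) (by positivity))
  refine ⟨N, fun k hk => lt_of_le_of_lt ?_ (half_lt_self hε)⟩
  rw [dist_eq_norm]
  have : ∀ᵐ x ∂unitVol, ‖(fnL (z k) - fnL y) x‖ ≤ ε / 2 := by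
    filter_upwards [Lp.coeFn_sub (fnL (z k)) (fnL y), rep_ae_eq (z k), rep_ae_eq y,
      ae_restrict_mem measurableSet_Ioo] with x h1 h2 h3 hx
    rw [h1, Pi.sub_apply, coe_fnL, coe_fnL, ← h2, ← h3, ← dist_eq_norm, dist_comm]
    exact (hN k hk x hx).le
  have := Lp.norm_le_of_ae_bound (by positivity) this
  simpa [measureUnivNNReal] using this

/-- Bounded sequences whose functions converge uniformly converge weakly. -/
theorem TendstoC0.tendstoWeakly (hp : 1 < p) (hp' : p < ∞) {z : ℕ → W1p p} {y : W1p p}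
    (h : TendstoC0 z y) (hb : Bornology.IsBounded (range z)) : TendstoWeakly z y := by
  have hfn := h.tendsto_fnL
  obtain ⟨R, hR⟩ := hb.exists_norm_le
  have hR' : ∀ k, ‖z k‖ ≤ R := fun k => hR _ (mem_range_self k)
  have hR0 : 0 ≤ R := (norm_nonneg _).trans (hR' 0)
  have hq : 0 < p.toReal := ENNReal.toReal_pos (zero_lt_one.trans hp).ne' hp'.ne
  rw [tendstoWeakly_iff]
  by_contra hcon
  push Not at hcon
  -- If weak convergence fails, some functional, up to sign, exceeds its value at y by a fixed η
  -- infinitely often.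
  obtain ⟨T, η, hη, hfreq⟩ : ∃ T : W1p p →L[ℝ] ℝ, ∃ η : ℝ, 0 < η ∧
      ∃ᶠ k in atTop, T y + η ≤ T (z k) := by
    obtain ⟨T, hT⟩ := hcon
    rw [Metric.tendsto_nhds] at hT
    push Not at hT
    obtain ⟨η, hη, hf⟩ := hT
    have : ∃ᶠ k in atTop, T y + η ≤ T (z k) ∨ (-T) y + η ≤ (-T) (z k) := by
      refine hf.mono fun k hk => ?_
      rw [Real.dist_eq] at hk
      rcases le_abs.1 hk with h | h
      · left; linarith
      · right
        simp only [neg_apply]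
        linarith
    rcases frequently_or_distrib.1 this with h | h
    · exact ⟨T, η, hη, h⟩
    · exact ⟨-T, η, hη, h⟩
  -- Convex hulls of the tails of that subsequence: all their elements keep the excess η under T,
  -- and their functions are uniformly close to y in L^p for large k.
  set C : ℕ → Set (W1p p) := fun k => convexHull ℝ {w | ∃ j, k ≤ j ∧ w = z j ∧ T y + η ≤ T (z j)}
    with hC
  have hCanti : Antitone C := fun k l hkl => convexHull_mono (by
    rintro w ⟨j, hj, hw⟩
    exact ⟨j, hkl.trans hj, hw⟩)
  have hCne : ∀ k, (C k).Nonempty := fun k => by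
    obtain ⟨j, hj, hj'⟩ := frequently_atTop.1 hfreq k
    exact ⟨z j, subset_convexHull ℝ _ ⟨j, hj, rfl, hj'⟩⟩
  have hCconv : ∀ k, ∀ f ∈ C k, ∀ g ∈ C k, (1 / 2 : ℝ) • (f + g) ∈ C k := fun k f hf g hg => by
    rw [smul_add]
    exact convex_convexHull ℝ _ hf hg (by norm_num) (by norm_num) (by norm_num)
  have hCR : ∀ k, ∀ w ∈ C k, ‖w‖ ≤ R := by
    intro k w hw
    have : C k ⊆ Metric.closedBall 0 R := convexHull_min (by
      rintro w ⟨j, -, rfl, -⟩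
      rw [mem_closedBall_zero_iff]; exact hR' j) (convex_closedBall _ _)
    exact mem_closedBall_zero_iff.1 (this hw)
  have hCT : ∀ k, ∀ w ∈ C k, T y + η ≤ T w := by
    intro k w hw
    have : C k ⊆ {w | T y + η ≤ T w} := convexHull_min (by
      rintro w ⟨j, -, rfl, hj⟩
      exact hj) (convex_halfSpace_ge T.toLinearMap.isLinear _)
    exact this hw
  -- Almost minimizing the norm of the derivative makes the derivatives Cauchy by uniform convexity.
  -- The resulting convex combinations converge strongly to y, which contradicts the excess under T.
  obtain ⟨g, hgC, hgap⟩ := exists_almost_minimizers hCanti hCne hCconv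
    (Φ := fun w => ‖wderivL w‖ ^ p.toReal) (B := R ^ p.toReal) (fun w => by positivity)
    fun w hw => Real.rpow_le_rpow (norm_nonneg _) ((norm_wderivL_le w).trans (hCR 0 w hw)) hq.le
  have hgf : Tendsto (fun k => fnL (g k)) atTop (𝓝 (fnL y)) := by
    rw [Metric.tendsto_atTop] at hfn ⊢
    intro ε hε
    obtain ⟨N, hN⟩ := hfn (ε / 2) (by positivity)
    refine ⟨N, fun k hk => lt_of_le_of_lt ?_ (half_lt_self hε)⟩
    have hconv : Convex ℝ {w : W1p p | dist (fnL w) (fnL y) ≤ ε / 2} :=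
      (convex_closedBall (fnL y) (ε / 2)).is_linear_preimage (f := fun w : W1p p => fnL w)
        ⟨fun a b => map_add _ a b, fun c a => map_smul _ c a⟩
    have : C k ⊆ {w : W1p p | dist (fnL w) (fnL y) ≤ ε / 2} := convexHull_min (by
      rintro w ⟨j, hj, rfl, -⟩
      exact (hN j (hk.trans hj)).le) hconv
    exact this (hgC k)
  have hgd : CauchySeq fun k => wderivL (g k) := by
    refine cauchySeq_of_gap hp hp'.ne (fun k => (norm_wderivL_le _).trans (hCR k _ (hgC k)))
      fun δ hδ => ?_
    obtain ⟨N, hN⟩ := hgap δ hδ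
    refine ⟨N, fun k hk l hkl => ?_⟩
    have := hN k hk l hkl
    rwa [map_smul, map_add] at this
  have hlim := (T.continuous.tendsto y).comp (tendsto_of_cauchySeq hgf hgd)
  have := ge_of_tendsto' hlim fun k => hCT k _ (hgC k)
  linarith

end W1p

/-- Otherwise Hahn–Banach separates y strictly from s, and the separating functional contradicts the
convergence. -/
theorem Convex.mem_of_forall_tendsto {E : Type*} [NormedAddCommGroup E] [NormedSpace ℝ E]
    {s : Set E} (hs : Convex ℝ s) (hs' : IsClosed s) {z : ℕ → E} {y : E}
    (h : ∀ T : E →L[ℝ] ℝ, Tendsto (fun k => T (z k)) atTop (𝓝 (T y)))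
    (hz : ∀ k, z k ∈ s) : y ∈ s := by
  by_contra hy
  obtain ⟨T, u, h1, h2⟩ := geometric_hahn_banach_point_closed hs hs' hy
  exact absurd (ge_of_tendsto' (h T) fun k => (h2 _ (hz k)).le) (not_le.2 h1)

/-! ### The lower bound: weak lower semicontinuity -/

namespace W1p
variable {p : ℝ≥0∞} [Fact (1 ≤ p)]

section
variable {H : Plane → ℝ}

theorem aemeasurable_comp_wderiv (hHc : Continuous H) (y : W1p p) :
    AEMeasurable (fun x => ENNReal.ofReal (H (wderiv y x))) unitVol :=
  (hHc.comp_aestronglyMeasurable (memLp_wderiv y).1).aemeasurable.ennreal_ofReal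

theorem convex_sublevel (hH : ConvexOn ℝ univ H) (hHc : Continuous H) (c : ℝ≥0∞) :
    Convex ℝ {y : W1p p | ∫⁻ x, ENNReal.ofReal (H (wderiv y x)) ∂unitVol ≤ c} := by
  intro y hy z hz a b ha hb hab
  have hy' : ∫⁻ x, ENNReal.ofReal (H (wderiv y x)) ∂unitVol ≤ c := hy
  have hz' : ∫⁻ x, ENNReal.ofReal (H (wderiv z x)) ∂unitVol ≤ c := hz
  have hmy := aemeasurable_comp_wderiv hHc y
  have hmz := aemeasurable_comp_wderiv hHc z
  calc ∫⁻ x, ENNReal.ofReal (H (wderiv (a • y + b • z) x)) ∂unitVol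
      ≤ ∫⁻ x, (ENNReal.ofReal a * ENNReal.ofReal (H (wderiv y x)) +
          ENNReal.ofReal b * ENNReal.ofReal (H (wderiv z x))) ∂unitVol := by
        refine lintegral_mono_ae ?_
        filter_upwards [wderiv_add (a • y) (b • z), wderiv_smul a y, wderiv_smul b z] with x h1 h2 h3
        rw [h1, Pi.add_apply, h2, h3, Pi.smul_apply, Pi.smul_apply, ← ENNReal.ofReal_mul ha,
          ← ENNReal.ofReal_mul hb]
        exact (ENNReal.ofReal_le_ofReal (hH.2 (mem_univ _) (mem_univ _) ha hb hab)).trans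
          ENNReal.ofReal_add_le
    _ = ENNReal.ofReal a * ∫⁻ x, ENNReal.ofReal (H (wderiv y x)) ∂unitVol +
          ENNReal.ofReal b * ∫⁻ x, ENNReal.ofReal (H (wderiv z x)) ∂unitVol := by
        rw [lintegral_add_left' (hmy.const_mul _), lintegral_const_mul'' _ hmy,
          lintegral_const_mul'' _ hmz]
    _ ≤ ENNReal.ofReal a * c + ENNReal.ofReal b * c := by gcongr
    _ = c := by rw [← add_mul, ← ENNReal.ofReal_add ha hb, hab, ENNReal.ofReal_one, one_mul]

/-- Strong convergence gives a subsequence whose derivatives converge almost everywhere, and Fatou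
applies since the integrand is nonnegative. -/
theorem isClosed_sublevel (hHc : Continuous H) (c : ℝ≥0∞) :
    IsClosed {y : W1p p | ∫⁻ x, ENNReal.ofReal (H (wderiv y x)) ∂unitVol ≤ c} := by
  refine IsSeqClosed.isClosed fun z y hz hzy => ?_
  have h1 : Tendsto (fun k => wderivL (z k)) atTop (𝓝 (wderivL y)) :=
    (wderivL.continuous.tendsto y).comp hzy
  obtain ⟨φ, -, hφ⟩ := (tendstoInMeasure_of_tendsto_Lp h1).exists_seq_tendsto_ae
  calc ∫⁻ x, ENNReal.ofReal (H (wderiv y x)) ∂unitVol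
      = ∫⁻ x, liminf (fun i => ENNReal.ofReal (H (wderiv (z (φ i)) x))) atTop ∂unitVol := by
        refine lintegral_congr_ae (hφ.mono fun x hx => ?_)
        exact ((ENNReal.continuous_ofReal.tendsto _).comp
          ((hHc.tendsto _).comp hx)).liminf_eq.symm
    _ ≤ liminf (fun i => ∫⁻ x, ENNReal.ofReal (H (wderiv (z (φ i)) x)) ∂unitVol) atTop :=
        lintegral_liminf_le' fun i => aemeasurable_comp_wderiv hHc _
    _ ≤ liminf (fun _ : ℕ => c) atTop := liminf_le_liminf (Eventually.of_forall fun i => hz (φ i))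
    _ = c := liminf_const c

/-- Weak lower semicontinuity of integral functionals with convex integrand. -/
theorem TendstoWeakly.lintegral_le (hH : ConvexOn ℝ univ H) (hHc : Continuous H) {c : ℝ≥0∞}
    {z : ℕ → W1p p} {y : W1p p} (h : TendstoWeakly z y)
    (hz : ∀ k, ∫⁻ x, ENNReal.ofReal (H (wderiv (z k) x)) ∂unitVol ≤ c) :
    ∫⁻ x, ENNReal.ofReal (H (wderiv y x)) ∂unitVol ≤ c := by
  rw [tendstoWeakly_iff] at h
  have h1 := convex_sublevel (p := p) hH hHc c
  have h2 := isClosed_sublevel (p := p) hHc c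
  have h3 := Convex.mem_of_forall_tendsto h1 h2 (z := z) (y := y)
  exact h3 h hz

end

theorem TendstoWeakly.nonInterpenetrative (hp : 1 < p) (hp' : p < ∞) {z : ℕ → W1p p} {y : W1p p}
    (h : TendstoWeakly z y) (hz : ∀ k, IsHomeo (z k)) : NonInterpenetrative y :=
  ⟨z, h.isBounded, hz, tendstoC0_iff.2 ((h.tendstoUniformlyOn hp hp').mono Ioo_subset_Icc_self)⟩

theorem isHomeo_of_energy_lt {f : Plane → ℝ≥0∞} {y : W1p p} {c : ℝ≥0∞} (h : energy f y < c) :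
    IsHomeo y := by
  by_contra hn
  rw [energy, if_neg hn] at h
  exact not_top_lt h

/-- For every c above the lower limit there is a subsequence with energy below c. Finite energy
makes its members homeomorphisms, so y is non-interpenetrative, and the sublevel set of the
convexified functional at c is weakly closed. -/
theorem convexEnergy_le_liminf (hp : 1 < p) (hp' : p < ∞) {f : Plane → ℝ≥0∞}
    (hfin : ∀ a, a ≠ 0 → f a < ∞) {z : ℕ → W1p p} {y : W1p p} (h : TendstoWeakly z y) :
    convexEnergy f y ≤ liminf (fun k => energy f (z k)) atTop := by
  refine le_of_forall_gt_imp_ge_of_dense fun c hc => ?_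
  obtain ⟨φ, hφ, hφc⟩ := extraction_of_frequently_atTop (frequently_lt_of_liminf_lt (by isBoundedDefault) hc)
  have hw := h.comp hφ.tendsto_atTop
  have hhom : ∀ k, IsHomeo ((z ∘ φ) k) := fun k => isHomeo_of_energy_lt (hφc k)
  rw [convexEnergy, if_pos (hw.nonInterpenetrative hp hp' hhom)]
  simp only [convexEnvelope_eq hfin]
  refine hw.lintegral_le (convexOn_hullFn hfin) (continuous_hullFn hfin) fun k => ?_
  refine le_trans (lintegral_mono fun x => ofReal_hullFn_le _) ?_
  have := (hφc k).le
  have hk : IsHomeo (z (φ k)) := hhom k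
  rwa [energy, if_pos hk] at this

end W1p

/-! ### The upper bound: recovery sequences -/

namespace W1p
variable {p : ℝ≥0∞} [Fact (1 ≤ p)]

/-- Non-interpenetrative maps are uniform limits of arcs of bounded length. -/
theorem NonInterpenetrative.exists_arcs {y : W1p p} (hy : NonInterpenetrative y) :
    ∃ L R : ℝ, ∀ ε : ℝ, 0 < ε → ∃ (z : ℝ → Plane) (V : ℝ → ℝ), ContinuousOn z (Icc 0 1) ∧
      InjOn z (Icc 0 1) ∧ (∀ t ∈ Icc (0 : ℝ) 1, ‖z t‖ ≤ R) ∧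
      (∀ s ∈ Icc (0 : ℝ) 1, ∀ t ∈ Icc (0 : ℝ) 1, s ≤ t → dist (z t) (z s) ≤ V t - V s) ∧
      V 1 - V 0 ≤ L ∧ ∀ t ∈ Icc (0 : ℝ) 1, dist (z t) (rep y t) ≤ ε := by
  obtain ⟨w, hb, hhom, hC0⟩ := hy
  obtain ⟨B, hB⟩ := hb.exists_norm_le
  rw [tendstoC0_iff, Metric.tendstoUniformlyOn_iff] at hC0
  refine ⟨B, 2 * B, fun ε hε => ?_⟩
  obtain ⟨ω, hω, hmod⟩ := Metric.uniformContinuousOn_iff.1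
    ((isCompact_Icc (a := (0 : ℝ)) (b := 1)).uniformContinuousOn_of_continuous
      (continuous_rep y).continuousOn) (ε / 2) (half_pos hε)
  obtain ⟨k, hk⟩ := (hC0 (ε / 2) (half_pos hε)).exists
  have hBk : ‖w k‖ ≤ B := hB _ (mem_range_self k)
  obtain ⟨a, ha, ha4, haω⟩ : ∃ a : ℝ, 0 < a ∧ a ≤ 1 / 4 ∧ a < ω :=
    ⟨min (1 / 4) (ω / 2), by positivity, min_le_left _ _,
      (min_le_right _ _).trans_lt (half_lt_self hω)⟩
  -- The homeomorphism is injective only on the open interval. Composing with an affine map of [0,1]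
  -- into (0,1) close to the identity gives an arc with its ends.
  set θ : ℝ → ℝ := fun t => a + (1 - 2 * a) * t with hθ
  have hθI : ∀ t ∈ Icc (0 : ℝ) 1, θ t ∈ Ioo (0 : ℝ) 1 := fun t ht => by
    obtain ⟨h0, h1⟩ := ht
    constructor <;> simp only [hθ] <;> nlinarith
  have hθmono : ∀ s t, s ≤ t → θ s ≤ θ t := fun s t hst => by
    simp only [hθ]; nlinarith
  have hθd : ∀ t ∈ Icc (0 : ℝ) 1, dist (θ t) t < ω := fun t ht => by
    obtain ⟨h0, h1⟩ := ht
    rw [Real.dist_eq, abs_lt]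
    constructor <;> simp only [hθ] <;> nlinarith
  have hθc : Continuous θ := by fun_prop
  have hi := (integrable_wderiv (w k)).norm
  set V : ℝ → ℝ := fun t => ∫ x in (0 : ℝ)..θ t, ‖wderiv (w k) x‖ ∂unitVol with hV
  have hVsub : ∀ s t, s ≤ t → V t - V s = ∫ x in Ioc (θ s) (θ t), ‖wderiv (w k) x‖ ∂unitVol := by
    intro s t hst
    simp only [hV]
    rw [intervalIntegral.integral_interval_sub_left hi.intervalIntegrable hi.intervalIntegrable,
      intervalIntegral.integral_of_le (hθmono s t hst)]
  refine ⟨fun t => rep (w k) (θ t), V, ((continuous_rep (w k)).comp hθc).continuousOn,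
    fun s hs t ht hst => ?_, fun t _ => (norm_rep_le _ _).trans (by linarith),
    fun s _ t _ hst => ?_, ?_, fun t ht => ?_⟩
  · have h := (hhom k).injOn (hθI s hs) (hθI t ht) hst
    simp only [hθ] at h
    have h' : (1 - 2 * a) * s = (1 - 2 * a) * t := by linarith
    exact mul_left_cancel₀ (by linarith) h'
  · rw [hVsub s t hst]
    exact dist_rep_le_integral _ (hθmono s t hst)
  · rw [hVsub 0 1 zero_le_one]
    exact ((setIntegral_le_integral hi (ae_of_all _ fun _ => norm_nonneg _)).trans
      (integral_norm_wderiv_le _)).trans hBk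
  · have h1 := hk (θ t) (hθI t ht)
    have h2 := hmod (θ t) (Ioo_subset_Icc_self (hθI t ht)) t ht (hθd t ht)
    rw [dist_comm] at h1
    linarith [dist_triangle (rep (w k) (θ t)) (rep y (θ t)) (rep y t)]

theorem integrable_comp_wderiv (hp' : p < ∞) {H : Plane → ℝ} (hHc : Continuous H)
    (hH0 : ∀ a, 0 ≤ H a) {C : ℝ} (hgr : ∀ a, H a ≤ C * (1 + ‖a‖ ^ p.toReal)) (y : W1p p) :
    Integrable (fun x => H (wderiv y x)) unitVol := by
  have h1 := integrable_norm_rpow_Lp hp'.ne (wderivL y)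
  refine Integrable.mono' (((integrable_const (1 : ℝ)).add h1).const_mul C)
    (hHc.comp_aestronglyMeasurable (memLp_wderiv y).1) (ae_of_all _ fun x => ?_)
  rw [Real.norm_of_nonneg (hH0 _)]
  exact hgr _

theorem integrable_powBound_wderiv (hp' : p < ∞) (y : W1p p) :
    Integrable (fun x => powBound p.toReal (wderiv y x)) unitVol := by
  have h1 : MemLp (fun x => 2 * ‖wderiv y x‖ + 1) p unitVol :=
    ((memLp_wderiv y).norm.const_mul 2).add (memLp_const 1)
  have h2 := h1.integrable_norm_rpow (zero_lt_one.trans_le Fact.out).ne' hp'.ne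
  refine ((integrable_const (1 : ℝ)).add h2).congr (ae_of_all _ fun x => ?_)
  simp only [Pi.add_apply, powBound]
  rw [Real.norm_of_nonneg (by positivity)]

section
variable {f : Plane → ℝ≥0∞}

theorem lintegral_convexEnvelope (hp' : p < ∞) (hfin : ∀ a, a ≠ 0 → f a < ∞) {C : ℝ}
    (hgr : ∀ a, hullFn f a ≤ C * (1 + ‖a‖ ^ p.toReal)) (y : W1p p) :
    ∫⁻ x, convexEnvelope f (wderiv y x) ∂unitVol =
      ENNReal.ofReal (∫ x, hullFn f (wderiv y x) ∂unitVol) := by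
  simp only [convexEnvelope_eq hfin]
  exact (ofReal_integral_eq_lintegral_ofReal
    (integrable_comp_wderiv hp' (continuous_hullFn hfin) hullFn_nonneg hgr y)
    (ae_of_all _ fun x => hullFn_nonneg _)).symm

/-- First a polygonal map with almost the convexified energy of y, then zigzags on its pieces to
reach that energy with f itself. -/
theorem NonInterpenetrative.exists_PAff (hp : 1 < p) (hp' : p < ∞) (hf_zero : f 0 = ∞)
    (hfin : ∀ a, a ≠ 0 → f a < ∞) (hf_cont : ContinuousOn f {0}ᶜ) {C : ℝ} (hC : 0 ≤ C)
    (hgr : ∀ a, hullFn f a ≤ C * (1 + ‖a‖ ^ p.toReal)) {y : W1p p} (hy : NonInterpenetrative y)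
    {ε : ℝ} (hε : 0 < ε) :
    ∃ u, PAff u 0 1 ∧ InjOn u (Icc 0 1) ∧ (∀ x ∈ Icc (0 : ℝ) 1, dist (u x) (rep y x) ≤ ε) ∧
      energyOn f u 0 1 ≤ ∫⁻ x, convexEnvelope f (wderiv y x) ∂unitVol + ENNReal.ofReal ε := by
  have hq : 1 ≤ p.toReal := by
    have := ENNReal.toReal_mono hp'.ne hp.le
    simpa using this
  have hI := integrable_comp_wderiv hp' (continuous_hullFn hfin) hullFn_nonneg hgr y
  obtain ⟨L, R, harc⟩ := hy.exists_arcs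
  obtain ⟨u, hu, hui, huy, hue⟩ := exists_PA_approx (convexOn_hullFn hfin) (continuous_hullFn hfin)
    hullFn_nonneg hC hq hgr (y := rep y) (g := wderiv y)
    (by rw [IntegrableOn, ← unitVol_eq]; exact integrable_wderiv y)
    (by rw [IntegrableOn, ← unitVol_eq]; exact hI)
    (by rw [IntegrableOn, ← unitVol_eq]; exact integrable_powBound_wderiv hp' y)
    (fun a b ha hab hb => by rw [rep_sub y hab, unitVol_restrict_Ioc ha hb])
    (continuous_rep y).continuousOn harc (half_pos (half_pos hε))
  obtain ⟨w, hw, hwi, hwu, hwe⟩ := exists_relaxed hfin hf_cont hf_zero hu hui (half_pos hε)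
  refine ⟨w, hw, hwi, fun x hx => ?_, ?_⟩
  · linarith [hwu x, huy x hx, dist_triangle (w x) (u x) (rep y x)]
  · rw [lintegral_convexEnvelope hp' hfin hgr, unitVol_eq]
    refine (hwe.trans (add_le_add_left hue _)).trans ?_
    have h0 : 0 ≤ ∫ x in Ioc (0 : ℝ) 1, hullFn f (wderiv y x) :=
      integral_nonneg fun x => hullFn_nonneg _
    rw [← ENNReal.ofReal_add (by positivity) (by positivity), ← ENNReal.ofReal_add h0 hε.le]
    exact ENNReal.ofReal_le_ofReal (by linarith)

theorem norm_le_add (y : W1p p) : ‖y‖ ≤ ‖fnL y‖ + ‖wderivL y‖ := by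
  have h : (y : WithLp p (Lp Plane p unitVol × Lp Plane p unitVol)) =
      WithLp.toLp p (fnL y, 0) + WithLp.toLp p (0, wderivL y) := by
    rw [← WithLp.toLp_add, Prod.mk_add_mk, add_zero, zero_add]
    rfl
  calc ‖y‖ = ‖(y : WithLp p (Lp Plane p unitVol × Lp Plane p unitVol))‖ := rfl
    _ ≤ _ := by
      rw [h]
      refine (norm_add_le _ _).trans ?_
      rw [WithLp.norm_toLp_fst, WithLp.norm_toLp_snd]

theorem energy_mono {f g : Plane → ℝ≥0∞} (h : ∀ a, f a ≤ g a) (y : W1p p) :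
    energy f y ≤ energy g y := by
  unfold energy
  split_ifs
  · exact lintegral_mono fun x => h _
  · exact le_rfl

theorem norm_wderivL_le_of_coercive (hp' : p < ∞) {c C : ℝ} (hc : 0 < c)
    (hco : ∀ a : Plane, ENNReal.ofReal (c * ‖a‖ ^ p.toReal - C) ≤ f a) {E : ℝ≥0∞} (hE : E ≠ ∞)
    {y : W1p p} (hy : ∫⁻ x, f (wderiv y x) ∂unitVol ≤ E) :
    ‖wderivL y‖ ≤ ((E + ENNReal.ofReal |C|).toReal / c) ^ p.toReal⁻¹ := by
  have hq : 0 < p.toReal := ENNReal.toReal_pos (zero_lt_one.trans_le Fact.out).ne' hp'.ne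
  have h1 : ∀ a : Plane, ENNReal.ofReal (c * ‖a‖ ^ p.toReal) ≤ f a + ENNReal.ofReal |C| := by
    intro a
    refine le_trans ?_ (add_le_add_left (hco a) _)
    refine le_trans (ENNReal.ofReal_le_ofReal ?_) ENNReal.ofReal_add_le
    linarith [le_abs_self C]
  have h2 : ENNReal.ofReal (∫ x, c * ‖wderivL y x‖ ^ p.toReal ∂unitVol) ≤
      E + ENNReal.ofReal |C| := by
    rw [ofReal_integral_eq_lintegral_ofReal ((integrable_norm_rpow_Lp hp'.ne _).const_mul c)
      (ae_of_all _ fun x => by positivity)]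
    calc _ ≤ ∫⁻ x, (f (wderiv y x) + ENNReal.ofReal |C|) ∂unitVol :=
          lintegral_mono fun x => h1 _
      _ = ∫⁻ x, f (wderiv y x) ∂unitVol + ENNReal.ofReal |C| := by
          rw [lintegral_add_right _ measurable_const, lintegral_const, measure_univ, mul_one]
      _ ≤ _ := add_le_add_left hy _
  rw [integral_const_mul, ← Lp_norm_rpow_eq hp'.ne] at h2
  have h3 := (ENNReal.ofReal_le_iff_le_toReal
    (ENNReal.add_ne_top.2 ⟨hE, ENNReal.ofReal_ne_top⟩)).1 h2
  rw [Real.le_rpow_inv_iff_of_pos (norm_nonneg _) (by positivity) hq, le_div_iff₀ hc, mul_comm]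
  exact h3

/-- Recovery sequences of piecewise affine homeomorphisms for coercive densities. -/
theorem NonInterpenetrative.exists_recovery (hp : 1 < p) (hp' : p < ∞) (hf_zero : f 0 = ∞)
    (hfin : ∀ a, a ≠ 0 → f a < ∞) (hf_cont : ContinuousOn f {0}ᶜ)
    (hf_growth : ∀ δ : ℝ, 0 < δ → ∃ c : ℝ, 0 < c ∧
      ∀ a : Plane, δ ≤ ‖a‖ → f a ≤ ENNReal.ofReal (c * (1 + ‖a‖ ^ p.toReal)))
    {c C : ℝ} (hc : 0 < c) (hco : ∀ a : Plane, ENNReal.ofReal (c * ‖a‖ ^ p.toReal - C) ≤ f a)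
    {y : W1p p} (hy : NonInterpenetrative y) :
    ∃ z : ℕ → W1p p, (∀ k, IsHomeo (z k) ∧ IsPiecewiseAffine (z k)) ∧ TendstoWeakly z y ∧
      ∀ k : ℕ, energy f (z k) ≤ convexEnergy f y + ENNReal.ofReal (1 / ((k : ℝ) + 1)) := by
  obtain ⟨D, hD, hgr⟩ := hullFn_growth hfin ENNReal.toReal_nonneg hf_growth
  have hε : ∀ k : ℕ, (0 : ℝ) < 1 / ((k : ℝ) + 1) := fun k => by positivity
  have hε1 : ∀ k : ℕ, 1 / ((k : ℝ) + 1) ≤ 1 := fun k => by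
    rw [div_le_one (by positivity)]
    linarith [(Nat.cast_nonneg k : (0 : ℝ) ≤ k)]
  choose u hu hui huy hue using fun k : ℕ =>
    hy.exists_PAff hp hp' hf_zero hfin hf_cont hD.le hgr (hε k)
  choose z hz1 hz2 hz3 hz4 using fun k : ℕ => exists_of_PAff (p := p) (hu k) (hui k)
  have hlin : ∀ k, ∫⁻ x, f (wderiv (z k) x) ∂unitVol ≤
      ∫⁻ x, convexEnvelope f (wderiv y x) ∂unitVol + ENNReal.ofReal (1 / ((k : ℝ) + 1)) := by
    intro k
    rw [lintegral_congr_ae ((hz3 k).mono fun x hx => by rw [hx])]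
    refine le_trans (le_of_eq ?_) (hue k)
    rw [energyOn, ← unitVol_eq]
  have hEtop : ∫⁻ x, convexEnvelope f (wderiv y x) ∂unitVol + ENNReal.ofReal 1 ≠ ∞ := by
    rw [lintegral_convexEnvelope hp' hfin hgr]
    exact ENNReal.add_ne_top.2 ⟨ENNReal.ofReal_ne_top, ENNReal.ofReal_ne_top⟩
  have hC0 : TendstoC0 z y := by
    rw [tendstoC0_iff, Metric.tendstoUniformlyOn_iff]
    intro η hη
    filter_upwards [(tendsto_one_div_add_atTop_nhds_zero_nat (𝕜 := ℝ)).eventually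
      (gt_mem_nhds hη)] with k hk x hx
    rw [hz4 k (Ioo_subset_Icc_self hx), dist_comm]
    exact (huy k x (Ioo_subset_Icc_self hx)).trans_lt hk
  -- Uniform closeness to y bounds the functions and coercivity bounds the derivatives; together
  -- with uniform convergence this yields weak convergence.
  have hb : Bornology.IsBounded (range z) := by
    refine isBounded_iff_forall_norm_le.2 ⟨(2 * ‖y‖ + 1) + ((∫⁻ x, convexEnvelope f (wderiv y x)
      ∂unitVol + ENNReal.ofReal 1 + ENNReal.ofReal |C|).toReal / c) ^ p.toReal⁻¹, ?_⟩
    rintro _ ⟨k, rfl⟩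
    refine (norm_le_add _).trans (add_le_add ?_ ?_)
    · have : ∀ᵐ x ∂unitVol, ‖fnL (z k) x‖ ≤ 2 * ‖y‖ + 1 := by
        filter_upwards [rep_ae_eq (z k), ae_restrict_mem measurableSet_Ioo] with x h1 hx
        have hx' := Ioo_subset_Icc_self hx
        rw [coe_fnL, ← h1, hz4 k hx']
        have h2 := huy k x hx'
        rw [dist_eq_norm] at h2
        linarith [norm_le_norm_add_norm_sub' (u k x) (rep y x), norm_rep_le y x, hε1 k]
      have := Lp.norm_le_of_ae_bound (by positivity) this
      simpa [measureUnivNNReal] using this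
    · exact norm_wderivL_le_of_coercive hp' hc hco hEtop
        ((hlin k).trans (by gcongr; exact hε1 k))
  refine ⟨z, fun k => ⟨hz1 k, hz2 k⟩, hC0.tendstoWeakly hp hp' hb, fun k => ?_⟩
  rw [energy, if_pos (hz1 k), convexEnergy, if_pos hy]
  exact hlin k

end

end W1p

/-! ### Densities without coercivity, and the conclusion -/

theorem tendsto_add_ofReal_one_div (c : ℝ≥0∞) :
    Tendsto (fun k : ℕ => c + ENNReal.ofReal (1 / ((k : ℝ) + 1))) atTop (𝓝 c) := by
  have := (ENNReal.continuous_ofReal.tendsto 0).comp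
    (tendsto_one_div_add_atTop_nhds_zero_nat (𝕜 := ℝ))
  rw [ENNReal.ofReal_zero] at this
  simpa using this.const_add c

/-- A coercive perturbation of `f`. -/
def perturb (f : Plane → ℝ≥0∞) (q : ℝ) (n : ℕ) (a : Plane) : ℝ≥0∞ :=
  f a + ENNReal.ofReal (1 / (n + 1 : ℝ) * ‖a‖ ^ q)

theorem perturb_growth {f : Plane → ℝ≥0∞} {q : ℝ} (hf_growth : ∀ δ : ℝ, 0 < δ → ∃ c : ℝ, 0 < c ∧
      ∀ a : Plane, δ ≤ ‖a‖ → f a ≤ ENNReal.ofReal (c * (1 + ‖a‖ ^ q))) (n : ℕ) :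
    ∀ δ : ℝ, 0 < δ → ∃ c : ℝ, 0 < c ∧
      ∀ a : Plane, δ ≤ ‖a‖ → perturb f q n a ≤ ENNReal.ofReal (c * (1 + ‖a‖ ^ q)) := by
  intro δ hδ
  obtain ⟨c, hc, h⟩ := hf_growth δ hδ
  refine ⟨c + 1, by linarith, fun a ha => ?_⟩
  refine (add_le_add_left (h a ha) _).trans ?_
  rw [← ENNReal.ofReal_add (by positivity) (by positivity)]
  apply ENNReal.ofReal_le_ofReal
  have h1 : 1 / (n + 1 : ℝ) * ‖a‖ ^ q ≤ 1 * ‖a‖ ^ q := by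
    gcongr
    rw [div_le_one (by positivity)]
    linarith [(Nat.cast_nonneg n : (0 : ℝ) ≤ n)]
  linarith

theorem continuousOn_perturb {f : Plane → ℝ≥0∞} {q : ℝ} (hq : 0 ≤ q)
    (hf : ContinuousOn f {0}ᶜ) (n : ℕ) : ContinuousOn (perturb f q n) {0}ᶜ :=
  hf.add (ENNReal.continuous_ofReal.comp (continuous_const.mul
    (continuous_norm.rpow_const fun _ => Or.inr hq))).continuousOn

namespace W1p
variable {p : ℝ≥0∞} [Fact (1 ≤ p)] {f : Plane → ℝ≥0∞}

/-- Dominated convergence: the envelopes converge pointwise, and the one for n = 0 is an integrable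
majorant by its growth of order p. -/
theorem tendsto_convexEnergy_perturb (hp' : p < ∞) (hfin : ∀ a, a ≠ 0 → f a < ∞)
    (hf_growth : ∀ δ : ℝ, 0 < δ → ∃ c : ℝ, 0 < c ∧
      ∀ a : Plane, δ ≤ ‖a‖ → f a ≤ ENNReal.ofReal (c * (1 + ‖a‖ ^ p.toReal)))
    {y : W1p p} (hy : NonInterpenetrative y) :
    Tendsto (fun n => convexEnergy (perturb f p.toReal n) y) atTop (𝓝 (convexEnergy f y)) := by
  have hfinn : ∀ n a, a ≠ 0 → perturb f p.toReal n a < ∞ := fun n a ha =>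
    ENNReal.add_lt_top.2 ⟨hfin a ha, ENNReal.ofReal_lt_top⟩
  obtain ⟨D, hD, hgr⟩ := hullFn_growth (hfinn 0) ENNReal.toReal_nonneg (perturb_growth hf_growth 0)
  have hle : ∀ n a, convexEnvelope (perturb f p.toReal n) a ≤
      convexEnvelope (perturb f p.toReal 0) a := fun n a => by
    refine iSup₂_mono fun g hg => iSup_mono' fun h => ⟨fun b => (h b).trans ?_, le_rfl⟩
    unfold perturb
    gcongr
    simp
  simp only [convexEnergy, if_pos hy]
  refine tendsto_lintegral_of_dominated_convergence'
    (fun x => convexEnvelope (perturb f p.toReal 0) (wderiv y x)) (fun n => ?_)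
    (fun n => ae_of_all _ fun x => hle n _) ?_ (ae_of_all _ fun x => ?_)
  · simp only [convexEnvelope_eq (hfinn n)]
    exact aemeasurable_comp_wderiv (continuous_hullFn (hfinn n)) y
  · rw [lintegral_convexEnvelope hp' (hfinn 0) hgr]
    exact ENNReal.ofReal_ne_top
  · simp only [convexEnvelope_eq (hfinn _), convexEnvelope_eq hfin]
    exact (ENNReal.continuous_ofReal.tendsto _).comp (tendsto_hullFn_add hfin p.toReal _)

/-- The perturbed density is coercive and has recovery sequences, which are admissible for f at no
higher energy; then n tends to infinity. -/
theorem relaxedEnergyPA_le_convexEnergy (hp : 1 < p) (hp' : p < ∞) (hf_zero : f 0 = ∞)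
    (hfin : ∀ a, a ≠ 0 → f a < ∞) (hf_cont : ContinuousOn f {0}ᶜ)
    (hf_growth : ∀ δ : ℝ, 0 < δ → ∃ c : ℝ, 0 < c ∧
      ∀ a : Plane, δ ≤ ‖a‖ → f a ≤ ENNReal.ofReal (c * (1 + ‖a‖ ^ p.toReal))) (y : W1p p) :
    relaxedEnergyPA f y ≤ convexEnergy f y := by
  by_cases hy : NonInterpenetrative y
  swap
  · rw [convexEnergy, if_neg hy]
    exact le_top
  refine ge_of_tendsto' (tendsto_convexEnergy_perturb hp' hfin hf_growth hy) fun n => ?_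
  obtain ⟨z, hz, hzy, hzE⟩ := hy.exists_recovery (f := perturb f p.toReal n) hp hp'
    (by rw [perturb, hf_zero, top_add])
    (fun a ha => ENNReal.add_lt_top.2 ⟨hfin a ha, ENNReal.ofReal_lt_top⟩)
    (continuousOn_perturb ENNReal.toReal_nonneg hf_cont n) (perturb_growth hf_growth n)
    (c := 1 / (n + 1 : ℝ)) (C := 0) (by positivity)
    (fun a => by rw [sub_zero]; exact le_add_self)
  have hle : relaxedEnergyPA f y ≤ liminf (fun k => energy f (z k)) atTop := by
    unfold relaxedEnergyPA
    exact iInf_le_of_le z (iInf_le_of_le hzy (iInf_le _ hz))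
  refine hle.trans ?_
  rw [← (tendsto_add_ofReal_one_div (convexEnergy (perturb f p.toReal n) y)).liminf_eq]
  exact liminf_le_liminf (Eventually.of_forall fun k =>
    (energy_mono (fun a => le_self_add) _).trans (hzE k))

theorem relaxedEnergy_le_relaxedEnergyPA (y : W1p p) : relaxedEnergy f y ≤ relaxedEnergyPA f y :=
  iInf₂_mono fun _ _ => le_iInf fun _ => le_rfl

theorem convexEnergy_le_relaxedEnergy (hp : 1 < p) (hp' : p < ∞) (hfin : ∀ a, a ≠ 0 → f a < ∞)
    (y : W1p p) : convexEnergy f y ≤ relaxedEnergy f y :=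
  le_iInf₂ fun _ hz => convexEnergy_le_liminf hp hp' hfin hz

end W1p

end

theorem lemma4p2 (p : ℝ≥0∞) [Fact (1 ≤ p)] (hp : 1 < p) (hp' : p < ∞)
    (f : Plane → ℝ≥0∞)
    (hf_zero : f 0 = ∞)
    (hf_fin : ∀ a, a ≠ 0 → f a < ∞)
    (hf_cont : ContinuousOn f {0}ᶜ)
    (hf_growth : ∀ δ : ℝ, 0 < δ → ∃ c : ℝ, 0 < c ∧
      ∀ a : Plane, δ ≤ ‖a‖ → f a ≤ ENNReal.ofReal (c * (1 + ‖a‖ ^ p.toReal))) :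
    -- the relaxation is the convexified functional on non-interpenetrative maps
    (∀ y : W1p p, W1p.relaxedEnergy f y = W1p.convexEnergy f y) ∧
    -- piecewise affine homeomorphisms suffice in the infimum
    (∀ y : W1p p, W1p.relaxedEnergyPA f y = W1p.relaxedEnergy f y) ∧
    -- if `f` is coercive, the infimum is attained by piecewise affine homeomorphisms
    ((∃ c C : ℝ, 0 < c ∧ ∀ a : Plane, ENNReal.ofReal (c * ‖a‖ ^ p.toReal - C) ≤ f a) →
      ∀ y : W1p p, W1p.NonInterpenetrative y →
        ∃ z : ℕ → W1p p, (∀ k, W1p.IsHomeo (z k) ∧ W1p.IsPiecewiseAffine (z k)) ∧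
          W1p.TendstoWeakly z y ∧
          Tendsto (fun k => W1p.energy f (z k)) atTop (𝓝 (W1p.relaxedEnergy f y))) := by
  have h1 : ∀ y : W1p p, W1p.relaxedEnergy f y = W1p.convexEnergy f y := fun y =>
    le_antisymm ((W1p.relaxedEnergy_le_relaxedEnergyPA y).trans
      (W1p.relaxedEnergyPA_le_convexEnergy hp hp' hf_zero hf_fin hf_cont hf_growth y))
      (W1p.convexEnergy_le_relaxedEnergy hp hp' hf_fin y)
  refine ⟨h1, fun y => le_antisymm ?_ (W1p.relaxedEnergy_le_relaxedEnergyPA y), ?_⟩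
  · rw [h1]
    exact W1p.relaxedEnergyPA_le_convexEnergy hp hp' hf_zero hf_fin hf_cont hf_growth y
  · rintro ⟨c, C, hc, hco⟩ y hy
    obtain ⟨z, hz, hzy, hzE⟩ := hy.exists_recovery hp hp' hf_zero hf_fin hf_cont hf_growth hc hco
    refine ⟨z, hz, hzy, ?_⟩
    rw [h1]
    refine tendsto_of_le_liminf_of_limsup_le (W1p.convexEnergy_le_liminf hp hp' hf_fin hzy) ?_
    rw [← (tendsto_add_ofReal_one_div (W1p.convexEnergy f y)).limsup_eq]
    exact limsup_le_limsup (Eventually.of_forall hzE)
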